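/- Let $\mathbb T=\mathbb R/\mathbb Z$. Let $\alpha=(\alpha_1,\dots,\alpha_4)\in[0,1]^4$, let $q^{(j)}_n$ be the denominators of the convergents of $\alpha_j$ ($q_0=1$, $q_1=a_1$, $q_n=a_nq_{n-1}+q_{n-2}$), and assume that for all $n\ge 1$ $$q_n^{(2)}\ge e^{nq_n^{(1)}},\quad q_n^{(3)}\ge e^{nq_n^{(2)}},\quad q_n^{(4)}\ge e^{nq_n^{(3)}},\quad q_{n+1}^{(1)}\ge e^{nq_n^{(4)}}.$$ Let $n_0$ be such that the function $$\varphi(x)=1+\sum_{j=1}^4\sum_{n\ge n_0}\frac{\cos(2\pi q_n^{(j)}x_j)}{e^{q_n^{(j)}}}$$ is strictly positive on $\mathbb T^4$. Let $T^t=T^t_{\alpha,\varphi}$ be the special flow over $R_\alpha:x\mapsto x+\alpha$ and under $\varphi$, on $M=\{(x,s)\in\mathbb T^4\times\mathbb R: 0\le s<\varphi(x)\}$, that is, $T^t(x,s)=(x+N\alpha,\,t+s-S_N\varphi(x))$, where $S_N\varphi$ ($N\in\mathbb Z$) are the Birkhoff sums of $\varphi$ over $R_\alpha$ and $N$ is the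 unique integer with $0\le t+s-S_N\varphi(x)<\varphi(x+N\alpha)$. Let $\mu$ be the restriction to $M$ of $\lambda_4\times\lambda$ ($\lambda_4$ the Haar probability measure of $\mathbb T^4$, $\lambda$ Lebesgue measure), and $M_\zeta=\{(x,s)\in M: s\le\varphi(x)-\zeta\}$. $C^\infty(M)$ is the space of smooth functions on the manifold $\mathbb T^4\times\mathbb R/\big((x,s+\varphi(x))\sim(x+\alpha,s)\big)$, of which $M$ is a fundamental domain. Write $\langle f\circ T^t,g\rangle=\int_M f(T^tz)\,g(z)\,d\mu(z)$. For a multi-interval $J=I_1\times\dots\times I_4\subset\mathbb T^4$ let $T_J$ be the largest real number such that $T^t(J\times\{0\})\cap (J\times\{0\})=\emptyset$ for $0<|t|<T_J$. For $T,C,\zeta>0$ let $R^T_J=\bigcup_{|t|<T}T^t(J\times\{0\})$ and $S^T_\zeta(J)=\{t\in(-T,T): T^t(J\times\{0\})\subset M_\zeta\}$. * $\mathcal G(J,T,C,\zeta)$ is the set of all $g\in C^\infty(M)$ that vanish outside $R^T_J$ and satisfy $g(T^t(x,0))=\chi(x)\psi(t)$ for $(x,t)\in J\times(-T,T)$, where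 $\psi\in C^\infty_0(\mathbb R,\mathbb R)$ vanishes outside $S^T_\zeta(J)$ and $\|\psi\|_{C^1}=\|\psi\|_0+\|\psi'\|_0\le C$, and where $\chi\in C^\infty(\mathbb T^4,\mathbb R)$ vanishes outside $J$, $\int_J\chi^2d\lambda_4=1$, $\|\chi\|_0\le C\lambda_4(J)^{-1/2}$, and $\|\chi\|_0+\|\partial_{x_j}\chi\|_0\le C\lambda_4(J)^{-1/2}|I_j|^{-1}$ for $j=1,\dots,4$. * $\mathcal F(J,T,C)$ is the set of all $f\in C^\infty(M)$ that have this same form with $\psi$ only required to vanish outside $(-T,T)$ instead of $S^T_\zeta(J)$, and that are smooth coboundaries on the flow-box: there is $u\in C^\infty(M)$, vanishing outside $R^T_J$, with $\int_a^bf(T^tz)\,dt=u(T^bz)-u(T^az)$ for all $z\in M$ and $a<b$. Let $J_n=\prod_{j=1}^4\big[1/(8q_n^{(j)}),\,1/(4q_n^{(j)})\big]$. **Theorem.** For any $T>0$, $C>0$ and $\zeta>0$, and for any sequence of pairs of functions $(f_n,g_n)$ such that $f_n\in\mathcal F(J_n,T,C)$ and $g_n\in\mathcal G(J_n,T,C,\zeta)$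 for all sufficiently large $n$, $$\lim_{n\to\infty}\int_{\mathbb R\setminus[-T_{J_n},T_{J_n}]}\big|\langle f_n\circ T^t_{\alpha,\varphi},g_n\rangle\big|^2\,dt=0 .$$ -/

import Mathlib

open Set Filter Topology MeasureTheory
open scoped ContDiff

noncomputable section

namespace TorusFlow

/-- The torus `𝕋⁴ = (ℝ/ℤ)⁴`, with its Haar probability measure `volume`. -/
abbrev Torus : Type := Fin 4 → UnitAddCircle

/-- The projection `ℝ⁴ → 𝕋⁴`. -/
def proj (x : Fin 4 → ℝ) : Torus := fun j => (x j : UnitAddCircle)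

/-! ### The frequency vector -/

/-- `q_n`, the denominator of the `n`-th convergent of `x` (`q_0 = 1`, `q_1 = a_1`,
`q_n = a_n q_{n-1} + q_{n-2}`), as a natural number. -/
def convDen (x : ℝ) (n : ℕ) : ℕ := ⌊(GenContFract.of x).dens n⌋₊

/-- The denominators of the convergents are natural numbers, so that the floor in `convDen`
changes nothing. -/
theorem convDen_eq (x : ℝ) (n : ℕ) : (convDen x n : ℝ) = (GenContFract.of x).dens n := by
  suffices h : ∀ n, (∃ k : ℕ, (GenContFract.of x).dens n = k) ∧
      (∃ k : ℕ, (GenContFract.of x).dens (n + 1) = k) by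
    obtain ⟨k, hk⟩ := (h n).1
    simp [convDen, hk]
  intro n
  induction n with
  | zero =>
    refine ⟨⟨1, by simp⟩, ?_⟩
    cases h : (GenContFract.of x).s.get? 0 with
    | none =>
      refine ⟨1, ?_⟩
      rw [GenContFract.dens_stable_of_terminated (n := 0) (by omega) h]
      simp
    | some gp =>
      rw [GenContFract.first_den_eq h]
      obtain ⟨z, hz⟩ := GenContFract.exists_int_eq_of_partDen
        (GenContFract.partDen_eq_s_b h)
      have h1 : (1 : ℝ) ≤ gp.b :=
        GenContFract.of_one_le_get?_partDen (GenContFract.partDen_eq_s_b h)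
      have hz0 : 0 ≤ z := by
        have : (0 : ℝ) ≤ z := by rw [← hz]; linarith
        exact_mod_cast this
      lift z to ℕ using hz0
      exact ⟨z, by simpa using hz⟩
  | succ n ih =>
    refine ⟨ih.2, ?_⟩
    obtain ⟨⟨k, hk⟩, ⟨l, hl⟩⟩ := ih
    cases h : (GenContFract.of x).s.get? (n + 1) with
    | none =>
      refine ⟨l, ?_⟩
      rw [GenContFract.dens_stable_of_terminated (n := n + 1) (by omega) h, hl]
    | some gp =>
      rw [GenContFract.dens_recurrence h hk hl]
      obtain ⟨z, hz⟩ := GenContFract.exists_int_eq_of_partDen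
        (GenContFract.partDen_eq_s_b h)
      have h1 : (1 : ℝ) ≤ gp.b :=
        GenContFract.of_one_le_get?_partDen (GenContFract.partDen_eq_s_b h)
      have ha : gp.a = 1 :=
        GenContFract.of_partNum_eq_one (GenContFract.partNum_eq_s_a h)
      have hz0 : 0 ≤ z := by
        have : (0 : ℝ) ≤ z := by rw [← hz]; linarith
        exact_mod_cast this
      lift z to ℕ using hz0
      refine ⟨z * l + k, ?_⟩
      rw [hz, ha]
      push_cast
      ring

/-- The set `Y ⊆ [0,1]⁴` of frequency vectors. The coordinates `0, 1, 2, 3` of `Fin 4` are the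
directions `1, 2, 3, 4`. -/
def Y : Set (Fin 4 → ℝ) :=
  {α | (∀ j, α j ∈ Icc (0 : ℝ) 1) ∧ ∀ n : ℕ, 1 ≤ n →
    Real.exp (n * convDen (α 0) n) ≤ convDen (α 1) n ∧
    Real.exp (n * convDen (α 1) n) ≤ convDen (α 2) n ∧
    Real.exp (n * convDen (α 2) n) ≤ convDen (α 3) n ∧
    Real.exp (n * convDen (α 3) n) ≤ convDen (α 0) (n + 1)}

/-! ### The ceiling function -/

/-- `φ(x) = 1 + ∑_j ∑_{n ≥ n₀} cos(2π q_n^{(j)} x_j) / exp(q_n^{(j)})`. Here `fourier q` is the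
character `x ↦ exp(2π i q x)` of `ℝ/ℤ`; see `re_fourier_coe`. -/
def ceiling (α : Fin 4 → ℝ) (n₀ : ℕ) (x : Torus) : ℝ :=
  1 + ∑ j, ∑' n : ℕ,
    (fourier (convDen (α j) (n₀ + n) : ℤ) (x j)).re / Real.exp (convDen (α j) (n₀ + n))

theorem re_fourier_coe (q : ℕ) (x : ℝ) :
    (fourier (q : ℤ) (x : UnitAddCircle)).re = Real.cos (2 * Real.pi * q * x) := by
  rw [fourier_coe_apply]
  have : 2 * (Real.pi : ℂ) * Complex.I * ((q : ℤ) : ℂ) * (x : ℂ) / ((1 : ℝ) : ℂ)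
      = ((2 * Real.pi * q * x : ℝ) : ℂ) * Complex.I := by
    push_cast
    ring
  rw [this, Complex.exp_ofReal_mul_I_re]

/-! ### The special flow over the translation by `ρ` and under the function `φ` -/

/-- The Birkhoff sums `S_n φ (x)`, `n ∈ ℤ`, over the translation `x ↦ x + ρ`:
`φ(x) + ⋯ + φ(x + (n-1)ρ)` for `n > 0`, `0` for `n = 0`, and
`-(φ(x + nρ) + ⋯ + φ(x - ρ))` for `n < 0`. -/
def birkhoff (ρ : Torus) (φ : Torus → ℝ) (n : ℤ) (x : Torus) : ℝ :=
  ∑ i ∈ Finset.range n.toNat, φ (x + i • ρ) -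
    ∑ i ∈ Finset.range (-n).toNat, φ (x - (i + 1) • ρ)

/-- `N(x, s, t)`: the unique integer `N` with `0 ≤ t + s - S_N φ(x) < φ(x + Nρ)`. -/
def hits (ρ : Torus) (φ : Torus → ℝ) (t : ℝ) (z : Torus × ℝ) : ℤ :=
  Classical.epsilon fun N : ℤ =>
    0 ≤ t + z.2 - birkhoff ρ φ N z.1 ∧ t + z.2 - birkhoff ρ φ N z.1 < φ (z.1 + N • ρ)

/-- The special flow `T^t (x, s) = (x + Nρ, t + s - S_N φ(x))` with `N = N(x, s, t)`. -/
def flow (ρ : Torus) (φ : Torus → ℝ) (t : ℝ) (z : Torus × ℝ) : Torus × ℝ :=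
  (z.1 + hits ρ φ t z • ρ, t + z.2 - birkhoff ρ φ (hits ρ φ t z) z.1)

/-- The phase space `M = {(x, s) : 0 ≤ s < φ(x)}`. -/
def phase (φ : Torus → ℝ) : Set (Torus × ℝ) := {z | 0 ≤ z.2 ∧ z.2 < φ z.1}

/-- The invariant measure `μ`: the restriction to `M` of the product of the Haar measure and of
the Lebesgue measure. -/
def phaseMeasure (φ : Torus → ℝ) : Measure (Torus × ℝ) := volume.restrict (phase φ)

/-- `M_ζ = {(x, s) ∈ M : 0 ≤ s ≤ φ(x) - ζ}`. -/
def phaseSub (φ : Torus → ℝ) (ζ : ℝ) : Set (Torus × ℝ) :=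
  {z | z ∈ phase φ ∧ z.2 ≤ φ z.1 - ζ}

/-- `f ∈ C^∞(M)`, where `M` is the manifold `𝕋⁴ × ℝ` modulo `(x, s + φ(x)) ∼ (x + ρ, s)`: the
lift of `f` to the covering space `ℝ⁴ × ℝ` is smooth. The point of `M` below `(x, s)` is
`T^s (x, 0)`. Functions on `M` are written as functions on `𝕋⁴ × ℝ`, of which only the values on
the fundamental domain `M` are used. -/
def SmoothOnPhase (ρ : Torus) (φ : Torus → ℝ) (f : Torus × ℝ → ℝ) : Prop :=
  ContDiff ℝ ∞ fun p : (Fin 4 → ℝ) × ℝ => f (flow ρ φ p.2 (proj p.1, 0))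

/-- `u` is a transfer function of `f`: it is smooth, and
`∫_a^b f(T^t z) dt = u(T^b z) - u(T^a z)` for all `a < b` and `z ∈ M`. -/
def IsTransferFunction (ρ : Torus) (φ : Torus → ℝ) (f u : Torus × ℝ → ℝ) : Prop :=
  SmoothOnPhase ρ φ u ∧ ∀ z ∈ phase φ, ∀ a b : ℝ, a < b →
    ∫ t in a..b, f (flow ρ φ t z) = u (flow ρ φ b z) - u (flow ρ φ a z)

/-- The correlation `⟨f ∘ T^t, g⟩ = ∫_M f(T^t z) g(z) dμ(z)`. -/
def correlation (ρ : Torus) (φ : Torus → ℝ) (f g : Torus × ℝ → ℝ) (t : ℝ) : ℝ :=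
  ∫ z, f (flow ρ φ t z) * g z ∂(phaseMeasure φ)

/-! ### Flow-boxes over multi-intervals, and the functions supported on them -/

/-- The multi-interval `J = I_1 × ⋯ × I_4 ⊆ 𝕋⁴`, `I_j = [a_j, b_j] mod 1`. -/
def multiInterval (a b : Fin 4 → ℝ) : Set Torus :=
  {x | ∀ j, x j ∈ (fun y : ℝ => (y : UnitAddCircle)) '' Icc (a j) (b j)}

/-- The set `(J, 0) ⊆ M`. -/
def base (J : Set Torus) : Set (Torus × ℝ) := J ×ˢ {(0 : ℝ)}

/-- `T_J`, the largest real number such that `T^t (J, 0) ∩ (J, 0) = ∅` whenever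
`0 < |t| < T_J`. -/
def returnTime (ρ : Torus) (φ : Torus → ℝ) (J : Set Torus) : ℝ :=
  sSup {τ : ℝ | ∀ t : ℝ, 0 < |t| → |t| < τ → Disjoint (flow ρ φ t '' base J) (base J)}

/-- The range `R_J^T = ⋃_{|t| < T} T^t (J, 0)` of the flow-box `F_J^T (x, t) = T^t (x, 0)`. -/
def boxRange (ρ : Torus) (φ : Torus → ℝ) (J : Set Torus) (T : ℝ) : Set (Torus × ℝ) :=
  ⋃ t ∈ Ioo (-T) T, flow ρ φ t '' base J

/-- `S^T_ζ(J) = {t ∈ (-T, T) : T^t (J, 0) ⊆ M_ζ}`. -/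
def goodTimes (ρ : Torus) (φ : Torus → ℝ) (J : Set Torus) (T ζ : ℝ) : Set ℝ :=
  {t | t ∈ Ioo (-T) T ∧ flow ρ φ t '' base J ⊆ phaseSub φ ζ}

/-- The profile `χ_J` on the base: `χ ∈ C_0^∞(J)`, `∫_J χ² dλ_4 = 1`,
`‖χ‖_0 ≤ C λ_4(J)^{-1/2}` and `‖χ‖_{1,j} = ‖χ‖_0 + ‖∂_j χ‖_0 ≤ C λ_4(J)^{-1/2} |I_j|^{-1}`. -/
structure IsBaseProfile (a b : Fin 4 → ℝ) (C : ℝ) (χ : Torus → ℝ) : Prop where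
  smooth : ContDiff ℝ ∞ fun x : Fin 4 → ℝ => χ (proj x)
  support : ∀ x, x ∉ multiInterval a b → χ x = 0
  normalized : ∫ x in multiInterval a b, χ x ^ 2 = 1
  bound_zero : ∀ x, |χ x| ≤ C * (volume.real (multiInterval a b)) ^ (-(1 / 2) : ℝ)
  bound_one : ∀ (j : Fin 4) (x : Torus) (y : Fin 4 → ℝ),
    |χ x| + |fderiv ℝ (fun x : Fin 4 → ℝ => χ (proj x)) y (Pi.single j 1)| ≤
      C * (volume.real (multiInterval a b)) ^ (-(1 / 2) : ℝ) * (b j - a j)⁻¹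

/-- The profile `ψ` in the flow direction: `ψ ∈ C_0^∞(ℝ)` vanishes outside `S`, and
`‖ψ‖_0 + ‖ψ'‖_0 ≤ C`. -/
structure IsTimeProfile (S : Set ℝ) (C : ℝ) (ψ : ℝ → ℝ) : Prop where
  smooth : ContDiff ℝ ∞ ψ
  compact : HasCompactSupport ψ
  support : ∀ t, t ∉ S → ψ t = 0
  bound : ∀ t t' : ℝ, |ψ t| + |deriv ψ t'| ≤ C

/-- `h ∈ C^∞(M)` vanishes outside `R_J^T`, and `h(F_J^T(x, t)) = χ(x) ψ(t)` on the flow-box, for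
a base profile `χ` and a time profile `ψ` that vanishes outside `S`. -/
def IsBoxFunction (ρ : Torus) (φ : Torus → ℝ) (a b : Fin 4 → ℝ) (T C : ℝ) (S : Set ℝ)
    (h : Torus × ℝ → ℝ) : Prop :=
  SmoothOnPhase ρ φ h ∧
  (∀ z ∈ phase φ, z ∉ boxRange ρ φ (multiInterval a b) T → h z = 0) ∧
  ∃ (χ : Torus → ℝ) (ψ : ℝ → ℝ), IsBaseProfile a b C χ ∧ IsTimeProfile S C ψ ∧
    ∀ x ∈ multiInterval a b, ∀ t ∈ Ioo (-T) T, h (flow ρ φ t (x, 0)) = χ x * ψ t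

/-- The class `𝓖(J, T, C, ζ)`. -/
def classG (ρ : Torus) (φ : Torus → ℝ) (a b : Fin 4 → ℝ) (T C ζ : ℝ) :
    Set (Torus × ℝ → ℝ) :=
  {g | IsBoxFunction ρ φ a b T C (goodTimes ρ φ (multiInterval a b) T ζ) g}

/-- The class `𝓕(J, T, C)`: the functions on the flow-box (without the restriction on the time
profile that involves `ζ`) which are smooth coboundaries on the flow-box, that is, which have a
transfer function that vanishes outside `R_J^T`. -/
def classF (ρ : Torus) (φ : Torus → ℝ) (a b : Fin 4 → ℝ) (T C : ℝ) :
    Set (Torus × ℝ → ℝ) :=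
  {f | IsBoxFunction ρ φ a b T C (Ioo (-T) T) f ∧
    ∃ u : Torus × ℝ → ℝ, IsTransferFunction ρ φ f u ∧
      ∀ z ∈ phase φ, z ∉ boxRange ρ φ (multiInterval a b) T → u z = 0}

/-- The left end points `1 / (8 q_n^{(j)})` of `J_n`. -/
def leftEnd (α : Fin 4 → ℝ) (n : ℕ) : Fin 4 → ℝ := fun j => 1 / (8 * convDen (α j) n)

/-- The right end points `1 / (4 q_n^{(j)})` of `J_n`. -/
def rightEnd (α : Fin 4 → ℝ) (n : ℕ) : Fin 4 → ℝ := fun j => 1 / (4 * convDen (α j) n)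

end TorusFlow

end

/-!
The correlations of `f n` and `g n` decay like `|t| ^ (-7/12)`, uniformly in `n`, and vanish for
`2 T < |t|` until an orbit can return to `J_n`. The square of `|t| ^ (-7/12)` is integrable at
infinity, and the first return to `J_n` happens at a time that tends to infinity with `n`, so the
integrals tend to `0`.

*Unfolding.* The phase space is a fundamental domain of `(x, s) ↦ (x + α, s - φ x)` on `𝕋⁴ × ℝ`.
Writing both functions as sums over the visits of an orbit to `J_n`, the correlation at time `t`
becomes an integral over `r`, `|r - t| < T`, of a bounded weight times
`∑_N ∫ χ₁(x) χ₂(x + N α) ψ(r - S_N φ(x)) dx`, where `χ₁`, `χ₂` are the base profiles of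
`g n`, `f n` and `ψ` is the time profile of `f n` (`correlation_eq_integral`). As `q_n^{(4)}` is
the denominator of a convergent, the term of index `N ≠ 0` is zero unless `|N| ≥ q_n^{(4)}`
(`le_abs_of_mem_interval`). In particular different visits to `J_n` are separated by
more than `2 T`, and for given `x` and `r` at most one `N` contributes.

*Stretching.* Let `q_m` be the denominators in the direction `j`. For
`exp (12 q_m) ≤ |r| ≤ q_{m+1} ^ (1/2)` and `N` comparable with `r`, the derivative `∂_j S_N φ` is
`-2 π N q_m e^{-q_m} sin (2 π q_m x_j)`, up to an error of order `q_m`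
(`exists_abs_birkhoff_ceilingPartial_sub_le`). The complements of these windows, for different
directions, are disjoint from each other by the growth assumption on the denominators, so at every
large time at least two of the first three directions are stretched (`exists_two_isStretched`).

*Integration by parts.* As `f` is a coboundary on the flow-box, `ψ` is the derivative of a function
`Ψ` supported in the same interval. Integrating by parts in a stretched direction
replaces `ψ` by `Ψ` and gains the inverse of `∂_j S_N φ`. This is not possible near the critical
points, where the weight `w_j = δ² / (sin² + δ²)` is not small: the decomposition
`1 = w_j w_j' + (1 - w_j) + w_j (1 - w_j')` allows an integration by parts in the second and in the
third term (`abs_integral_mul_one_sub_weight_le`), while the first one has an integral of order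
`δ²` because two directions are available. The choice `δ = |r| ^ (-1/3)` balances the terms
(`exists_abs_sum_integral_le`).
-/

noncomputable section

namespace TorusFlow

/-! ### Convergents of an irrational number -/

/-- `q` and `p` behave like the denominators and the numerators of the convergents of an irrational
number `x`. Only these properties of continued fractions are used below. -/
structure IsConvergents (x : ℝ) (q : ℕ → ℕ) (p : ℕ → ℤ) : Prop where
  q_zero : q 0 = 1
  q_one_pos : 1 ≤ q 1
  add_le : ∀ n, q (n + 1) + q n ≤ q (n + 2)
  abs_le : ∀ n, |q n * x - p n| ≤ 1 / q (n + 1)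
  det : ∀ n, |p n * q (n + 1) - q n * p (n + 1)| = 1

theorem exists_int_eq_nums (x : ℝ) (n : ℕ) : ∃ k : ℤ, (GenContFract.of x).nums n = k := by
  suffices h : ∀ n, (∃ k : ℤ, (GenContFract.of x).nums n = k) ∧
      (∃ k : ℤ, (GenContFract.of x).nums (n + 1) = k) from (h n).1
  intro n
  induction n with
  | zero =>
    have h0 : (GenContFract.of x).nums 0 = (⌊x⌋ : ℤ) := by
      rw [GenContFract.zeroth_num_eq_h, GenContFract.of_h_eq_floor]
    refine ⟨⟨_, h0⟩, ?_⟩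
    cases h : (GenContFract.of x).s.get? 0 with
    | none => exact ⟨_, (GenContFract.nums_stable_of_terminated (n := 0) (by omega) h).trans h0⟩
    | some gp =>
      obtain ⟨z, hz⟩ := GenContFract.exists_int_eq_of_partDen (GenContFract.partDen_eq_s_b h)
      have ha : gp.a = 1 := GenContFract.of_partNum_eq_one (GenContFract.partNum_eq_s_a h)
      refine ⟨z * ⌊x⌋ + 1, ?_⟩
      rw [GenContFract.first_num_eq h, GenContFract.of_h_eq_floor, hz, ha]
      push_cast
      ring
  | succ n ih =>
    refine ⟨ih.2, ?_⟩
    obtain ⟨⟨k, hk⟩, ⟨l, hl⟩⟩ := ih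
    cases h : (GenContFract.of x).s.get? (n + 1) with
    | none =>
      exact ⟨l, (GenContFract.nums_stable_of_terminated (n := n + 1) (by omega) h).trans hl⟩
    | some gp =>
      obtain ⟨z, hz⟩ := GenContFract.exists_int_eq_of_partDen (GenContFract.partDen_eq_s_b h)
      have ha : gp.a = 1 := GenContFract.of_partNum_eq_one (GenContFract.partNum_eq_s_a h)
      refine ⟨z * l + k, ?_⟩
      rw [GenContFract.nums_recurrence h hk hl, hz, ha]
      push_cast
      ring

/-- A continued fraction that terminates has only finitely many different denominators. -/
theorem not_terminatedAt_of_tendsto {x : ℝ} (h : Tendsto (convDen x) atTop atTop) (n : ℕ) :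
    ¬ (GenContFract.of x).TerminatedAt n := by
  intro hn
  obtain ⟨m, hm⟩ := eventually_atTop.1 (h.eventually_gt_atTop (convDen x n))
  have := hm (max m n) (le_max_left _ _)
  have h2 : convDen x (max m n) = convDen x n := by
    unfold convDen
    rw [GenContFract.dens_stable_of_terminated (le_max_right m n) hn]
  omega

theorem exists_isConvergents {x : ℝ} (h : Tendsto (convDen x) atTop atTop) :
    ∃ p, IsConvergents x (convDen x) p := by
  have hnt := not_terminatedAt_of_tendsto h
  choose p hp using exists_int_eq_nums x
  have hmono : ∀ n, convDen x n ≤ convDen x (n + 1) := fun n => by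
    have := GenContFract.of_den_mono (v := x) (n := n)
    rw [← convDen_eq, ← convDen_eq] at this
    exact_mod_cast this
  have h0 : convDen x 0 = 1 := by
    have := convDen_eq x 0
    rw [GenContFract.zeroth_den_eq_one] at this
    exact_mod_cast this
  have hpos : ∀ n, 1 ≤ convDen x n := fun n => by
    rw [← h0]
    exact monotone_nat_of_le_succ hmono (Nat.zero_le n)
  refine ⟨p, h0, hpos 1, fun n => ?_, fun n => ?_, fun n => ?_⟩
  · obtain ⟨gp, hgp⟩ := Option.ne_none_iff_exists'.1 (hnt (n + 1))
    have hrec := GenContFract.dens_recurrence hgp (convDen_eq x n).symm (convDen_eq x (n + 1)).symm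
    have ha : gp.a = 1 := GenContFract.of_partNum_eq_one (GenContFract.partNum_eq_s_a hgp)
    have hb : 1 ≤ gp.b := GenContFract.of_one_le_get?_partDen (GenContFract.partDen_eq_s_b hgp)
    rw [← convDen_eq, ha] at hrec
    have : (convDen x (n + 1) + convDen x n : ℝ) ≤ convDen x (n + 2) := by
      rw [hrec]
      nlinarith [Nat.cast_nonneg (α := ℝ) (convDen x (n + 1))]
    exact_mod_cast this
  · have h1 := GenContFract.abs_sub_convs_le (hnt n)
    rw [GenContFract.conv_eq_num_div_den, hp, ← convDen_eq, ← convDen_eq] at h1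
    have hq : (0 : ℝ) < convDen x n := by exact_mod_cast hpos n
    have : |convDen x n * x - p n| = convDen x n * |x - p n / convDen x n| := by
      rw [← abs_of_pos hq, ← abs_mul, abs_of_pos hq]
      congr 1
      field_simp
    rw [this]
    calc _ ≤ (convDen x n : ℝ) * (1 / (convDen x n * convDen x (n + 1))) := by gcongr
      _ = _ := by field_simp
  · have h1 := SimpContFract.determinant (s := SimpContFract.of x) (n := n) (hnt n)
    change (GenContFract.of x).nums n * (GenContFract.of x).dens (n + 1) -
      (GenContFract.of x).dens n * (GenContFract.of x).nums (n + 1) = _ at h1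
    rw [hp, hp, ← convDen_eq, ← convDen_eq] at h1
    have h2 : (p n * convDen x (n + 1) - convDen x n * p (n + 1) : ℤ) = (-1) ^ (n + 1) := by
      exact_mod_cast h1
    rw [h2, abs_pow]
    simp

namespace IsConvergents

variable {x : ℝ} {q : ℕ → ℕ} {p : ℕ → ℤ}

theorem mono (h : IsConvergents x q p) : Monotone q := by
  refine monotone_nat_of_le_succ fun n => ?_
  cases n with
  | zero => rw [h.q_zero]; exact h.q_one_pos
  | succ n => exact le_of_add_le_left (h.add_le n)

theorem pos (h : IsConvergents x q p) (n : ℕ) : 0 < q n := by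
  have h1 : q 0 ≤ q n := h.mono (Nat.zero_le n)
  have h2 := h.q_zero
  omega

theorem two_le (h : IsConvergents x q p) (n : ℕ) : 2 ≤ q (n + 2) := by
  have := h.add_le n
  have := h.pos n
  have := h.pos (n + 1)
  omega

theorem succ_lt (h : IsConvergents x q p) {n : ℕ} (hn : 1 ≤ n) : q n < q (n + 1) := by
  obtain ⟨m, rfl⟩ := Nat.exists_eq_add_of_le' hn
  have h1 : q (m + 1) + q m ≤ q (m + 1 + 1) := h.add_le m
  have := h.pos m
  omega

theorem le_self (h : IsConvergents x q p) (n : ℕ) : n ≤ q n := by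
  induction n with
  | zero => omega
  | succ n ih =>
    rcases Nat.eq_zero_or_pos n with rfl | hn
    · exact h.pos 1
    · have := h.succ_lt hn; omega

/-- The determinant formula turns the upper bound for the approximation at step `n + 1` into a lower
bound at step `n`. -/
theorem le_abs (h : IsConvergents x q p) (n : ℕ) : 1 / (2 * q (n + 1)) ≤ |q n * x - p n| := by
  have hq1 : (0 : ℝ) < q (n + 1) := by exact_mod_cast h.pos _
  have hq0 : (0 : ℝ) < q n := by exact_mod_cast h.pos _
  have hq2 : (0 : ℝ) < q (n + 2) := by exact_mod_cast h.pos _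
  have hadd : (2 * q n : ℝ) ≤ q (n + 2) := by
    have := h.add_le n
    have : q n ≤ q (n + 1) := h.mono (Nat.le_succ n)
    exact_mod_cast (by omega : 2 * q n ≤ q (n + 2))
  have hdet : |(p n * q (n + 1) - q n * p (n + 1) : ℝ)| = 1 := by exact_mod_cast h.det n
  have h1 : (1 : ℝ) ≤ q (n + 1) * |q n * x - p n| + q n * |q (n + 1) * x - p (n + 1)| := by
    rw [← hdet, ← abs_of_pos hq1, ← abs_of_pos hq0, ← abs_mul, ← abs_mul, abs_of_pos hq1,
      abs_of_pos hq0]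
    refine le_trans (le_of_eq ?_) (abs_sub _ _)
    rw [← abs_neg]
    congr 1
    ring
  have h2 : (q n : ℝ) * |q (n + 1) * x - p (n + 1)| ≤ 1 / 2 := by
    calc _ ≤ (q n : ℝ) * (1 / q (n + 2)) := by gcongr; exact h.abs_le (n + 1)
      _ ≤ 1 / 2 := by
        rw [mul_one_div, div_le_div_iff₀ hq2 two_pos]
        linarith
  rw [div_le_iff₀ (by positivity)]
  nlinarith

/-- The multiples `N x`, `0 < N < q_n`, stay away from the integers. -/
theorem le_abs_mul_sub (h : IsConvergents x q p) {n : ℕ} (hn : 2 * q n ≤ q (n + 1)) {N : ℤ}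
    (hN : N ≠ 0) (hNq : |N| < q n) (k : ℤ) : 1 / (2 * q n) ≤ |N * x - k| := by
  have hq0 : (0 : ℝ) < q n := by exact_mod_cast h.pos _
  have hq1 : (0 : ℝ) < q (n + 1) := by exact_mod_cast h.pos _
  -- `N p_n / q_n` is not an integer, and `N x` is close to it
  have hcop : IsCoprime (q n : ℤ) (p n) := by
    have hd := h.det n
    rcases abs_eq (zero_le_one' ℤ) |>.1 hd with h1 | h1
    · exact ⟨-p (n + 1), q (n + 1), by linarith⟩
    · exact ⟨p (n + 1), -q (n + 1), by linarith⟩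
  have hne : N * p n - k * q n ≠ 0 := by
    intro h0
    have hdvd : (q n : ℤ) ∣ N := hcop.dvd_of_dvd_mul_right ⟨k, by linarith⟩
    have := Int.le_of_dvd (abs_pos.2 hN) ((dvd_abs _ _).2 hdvd)
    omega
  have h1 : (1 : ℝ) ≤ |(N : ℝ) * p n - k * q n| := by exact_mod_cast Int.one_le_abs hne
  have h2 : |(N : ℝ) * p n - k * q n| ≤ q n * |N * x - k| + |(N : ℝ)| * |q n * x - p n| := by
    rw [← abs_of_pos hq0, ← abs_mul, ← abs_mul, abs_of_pos hq0]
    refine le_trans (le_of_eq ?_) (abs_sub _ _)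
    congr 1
    ring
  have h3 : |(N : ℝ)| * |q n * x - p n| ≤ 1 / 2 := by
    have hNq' : |(N : ℝ)| ≤ q n := by exact_mod_cast hNq.le
    have hn' : (2 * q n : ℝ) ≤ q (n + 1) := by exact_mod_cast hn
    calc _ ≤ (q n : ℝ) * (1 / q (n + 1)) := by gcongr; exact h.abs_le n
      _ ≤ 1 / 2 := by
        rw [mul_one_div, div_le_div_iff₀ hq1 two_pos]
        linarith
  rw [div_le_iff₀ (by positivity)]
  nlinarith

theorem ne_int (h : IsConvergents x q p) (k : ℤ) : x ≠ k := by
  rintro rfl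
  have h1 := h.abs_le 1
  have h2 := h.le_abs 1
  have hq : (2 : ℝ) ≤ q 2 := by exact_mod_cast h.two_le 0
  have h3 : (0 : ℝ) < |q 1 * (k : ℝ) - p 1| := lt_of_lt_of_le (by positivity) h2
  have h4 : |q 1 * (k : ℝ) - p 1| < 1 := lt_of_le_of_lt h1 (by
    rw [div_lt_one (by positivity)]; linarith)
  have h5 : (0 : ℤ) < |q 1 * k - p 1| := by exact_mod_cast h3
  have h6 : |q 1 * k - p 1| < (1 : ℤ) := by exact_mod_cast h4
  omega

end IsConvergents

/-! ### Exponential sums along a rotation -/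

theorem fourier_add_nsmul (q : ℤ) (y a : UnitAddCircle) (i : ℕ) :
    fourier q (y + i • a) = fourier q y * fourier q a ^ i := by
  rw [fourier_apply, fourier_apply, fourier_apply, smul_add, AddCircle.toCircle_add,
    smul_comm, AddCircle.toCircle_nsmul]
  simp

theorem norm_fourier_apply (q : ℤ) (y : UnitAddCircle) : ‖fourier q y‖ = 1 := by
  rw [fourier_apply]; exact Circle.norm_coe _

theorem norm_sum_fourier_le (q : ℤ) (y a : UnitAddCircle) (ha : fourier q a ≠ 1) (N : ℕ) :
    ‖∑ i ∈ Finset.range N, fourier q (y + i • a)‖ ≤ 2 / ‖fourier q a - 1‖ := by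
  simp_rw [fourier_add_nsmul, ← Finset.mul_sum]
  rw [norm_mul, norm_fourier_apply, one_mul, geom_sum_eq ha, norm_div]
  gcongr
  refine (norm_sub_le _ _).trans ?_
  rw [norm_pow, norm_fourier_apply]
  norm_num

theorem norm_fourier_coe_sub_one (q : ℕ) (x : ℝ) (p : ℤ) :
    ‖fourier (q : ℤ) (x : UnitAddCircle) - 1‖ = 2 * |Real.sin (Real.pi * (q * x - p))| := by
  have h : (fourier (q : ℤ) (x : UnitAddCircle) : ℂ) =
      Complex.exp (Complex.I * ((2 * Real.pi * (q * x - p) : ℝ) : ℂ)) := by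
    rw [fourier_coe_apply]
    have := Complex.exp_int_mul_two_pi_mul_I p
    rw [← mul_one (Complex.exp (Complex.I * _)), ← this, ← Complex.exp_add]
    congr 1
    push_cast
    ring
  rw [h, Complex.norm_exp_I_mul_ofReal_sub_one, Real.norm_eq_abs, abs_mul, abs_two]
  congr 3
  ring

theorem two_mul_abs_le_abs_sin {y : ℝ} (hy : |y| ≤ 1 / 2) : 2 * |y| ≤ |Real.sin (Real.pi * y)| := by
  have key : ∀ z : ℝ, 0 ≤ z → z ≤ 1 / 2 → 2 * z ≤ Real.sin (Real.pi * z) := fun z h0 h1 => by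
    have := Real.mul_le_sin (x := Real.pi * z) (by positivity) (by nlinarith [Real.pi_pos])
    have h2 : 2 / Real.pi * (Real.pi * z) = 2 * z := by field_simp
    linarith
  rcases le_total 0 y with h | h
  · rw [abs_of_nonneg h] at hy ⊢
    exact (key y h hy).trans (le_abs_self _)
  · rw [abs_of_nonpos h] at hy ⊢
    have := key (-y) (by linarith) hy
    rw [show Real.pi * -y = -(Real.pi * y) by ring, Real.sin_neg] at this
    exact this.trans (neg_le_abs _)

/-- The exponential sums of frequency `q_k` are bounded by a multiple of `q_{k+1}`, whatever their
length: the rotation number is at distance about `1 / q_{k+1}` from resonance. -/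
theorem IsConvergents.exists_norm_sum_fourier_le {x : ℝ} {q : ℕ → ℕ} {p : ℕ → ℤ}
    (h : IsConvergents x q p) : ∃ A : ℝ, 0 < A ∧ ∀ (k N : ℕ) (y : UnitAddCircle),
      ‖∑ i ∈ Finset.range N, fourier (q k : ℤ) (y + i • (x : UnitAddCircle))‖ ≤ A * q (k + 1) := by
  have hne : ∀ k, fourier (q k : ℤ) (x : UnitAddCircle) - 1 ≠ 0 → ∀ (N : ℕ) (y : UnitAddCircle),
      ‖∑ i ∈ Finset.range N, fourier (q k : ℤ) (y + i • (x : UnitAddCircle))‖ ≤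
        2 / ‖fourier (q k : ℤ) (x : UnitAddCircle) - 1‖ := fun k hk N y =>
    norm_sum_fourier_le _ _ _ (sub_ne_zero.1 hk) N
  have h0 : fourier (q 0 : ℤ) (x : UnitAddCircle) - 1 ≠ 0 := by
    rw [← norm_pos_iff, norm_fourier_coe_sub_one _ _ 0]
    have : Real.sin (Real.pi * (q 0 * x - (0 : ℤ))) ≠ 0 := by
      rw [Ne, Real.sin_eq_zero_iff]
      rintro ⟨n, hn⟩
      apply h.ne_int n
      rw [h.q_zero] at hn
      have hpi := Real.pi_ne_zero
      apply mul_left_cancel₀ hpi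
      push_cast at hn
      linarith
    positivity
  set A₀ := 2 / ‖fourier (q 0 : ℤ) (x : UnitAddCircle) - 1‖
  have hA₀ : 0 < A₀ := div_pos two_pos (norm_pos_iff.2 h0)
  refine ⟨A₀ + 1, by positivity, fun k N y => ?_⟩
  have hq1 : (1 : ℝ) ≤ q (k + 1) := by exact_mod_cast h.pos (k + 1)
  cases k with
  | zero =>
    refine (hne 0 h0 N y).trans ?_
    change A₀ ≤ _
    nlinarith
  | succ k =>
    have hq2 : (2 : ℝ) ≤ q (k + 1 + 1) := by exact_mod_cast h.two_le k
    have hle : |q (k + 1) * x - p (k + 1)| ≤ 1 / 2 :=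
      (h.abs_le (k + 1)).trans (one_div_le_one_div_of_le two_pos hq2)
    have h1 := two_mul_abs_le_abs_sin hle
    have h2 : 2 / (q (k + 1 + 1) : ℝ) ≤ ‖fourier (q (k + 1) : ℤ) (x : UnitAddCircle) - 1‖ := by
      rw [norm_fourier_coe_sub_one _ _ (p (k + 1))]
      have := h.le_abs (k + 1)
      have h3 : 2 / (q (k + 1 + 1) : ℝ) = 4 * (1 / (2 * q (k + 1 + 1))) := by field_simp; norm_num
      linarith
    have h3 : 0 < ‖fourier (q (k + 1) : ℤ) (x : UnitAddCircle) - 1‖ :=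
      lt_of_lt_of_le (by positivity) h2
    refine (hne (k + 1) (norm_pos_iff.1 h3) N y).trans ?_
    rw [div_le_iff₀ h3]
    have : (2 : ℝ) ≤ q (k + 1 + 1) * ‖fourier (q (k + 1) : ℤ) (x : UnitAddCircle) - 1‖ := by
      rw [div_le_iff₀ (by linarith)] at h2
      linarith
    nlinarith

/-- Up to time `N ≪ q_{m+1}` the character of frequency `q_m` hardly changes along an orbit. -/
theorem IsConvergents.norm_fourier_add_nsmul_sub_le {x : ℝ} {q : ℕ → ℕ} {p : ℕ → ℤ}
    (h : IsConvergents x q p) (m i : ℕ) (y : UnitAddCircle) :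
    ‖fourier (q m : ℤ) (y + i • (x : UnitAddCircle)) - fourier (q m : ℤ) y‖ ≤
      2 * Real.pi * i / q (m + 1) := by
  have hstep : ‖fourier (q m : ℤ) (x : UnitAddCircle) - 1‖ ≤ 2 * Real.pi / q (m + 1) := by
    rw [norm_fourier_coe_sub_one _ _ (p m)]
    have := h.abs_le m
    calc _ ≤ 2 * |Real.pi * (q m * x - p m)| :=
          mul_le_mul_of_nonneg_left Real.abs_sin_le_abs two_pos.le
      _ = 2 * Real.pi * |q m * x - p m| := by rw [abs_mul, abs_of_pos Real.pi_pos]; ring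
      _ ≤ 2 * Real.pi * (1 / q (m + 1)) := by gcongr
      _ = _ := by ring
  rw [fourier_add_nsmul, ← mul_sub_one, norm_mul, norm_fourier_apply, one_mul]
  calc _ ≤ (i : ℝ) * ‖fourier (q m : ℤ) (x : UnitAddCircle) - 1‖ := by
        rw [← geom_sum_mul, norm_mul]
        gcongr
        refine (norm_sum_le _ _).trans ?_
        simp_rw [norm_pow, norm_fourier_apply, one_pow]
        simp
    _ ≤ i * (2 * Real.pi / q (m + 1)) := by gcongr
    _ = _ := by ring

/-! ### Growth of the denominators -/

theorem one_le_convDen (x : ℝ) (n : ℕ) : 1 ≤ convDen x n := by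
  have hmono : Monotone fun n => (GenContFract.of x).dens n :=
    monotone_nat_of_le_succ fun n => GenContFract.of_den_mono
  have h := hmono (Nat.zero_le n)
  simp only [GenContFract.zeroth_den_eq_one, ← convDen_eq] at h
  exact_mod_cast h

/-- The denominators of the four coordinates, in one sequence: first by the index, then by the
coordinate. -/
def allDens (α : Fin 4 → ℝ) (i : ℕ) : ℕ := convDen (α (Fin.ofNat 4 i)) (i / 4)

theorem allDens_eq (α : Fin 4 → ℝ) (m : ℕ) (j : Fin 4) :
    allDens α (4 * m + j) = convDen (α j) m := by
  unfold allDens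
  have h1 : Fin.ofNat 4 (4 * m + j) = j := by
    ext
    simp [Fin.ofNat]
  rw [h1]
  congr 1
  omega

theorem exp_allDens_le {α : Fin 4 → ℝ} (hα : α ∈ Y) {i : ℕ} (hi : 4 ≤ i) :
    Real.exp ((i / 4 : ℕ) * allDens α i) ≤ allDens α (i + 1) := by
  obtain ⟨m, j, rfl⟩ : ∃ (m : ℕ) (j : Fin 4), i = 4 * m + j :=
    ⟨i / 4, ⟨i % 4, Nat.mod_lt _ (by norm_num)⟩, (Nat.div_add_mod i 4).symm⟩
  have hm : 1 ≤ m := by omega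
  have hdiv : (4 * m + (j : ℕ)) / 4 = m := by omega
  obtain ⟨h0, h1, h2, h3⟩ := hα.2 m hm
  rw [allDens_eq, hdiv]
  fin_cases j
  · have := allDens_eq α m 1
    simp only [Fin.val_one, Fin.zero_eta, add_zero] at this ⊢
    rw [this]; exact h0
  · have := allDens_eq α m 2
    simp only [Fin.mk_one, Fin.val_two] at this ⊢
    rw [add_assoc, one_add_one_eq_two, this]; exact h1
  · have := allDens_eq α m 3
    simp only [Fin.reduceFinMk] at this ⊢
    rw [add_assoc]
    change _ ≤ ((allDens α (4 * m + ((3 : Fin 4) : ℕ)) : ℕ) : ℝ)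
    rw [this]; exact h2
  · have := allDens_eq α (m + 1) 0
    simp only [Fin.reduceFinMk, Fin.val_zero, add_zero] at this ⊢
    change _ ≤ ((allDens α (4 * m + 3 + 1) : ℕ) : ℝ)
    rw [show 4 * m + 3 + 1 = 4 * (m + 1) by ring, this]; exact h3

theorem allDens_mono {α : Fin 4 → ℝ} (hα : α ∈ Y) {i k : ℕ} (hi : 4 ≤ i) (hik : i ≤ k) :
    allDens α i ≤ allDens α k := by
  induction k, hik using Nat.le_induction with
  | base => exact le_rfl
  | succ k hk ih =>
    refine ih.trans ?_
    have h := exp_allDens_le hα (hi.trans hk)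
    have h1 : (1 : ℝ) ≤ (k / 4 : ℕ) := by exact_mod_cast (by omega : 1 ≤ k / 4)
    have h2 := Real.add_one_le_exp ((k / 4 : ℕ) * (allDens α k : ℝ))
    have h3 : (allDens α k : ℝ) ≤ allDens α (k + 1) := by
      nlinarith [Nat.cast_nonneg (α := ℝ) (allDens α k)]
    exact_mod_cast h3

theorem exp_mul_convDen_le {α : Fin 4 → ℝ} (hα : α ∈ Y) {m m' : ℕ} {j j' : Fin 4} (hm : 1 ≤ m)
    (h : m < m' ∨ m = m' ∧ j < j') :
    Real.exp (m * convDen (α j) m) ≤ convDen (α j') m' := by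
  have h1 := exp_allDens_le hα (i := 4 * m + j) (by omega)
  rw [allDens_eq, show (4 * m + (j : ℕ)) / 4 = m by omega] at h1
  refine h1.trans ?_
  rw [← allDens_eq]
  exact_mod_cast allDens_mono hα (by omega) (by omega)

theorem tendsto_convDen {α : Fin 4 → ℝ} (hα : α ∈ Y) (j : Fin 4) :
    Tendsto (convDen (α j)) atTop atTop := by
  refine (tendsto_add_atTop_iff_nat 2).1 (tendsto_atTop_mono (fun n => ?_) tendsto_id)
  have h := exp_mul_convDen_le hα (m := n + 1) (m' := n + 2) (j := 0) (j' := j) (by omega)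
    (Or.inl (by omega))
  have h2 := Real.add_one_le_exp ((n + 1 : ℕ) * (convDen (α 0) (n + 1) : ℝ))
  have h1 : (1 : ℝ) ≤ convDen (α 0) (n + 1) := by exact_mod_cast one_le_convDen _ _
  have h3 : (n : ℝ) ≤ convDen (α j) (n + 2) := by
    push_cast at h h2
    nlinarith [Nat.cast_nonneg (α := ℝ) n]
  exact_mod_cast h3

theorem two_mul_convDen_le {α : Fin 4 → ℝ} (hα : α ∈ Y) {m : ℕ} (hm : 2 ≤ m) (j : Fin 4) :
    2 * convDen (α j) m ≤ convDen (α j) (m + 1) := by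
  have h := exp_mul_convDen_le hα (m := m) (m' := m + 1) (j := j) (j' := j) (by omega)
    (Or.inl (by omega))
  have h2 := Real.add_one_le_exp ((m : ℝ) * convDen (α j) m)
  have hm' : (2 : ℝ) ≤ m := by exact_mod_cast hm
  have h3 : (2 * convDen (α j) m : ℝ) ≤ convDen (α j) (m + 1) := by
    nlinarith [Nat.cast_nonneg (α := ℝ) (convDen (α j) m)]
  exact_mod_cast h3

/-- At time `r` the coordinate `j` is uniformly stretched by the term of index `m` of the ceiling
function: `r` lies in the window from `exp (12 q_m)` to `q_{m+1} ^ (1 / 2)`. -/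
def IsStretched (α : Fin 4 → ℝ) (r : ℝ) (j : Fin 4) (m : ℕ) : Prop :=
  Real.exp (12 * convDen (α j) m) ≤ r ∧ r ^ 2 ≤ convDen (α j) (m + 1)

/-- Outside the windows of the coordinate `j`, the time `r` lies between `q_m ^ (1 / 2)` and
`exp (12 q_m)` for some `m`. For different coordinates these ranges are disjoint. -/
theorem exists_isStretched_or {α : Fin 4 → ℝ} (hα : α ∈ Y) {n : ℕ} (hn : 24 ≤ n) {r : ℝ}
    {j j' : Fin 4} (hj : Real.exp (12 * convDen (α j) n) ≤ r)
    (hj' : Real.exp (12 * convDen (α j') n) ≤ r) (hjj : j ≠ j') :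
    (∃ m, n ≤ m ∧ IsStretched α r j m) ∨ (∃ m, n ≤ m ∧ IsStretched α r j' m) := by
  classical
  have key : ∀ j : Fin 4, Real.exp (12 * convDen (α j) n) ≤ r →
      (∃ m, n ≤ m ∧ IsStretched α r j m) ∨
        ∃ M, n < M ∧ r < Real.exp (12 * convDen (α j) M) ∧ (convDen (α j) M : ℝ) < r ^ 2 := by
    intro j hj
    have hex : ∃ M, n < M ∧ r < Real.exp (12 * convDen (α j) M) := by
      have h1 : Tendsto (fun M => Real.exp (12 * (convDen (α j) M : ℝ))) atTop atTop :=
        Real.tendsto_exp_atTop.comp (Tendsto.const_mul_atTop (by norm_num)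
          (tendsto_natCast_atTop_atTop.comp (tendsto_convDen hα j)))
      exact ((eventually_gt_atTop n).and (h1.eventually_gt_atTop r)).exists
    obtain ⟨hM1, hM2⟩ := Nat.find_spec hex
    set M := Nat.find hex
    obtain ⟨m, hm⟩ : ∃ m, M = m + 1 := ⟨M - 1, by omega⟩
    have hmr : Real.exp (12 * convDen (α j) m) ≤ r := by
      rcases (by omega : m = n ∨ n < m) with rfl | h
      · exact hj
      · by_contra hlt
        exact Nat.find_min hex (show m < M by omega) ⟨h, not_le.1 hlt⟩
    rcases le_or_gt (r ^ 2) (convDen (α j) (m + 1)) with h | h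
    · exact Or.inl ⟨m, by omega, hmr, h⟩
    · exact Or.inr ⟨M, hM1, hM2, by rw [hm]; exact h⟩
  -- the later of two such ranges starts after the end of the earlier one: `r² < exp (24 q)`, while
  -- all denominators that follow `q = q_M` are at least `exp (M q)`
  have contra : ∀ {j j' : Fin 4} {M M' : ℕ}, n < M → r < Real.exp (12 * convDen (α j) M) →
      (convDen (α j') M' : ℝ) < r ^ 2 → 0 ≤ r → (M < M' ∨ M = M' ∧ j < j') → False := by
    intro j j' M M' hM h1 h2 hr hlt
    have h3 := exp_mul_convDen_le hα (by omega : 1 ≤ M) hlt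
    have h4 : r ^ 2 ≤ Real.exp (M * convDen (α j) M) := by
      calc r ^ 2 ≤ Real.exp (12 * convDen (α j) M) ^ 2 := by gcongr
        _ = Real.exp (24 * convDen (α j) M) := by
          rw [← Real.exp_nat_mul]; congr 1; push_cast; ring
        _ ≤ _ := by
          gcongr
          exact_mod_cast (by omega : 24 ≤ M)
    linarith
  have hr : 0 ≤ r := (Real.exp_pos _).le.trans hj
  rcases key j hj with h | ⟨M, hM, hM1, hM2⟩
  · exact Or.inl h
  rcases key j' hj' with h | ⟨M', hM', hM1', hM2'⟩
  · exact Or.inr h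
  exfalso
  rcases lt_trichotomy M M' with h | h | h
  · exact contra hM hM1 hM2' hr (Or.inl h)
  · rcases lt_or_gt_of_ne hjj with h' | h'
    · exact contra hM hM1 hM2' hr (Or.inr ⟨h, h'⟩)
    · exact contra hM' hM1' hM2 hr (Or.inr ⟨h.symm, h'⟩)
  · exact contra hM' hM1' hM2 hr (Or.inl h)

/-- At most one of the coordinates is not stretched, so that two of the first three are. -/
theorem exists_two_isStretched {α : Fin 4 → ℝ} (hα : α ∈ Y) {n : ℕ} (hn : 24 ≤ n) {r : ℝ}
    (hr : Real.exp (12 * convDen (α 2) n) ≤ r) :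
    ∃ (j j' : Fin 4) (m m' : ℕ), j ≠ j' ∧ n ≤ m ∧ n ≤ m' ∧
      IsStretched α r j m ∧ IsStretched α r j' m' := by
  have hle : ∀ j : Fin 4, j ≤ 2 → Real.exp (12 * convDen (α j) n) ≤ r := fun j hj => by
    refine le_trans ?_ hr
    have : convDen (α j) n ≤ convDen (α 2) n := by
      rw [← allDens_eq, ← allDens_eq]
      exact allDens_mono hα (by omega) (by have : (j : ℕ) ≤ (2 : Fin 4) := hj; omega)
    gcongr
  have h01 := exists_isStretched_or hα hn (hle 0 (by decide)) (hle 1 (by decide)) (by decide)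
  have h02 := exists_isStretched_or hα hn (hle 0 (by decide)) (hle 2 (by decide)) (by decide)
  have h12 := exists_isStretched_or hα hn (hle 1 (by decide)) (hle 2 (by decide)) (by decide)
  rcases h01 with ⟨m, hm, h⟩ | ⟨m, hm, h⟩
  · rcases h12 with ⟨m', hm', h'⟩ | ⟨m', hm', h'⟩
    · exact ⟨0, 1, m, m', by decide, hm, hm', h, h'⟩
    · exact ⟨0, 2, m, m', by decide, hm, hm', h, h'⟩
  · rcases h02 with ⟨m', hm', h'⟩ | ⟨m', hm', h'⟩
    · exact ⟨1, 0, m, m', by decide, hm, hm', h, h'⟩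
    · exact ⟨1, 2, m, m', by decide, hm, hm', h, h'⟩

/-! ### Partial derivatives on the torus -/

/-- `F'` is the partial derivative of `F` in the direction of the coordinate `j`: the derivative
along `h ↦ x + h e_j`, so that no lift to `ℝ⁴` is involved. -/
def HasPartial (j : Fin 4) (F F' : Torus → ℝ) : Prop :=
  ∀ x, HasDerivAt (fun h : ℝ => F (x + Pi.single j (h : UnitAddCircle))) (F' x) 0

namespace HasPartial

variable {j : Fin 4} {F F' G G' : Torus → ℝ}

theorem hasDerivAt (hF : HasPartial j F F') (x : Torus) (h : ℝ) :
    HasDerivAt (fun h : ℝ => F (x + Pi.single j (h : UnitAddCircle)))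
      (F' (x + Pi.single j (h : UnitAddCircle))) h := by
  have h1 := hF (x + Pi.single j (h : UnitAddCircle))
  have h2 := HasDerivAt.comp_sub_const h h (f := fun k : ℝ =>
    F (x + Pi.single j (h : UnitAddCircle) + Pi.single j (k : UnitAddCircle)))
    (f' := F' (x + Pi.single j (h : UnitAddCircle))) (by rw [sub_self]; exact h1)
  refine h2.congr_of_eventuallyEq (Eventually.of_forall fun k => ?_)
  dsimp only
  rw [add_assoc, ← Pi.single_add, ← AddCircle.coe_add, add_sub_cancel]

theorem add (hF : HasPartial j F F') (hG : HasPartial j G G') :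
    HasPartial j (fun x => F x + G x) (fun x => F' x + G' x) := fun x => (hF x).add (hG x)

theorem mul (hF : HasPartial j F F') (hG : HasPartial j G G') :
    HasPartial j (fun x => F x * G x) (fun x => F' x * G x + F x * G' x) := fun x => by
  simpa using (hF x).fun_mul (hG x)

theorem neg (hF : HasPartial j F F') : HasPartial j (fun x => -F x) (fun x => -F' x) :=
  fun x => (hF x).neg

theorem sum {ι : Type*} (s : Finset ι) {F F' : ι → Torus → ℝ}
    (hF : ∀ i ∈ s, HasPartial j (F i) (F' i)) :
    HasPartial j (fun x => ∑ i ∈ s, F i x) (fun x => ∑ i ∈ s, F' i x) :=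
  fun x => HasDerivAt.fun_sum fun i hi => hF i hi x

theorem comp_add (hF : HasPartial j F F') (c : Torus) :
    HasPartial j (fun x => F (x + c)) (fun x => F' (x + c)) := fun x => by
  have := hF (x + c)
  simp only [add_right_comm x _ c]
  exact this

theorem comp_const_sub {ψ ψ' : ℝ → ℝ} (hψ : ∀ t, HasDerivAt ψ (ψ' t) t) (hF : HasPartial j F F')
    (r : ℝ) : HasPartial j (fun x => ψ (r - F x)) (fun x => -(ψ' (r - F x) * F' x)) := fun x => by
  have h := (hψ (r - F (x + Pi.single j ((0 : ℝ) : UnitAddCircle)))).comp 0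
    ((hasDerivAt_const (0 : ℝ) r).sub (hF x))
  simpa [Function.comp_def] using h

theorem comp_apply {s s' : UnitAddCircle → ℝ}
    (hs : ∀ y, HasDerivAt (fun h : ℝ => s (y + (h : UnitAddCircle))) (s' y) 0) (j : Fin 4) :
    HasPartial j (fun x => s (x j)) (fun x => s' (x j)) := fun x => by
  simpa using hs (x j)

theorem comp_apply_ne (s : UnitAddCircle → ℝ) {i : Fin 4} (hij : i ≠ j) :
    HasPartial j (fun x => s (x i)) (fun _ => 0) := fun x => by
  simpa [Pi.single_eq_of_ne hij] using hasDerivAt_const (0 : ℝ) (s (x i))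

theorem aestronglyMeasurable (hF : HasPartial j F F') (hc : Continuous F) :
    AEStronglyMeasurable F' volume := by
  have hu : Tendsto (fun n : ℕ => (1 : ℝ) / ((n : ℝ) + 1)) atTop (𝓝[≠] 0) :=
    tendsto_nhdsWithin_iff.2 ⟨tendsto_one_div_add_atTop_nhds_zero_nat,
      Eventually.of_forall fun n => by
        simp only [mem_compl_iff, mem_singleton_iff]
        positivity⟩
  refine aestronglyMeasurable_of_tendsto_ae (u := atTop) (f := fun (n : ℕ) x =>
    (1 / ((n : ℝ) + 1))⁻¹ * (F (x + Pi.single j ((1 / ((n : ℝ) + 1) : ℝ) : UnitAddCircle)) - F x))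
    (fun n => Continuous.aestronglyMeasurable (by fun_prop)) (Eventually.of_forall fun x => ?_)
  have h := (hasDerivAt_iff_tendsto_slope_zero.1 (hF x)).comp hu
  refine h.congr fun n => ?_
  simp

theorem integrable (hF : HasPartial j F F') (hc : Continuous F) {B : ℝ} (hB : ∀ x, |F' x| ≤ B) :
    Integrable F' volume :=
  Integrable.of_bound (hF.aestronglyMeasurable hc) B (Eventually.of_forall hB)

/-- The integral of a partial derivative vanishes, since the Haar measure is invariant under
translations. -/
theorem integral_eq_zero (hF : HasPartial j F F') (hc : Continuous F) {B : ℝ}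
    (hB : ∀ x, |F' x| ≤ B) : ∫ x, F' x = 0 := by
  have hint : ∀ h : ℝ, Continuous fun x : Torus => F (x + Pi.single j (h : UnitAddCircle)) :=
    fun h => hc.comp (by fun_prop)
  have h := (hasDerivAt_integral_of_dominated_loc_of_deriv_le (μ := (volume : Measure Torus))
    (x₀ := (0 : ℝ)) (s := univ)
    (F := fun (h : ℝ) (x : Torus) => F (x + Pi.single j (h : UnitAddCircle)))
    (F' := fun (h : ℝ) (x : Torus) => F' (x + Pi.single j (h : UnitAddCircle)))
    (bound := fun _ => B)
    univ_mem (Eventually.of_forall fun h => (hint h).aestronglyMeasurable)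
    ((hint 0).integrable_of_hasCompactSupport (HasCompactSupport.of_compactSpace _))
    (by simpa using hF.aestronglyMeasurable hc)
    (Eventually.of_forall fun x h _ => hB _) (integrable_const _)
    (Eventually.of_forall fun x h _ => hF.hasDerivAt x h)).2
  have hconst : (fun h : ℝ => ∫ x : Torus, F (x + Pi.single j (h : UnitAddCircle))) =
      fun _ => ∫ x, F x := by
    funext h
    exact integral_add_right_eq_self F _
  rw [hconst] at h
  have := h.unique (hasDerivAt_const (0 : ℝ) _)
  simpa using this

end HasPartial

/-! ### The resonant weights -/

/-- `sin (2 π q y)` on the circle. -/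
def sinChar (q : ℕ) (y : UnitAddCircle) : ℝ := (fourier (q : ℤ) y).im

/-- The weight `δ² / (sin² (2 π q y) + δ²)`, which is concentrated at the distance `δ / q` from the
critical points of `cos (2 π q y)`. -/
def weight (δ : ℝ) (q : ℕ) (y : UnitAddCircle) : ℝ := δ ^ 2 / (sinChar q y ^ 2 + δ ^ 2)

/-- `sin / (sin² + δ²)`, a regularisation of `1 / sin (2 π q y)`. -/
def regInv (δ : ℝ) (q : ℕ) (y : UnitAddCircle) : ℝ := sinChar q y / (sinChar q y ^ 2 + δ ^ 2)

theorem sinChar_coe (q : ℕ) (x : ℝ) : sinChar q x = Real.sin (2 * Real.pi * q * x) := by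
  unfold sinChar
  rw [fourier_coe_apply]
  have : 2 * (Real.pi : ℂ) * Complex.I * ((q : ℤ) : ℂ) * (x : ℂ) / ((1 : ℝ) : ℂ)
      = ((2 * Real.pi * q * x : ℝ) : ℂ) * Complex.I := by
    push_cast
    ring
  rw [this, Complex.exp_ofReal_mul_I_im]

theorem continuous_sinChar (q : ℕ) : Continuous (sinChar q) :=
  Complex.continuous_im.comp (fourier (q : ℤ)).continuous

theorem fourier_add_coe (q : ℕ) (y : UnitAddCircle) (h : ℝ) :
    fourier (q : ℤ) (y + (h : UnitAddCircle)) = fourier (q : ℤ) y *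
      ((Real.cos (2 * Real.pi * q * h) : ℝ) + (Real.sin (2 * Real.pi * q * h) : ℝ) * Complex.I) := by
  rw [fourier_apply, smul_add, AddCircle.toCircle_add, Circle.coe_mul, ← fourier_apply,
    ← fourier_apply]
  congr 1
  rw [← re_fourier_coe, ← sinChar_coe, sinChar, Complex.re_add_im]

theorem hasDerivAt_re_fourier (q : ℕ) (y : UnitAddCircle) :
    HasDerivAt (fun h : ℝ => (fourier (q : ℤ) (y + (h : UnitAddCircle))).re)
      (-(2 * Real.pi * q * sinChar q y)) 0 := by
  have h : (fun h : ℝ => (fourier (q : ℤ) (y + (h : UnitAddCircle))).re) = fun h : ℝ =>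
      (fourier (q : ℤ) y).re * Real.cos (2 * Real.pi * q * h) -
        (fourier (q : ℤ) y).im * Real.sin (2 * Real.pi * q * h) := by
    funext h
    rw [fourier_add_coe]
    simp only [Complex.add_re, Complex.add_im, Complex.mul_re, Complex.mul_im, Complex.ofReal_re,
      Complex.ofReal_im, Complex.I_re, Complex.I_im]
    ring
  rw [h]
  have hl : HasDerivAt (fun h : ℝ => 2 * Real.pi * q * h) (2 * Real.pi * q) 0 := by
    simpa using (hasDerivAt_id (0 : ℝ)).const_mul (2 * Real.pi * (q : ℝ))
  refine ((hl.cos.const_mul _).sub (hl.sin.const_mul _)).congr_deriv ?_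
  simp [sinChar]
  ring

theorem hasDerivAt_sinChar (q : ℕ) (y : UnitAddCircle) :
    HasDerivAt (fun h : ℝ => sinChar q (y + (h : UnitAddCircle)))
      (2 * Real.pi * q * (fourier (q : ℤ) y).re) 0 := by
  have h : (fun h : ℝ => sinChar q (y + (h : UnitAddCircle))) = fun h : ℝ =>
      (fourier (q : ℤ) y).re * Real.sin (2 * Real.pi * q * h) +
        (fourier (q : ℤ) y).im * Real.cos (2 * Real.pi * q * h) := by
    funext h
    rw [sinChar, fourier_add_coe]
    simp only [Complex.add_re, Complex.add_im, Complex.mul_im, Complex.mul_re, Complex.ofReal_re,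
      Complex.ofReal_im, Complex.I_re, Complex.I_im]
    ring
  rw [h]
  have hl : HasDerivAt (fun h : ℝ => 2 * Real.pi * q * h) (2 * Real.pi * q) 0 := by
    simpa using (hasDerivAt_id (0 : ℝ)).const_mul (2 * Real.pi * (q : ℝ))
  refine ((hl.sin.const_mul _).add (hl.cos.const_mul _)).congr_deriv ?_
  simp
  ring

theorem abs_re_fourier_le (q : ℤ) (y : UnitAddCircle) : |(fourier q y).re| ≤ 1 :=
  (Complex.abs_re_le_norm _).trans (norm_fourier_apply q y).le

theorem weight_nonneg (δ : ℝ) (q : ℕ) (y : UnitAddCircle) : 0 ≤ weight δ q y := by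
  unfold weight; positivity

theorem continuous_weight {δ : ℝ} (hδ : 0 < δ) (q : ℕ) : Continuous (weight δ q) :=
  continuous_const.div (((continuous_sinChar q).pow 2).add continuous_const)
    fun y => by positivity

theorem continuous_regInv {δ : ℝ} (hδ : 0 < δ) (q : ℕ) : Continuous (regInv δ q) :=
  (continuous_sinChar q).div (((continuous_sinChar q).pow 2).add continuous_const)
    fun y => by positivity

theorem weight_le_one {δ : ℝ} (hδ : 0 < δ) (q : ℕ) (y : UnitAddCircle) : weight δ q y ≤ 1 := by
  unfold weight
  rw [div_le_one (by positivity)]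
  nlinarith [sq_nonneg (sinChar q y)]

theorem one_sub_weight {δ : ℝ} (hδ : 0 < δ) (q : ℕ) (y : UnitAddCircle) :
    1 - weight δ q y = sinChar q y * regInv δ q y := by
  unfold weight regInv
  have : sinChar q y ^ 2 + δ ^ 2 ≠ 0 := by positivity
  field_simp
  ring

theorem abs_regInv_le {δ : ℝ} (hδ : 0 < δ) (q : ℕ) (y : UnitAddCircle) :
    |regInv δ q y| ≤ 1 / (2 * δ) := by
  unfold regInv
  have : 0 < sinChar q y ^ 2 + δ ^ 2 := by positivity
  rw [abs_div, abs_of_pos this, div_le_div_iff₀ this (by positivity), ← sq_abs (sinChar q y)]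
  nlinarith [sq_nonneg (|sinChar q y| - δ)]

/-- The derivative of `regInv δ q`. -/
def regInvDeriv (δ : ℝ) (q : ℕ) (y : UnitAddCircle) : ℝ :=
  2 * Real.pi * q * (fourier (q : ℤ) y).re * (δ ^ 2 - sinChar q y ^ 2) /
    (sinChar q y ^ 2 + δ ^ 2) ^ 2

theorem hasDerivAt_regInv {δ : ℝ} (hδ : 0 < δ) (q : ℕ) (y : UnitAddCircle) :
    HasDerivAt (fun h : ℝ => regInv δ q (y + (h : UnitAddCircle))) (regInvDeriv δ q y) 0 := by
  have h := hasDerivAt_sinChar q y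
  have h1 := h.div ((h.pow 2).add_const (δ ^ 2)) (by simp; positivity)
  refine h1.congr_deriv ?_
  simp [regInvDeriv]
  ring

theorem abs_regInvDeriv_le {δ : ℝ} (hδ : 0 < δ) (q : ℕ) (y : UnitAddCircle) :
    |regInvDeriv δ q y| ≤ 2 * Real.pi * q * weight δ q y / δ ^ 2 := by
  unfold regInvDeriv weight
  set s := sinChar q y
  have hs : 0 < s ^ 2 + δ ^ 2 := by positivity
  have h1 : |δ ^ 2 - s ^ 2| ≤ s ^ 2 + δ ^ 2 := by
    rw [abs_le]; constructor <;> nlinarith [sq_nonneg s, sq_nonneg δ]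
  have h2 := abs_re_fourier_le q y
  have hpi := Real.pi_pos
  rw [abs_div, abs_mul, abs_mul, abs_of_pos (pow_pos hs 2),
    abs_of_nonneg (by positivity : 0 ≤ 2 * Real.pi * (q : ℝ))]
  calc _ ≤ 2 * Real.pi * q * 1 * (s ^ 2 + δ ^ 2) / (s ^ 2 + δ ^ 2) ^ 2 := by gcongr
    _ = _ := by field_simp

/-! ### Integration by parts in a stretched direction -/

/-- Integration by parts in the direction `j`, away from the critical points of `S`, when
`∂_j S` is close to `κ sin (2 π q x_j)`. -/
theorem abs_integral_mul_one_sub_weight_le {j : Fin 4} {a a' S S' v : Torus → ℝ} {ψ Ψ : ℝ → ℝ}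
    (ha : Continuous a) (ha' : HasPartial j a a') (hS : Continuous S) (hS' : HasPartial j S S')
    (hv : Continuous v) (hv' : HasPartial j v fun _ => 0)
    (hψ : Continuous ψ) (hΨ : ∀ t, HasDerivAt Ψ (ψ t) t)
    {A₀ A₁ P δ κ η : ℝ} {q : ℕ} (hδ : 0 < δ) (hκ : κ ≠ 0)
    (hA₀ : ∀ x, |a x| ≤ A₀) (hA₁ : ∀ x, |a' x| ≤ A₁) (hψP : ∀ t, |ψ t| ≤ P) (hΨP : ∀ t, |Ψ t| ≤ P)
    (hv1 : ∀ x, |v x| ≤ 1) (hη : ∀ x, |κ * sinChar q (x j) - S' x| ≤ η)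
    {E : Set Torus} (hE : MeasurableSet E) (r : ℝ)
    (hout : ∀ x, x ∉ E → (a x = 0 ∧ a' x = 0) ∨ (ψ (r - S x) = 0 ∧ Ψ (r - S x) = 0)) :
    |∫ x, v x * a x * ψ (r - S x) * (1 - weight δ q (x j))| ≤
      ∫ x in E, P / |κ| * ((A₀ * η + A₁) / (2 * δ) +
        2 * Real.pi * q * A₀ / δ ^ 2 * weight δ q (x j)) := by
  have hΨc : Continuous Ψ := continuous_iff_continuousAt.2 fun t => (hΨ t).continuousAt
  have hb : HasPartial j (fun x => regInv δ q (x j)) (fun x => regInvDeriv δ q (x j)) :=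
    HasPartial.comp_apply (hasDerivAt_regInv hδ q) j
  have hbc : Continuous fun x : Torus => regInv δ q (x j) :=
    (continuous_regInv hδ q).comp (continuous_apply j)
  have hwc : Continuous fun x : Torus => weight δ q (x j) :=
    (continuous_weight hδ q).comp (continuous_apply j)
  have hsc : Continuous fun x : Torus => sinChar q (x j) :=
    (continuous_sinChar q).comp (continuous_apply j)
  have hP : 0 ≤ P := (abs_nonneg _).trans (hψP 0)
  have hA₀' : 0 ≤ A₀ := (abs_nonneg _).trans (hA₀ 0)
  have hA₁' : 0 ≤ A₁ := (abs_nonneg _).trans (hA₁ 0)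
  have hη' : 0 ≤ η := (abs_nonneg _).trans (hη 0)
  have hpi := Real.pi_pos
  set M : Torus → ℝ := fun x => (A₀ * η + A₁) / (2 * δ) +
        2 * Real.pi * q * A₀ / δ ^ 2 * weight δ q (x j)
  have hM0 : ∀ x, 0 ≤ M x := fun x => by
    have := weight_nonneg δ q (x j)
    positivity
  have hMc : Continuous M := by fun_prop
  -- the function whose partial derivative is integrated
  have hF := (((hv'.mul ha').mul hb).mul (HasPartial.comp_const_sub hΨ hS' r))
  have hFc : Continuous fun x => v x * a x * regInv δ q (x j) * Ψ (r - S x) := by fun_prop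
  set F' : Torus → ℝ := fun x => ((0 * a x + v x * a' x) * regInv δ q (x j) +
    v x * a x * regInvDeriv δ q (x j)) * Ψ (r - S x) +
    v x * a x * regInv δ q (x j) * -(ψ (r - S x) * S' x)
  set I : Torus → ℝ := fun x => v x * a x * ψ (r - S x) * (1 - weight δ q (x j))
  have hIc : Continuous I := by fun_prop
  -- `κ I + F'` has no term with `S'` left but the error
  have hkey : ∀ x, κ * I x + F' x = v x * a x * regInv δ q (x j) * ψ (r - S x) *
      (κ * sinChar q (x j) - S' x) +
      v x * (a' x * regInv δ q (x j) + a x * regInvDeriv δ q (x j)) * Ψ (r - S x) := fun x => by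
    simp only [I, F', one_sub_weight hδ]
    ring
  have hbound : ∀ x, |κ * I x + F' x| ≤ E.indicator (fun x => P * M x) x := fun x => by
    rw [hkey]
    by_cases hx : x ∈ E
    · rw [indicator_of_mem hx]
      have h1 : |v x * a x * regInv δ q (x j) * ψ (r - S x) * (κ * sinChar q (x j) - S' x)| ≤
          1 * A₀ * (1 / (2 * δ)) * P * η := by
        rw [abs_mul, abs_mul, abs_mul, abs_mul]
        gcongr
        exacts [hv1 x, hA₀ x, abs_regInv_le hδ q _, hψP _, hη x]
      have h2 : |v x * (a' x * regInv δ q (x j) + a x * regInvDeriv δ q (x j)) * Ψ (r - S x)| ≤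
          1 * (A₁ * (1 / (2 * δ)) + A₀ * (2 * Real.pi * q * weight δ q (x j) / δ ^ 2)) * P := by
        have h3 : |a' x * regInv δ q (x j) + a x * regInvDeriv δ q (x j)| ≤
            A₁ * (1 / (2 * δ)) + A₀ * (2 * Real.pi * q * weight δ q (x j) / δ ^ 2) := by
          refine (abs_add_le _ _).trans ?_
          rw [abs_mul, abs_mul]
          gcongr
          exacts [hA₁ x, abs_regInv_le hδ q _, hA₀ x, abs_regInvDeriv_le hδ q _]
        rw [abs_mul, abs_mul]
        have := weight_nonneg δ q (x j)
        gcongr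
        exacts [hv1 x, hΨP _]
      refine (abs_add_le _ _).trans ((add_le_add h1 h2).trans (le_of_eq ?_))
      simp only [M]
      ring
    · rw [indicator_of_notMem hx]
      rcases hout x hx with ⟨h1, h2⟩ | ⟨h1, h2⟩ <;> simp [h1, h2]
  have hindint : Integrable (E.indicator fun x => P * M x) volume :=
    ((hMc.const_mul P).integrable_of_hasCompactSupport
      (HasCompactSupport.of_compactSpace _)).indicator hE
  have hIint : Integrable I volume :=
    hIc.integrable_of_hasCompactSupport (HasCompactSupport.of_compactSpace _)
  obtain ⟨BI, hBI⟩ := isCompact_univ.exists_bound_of_continuousOn hIc.continuousOn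
  obtain ⟨BM, hBM⟩ := isCompact_univ.exists_bound_of_continuousOn hMc.continuousOn
  have hF'B : ∀ x, |F' x| ≤ P * BM + |κ| * BI := fun x => by
    have h1 : |κ * I x + F' x| ≤ P * BM := (hbound x).trans <| by
      refine (indicator_le_self' (fun _ _ => mul_nonneg hP (hM0 _)) x).trans ?_
      gcongr
      exact (le_abs_self _).trans (hBM x (mem_univ x))
    have h2 : |κ * I x| ≤ |κ| * BI := by
      rw [abs_mul]
      gcongr
      exact hBI x (mem_univ x)
    have h3 := abs_sub (κ * I x + F' x) (κ * I x)
    rw [add_sub_cancel_left] at h3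
    linarith
  have hzero : ∫ x, F' x = 0 := hF.integral_eq_zero hFc hF'B
  have hF'int : Integrable F' volume := hF.integrable hFc hF'B
  have h1 : κ * ∫ x, I x = ∫ x, (κ * I x + F' x) := by
    rw [integral_add (hIint.const_mul κ) hF'int, hzero, add_zero, integral_const_mul]
  have h2 : |κ| * |∫ x, I x| ≤ ∫ x in E, P * M x := by
    rw [← abs_mul, h1, ← integral_indicator hE]
    refine (abs_integral_le_integral_abs).trans ?_
    exact integral_mono ((hIint.const_mul κ).add hF'int).abs hindint hbound
  have hκ' : 0 < |κ| := abs_pos.2 hκ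
  change _ ≤ ∫ x in E, P / |κ| * M x
  simp_rw [div_mul_eq_mul_div P]
  rw [integral_div, le_div_iff₀ hκ', mul_comm]
  exact h2

/-! ### Integrals over arcs and multi-intervals -/

/-- The arc `[a, b] mod 1` of the circle. -/
def arc (a b : ℝ) : Set UnitAddCircle := (fun y : ℝ => (y : UnitAddCircle)) '' Icc a b

theorem isCompact_arc (a b : ℝ) : IsCompact (arc a b) :=
  isCompact_Icc.image (AddCircle.continuous_mk' 1)

theorem measurableSet_arc (a b : ℝ) : MeasurableSet (arc a b) :=
  (isCompact_arc a b).isClosed.measurableSet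

theorem multiInterval_eq_pi (a b : Fin 4 → ℝ) :
    multiInterval a b = univ.pi fun j => arc (a j) (b j) := by
  ext x
  simp [multiInterval, arc]

theorem isClosed_multiInterval (a b : Fin 4 → ℝ) : IsClosed (multiInterval a b) := by
  rw [multiInterval_eq_pi]
  exact isClosed_set_pi fun j _ => (isCompact_arc _ _).isClosed

theorem coe_mem_arc {a b x : ℝ} (ha : 0 < a) (hb : b < 1) (hx : x ∈ Ioc (0 : ℝ) 1) :
    (x : UnitAddCircle) ∈ arc a b ↔ x ∈ Icc a b := by
  refine ⟨?_, fun h => mem_image_of_mem _ h⟩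
  rintro ⟨y, hy, hyx⟩
  have hx' : x ∈ Ioc (0 : ℝ) (0 + 1) := by simpa using hx
  have hy' : y ∈ Ioc (0 : ℝ) (0 + 1) := ⟨by linarith [hy.1], by linarith [hy.2]⟩
  have : Fact ((0 : ℝ) < 1) := ⟨one_pos⟩
  rw [← (AddCircle.coe_eq_coe_iff_of_mem_Ioc hy' hx').1 hyx]
  exact hy

theorem setIntegral_arc {a b : ℝ} (ha : 0 < a) (hab : a ≤ b) (hb : b < 1)
    (g : UnitAddCircle → ℝ) : ∫ y in arc a b, g y = ∫ x in a..b, g x := by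
  rw [← integral_indicator (measurableSet_arc a b), ← UnitAddCircle.integral_preimage 0,
    intervalIntegral.integral_of_le hab, ← integral_Icc_eq_integral_Ioc (x := a), zero_add]
  have h : ∀ x ∈ Ioc (0 : ℝ) 1, (arc a b).indicator g x =
      (Icc a b).indicator (fun x : ℝ => g x) x := fun x hx => by
    by_cases h : x ∈ Icc a b
    · rw [indicator_of_mem h, indicator_of_mem ((coe_mem_arc ha hb hx).2 h)]
    · rw [indicator_of_notMem h, indicator_of_notMem (mt (coe_mem_arc ha hb hx).1 h)]
  rw [setIntegral_congr_fun measurableSet_Ioc h, integral_indicator measurableSet_Icc,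
    Measure.restrict_restrict measurableSet_Icc]
  congr 2
  refine inter_eq_left.2 fun x hx => ⟨by linarith [hx.1], by linarith [hx.2]⟩

theorem volume_real_arc {a b : ℝ} (ha : 0 < a) (hab : a ≤ b) (hb : b < 1) :
    volume.real (arc a b) = b - a := by
  have h := setIntegral_arc ha hab hb fun _ => 1
  simpa using h

theorem setIntegral_multiInterval (a b : Fin 4 → ℝ) (g : Fin 4 → UnitAddCircle → ℝ) :
    ∫ x in multiInterval a b, ∏ j, g j (x j) = ∏ j, ∫ y in arc (a j) (b j), g j y := by
  rw [multiInterval_eq_pi, volume_pi, Measure.restrict_pi_pi, integral_fintype_prod_eq_prod]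

theorem volume_real_multiInterval (a b : Fin 4 → ℝ) :
    volume.real (multiInterval a b) = ∏ j, volume.real (arc (a j) (b j)) := by
  have h := setIntegral_multiInterval a b fun _ _ => 1
  simpa using h

/-- Over half a period the weight has integral at most `δ / q`. -/
theorem integral_weight_half_period_le {δ : ℝ} (hδ : 0 < δ) {q : ℕ} (hq : 0 < q) :
    ∫ x in (-(1 / (4 * q)) : ℝ)..(1 / (4 * q)), weight δ q x ≤ δ / q := by
  have hq' : (0 : ℝ) < q := by exact_mod_cast hq
  have hle : (-(1 / (4 * q)) : ℝ) ≤ 1 / (4 * q) := by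
    have : (0 : ℝ) < 1 / (4 * q) := by positivity
    linarith
  have hpt : ∀ x ∈ Icc (-(1 / (4 * q)) : ℝ) (1 / (4 * q)),
      weight δ q x ≤ (1 + (4 * q / δ * x) ^ 2)⁻¹ := fun x hx => by
    have hx' : |2 * (q * x)| ≤ 1 / 2 := by
      rw [abs_le]
      have h1 : (q : ℝ) * (1 / (4 * q)) = 1 / 4 := by field_simp
      constructor
      · nlinarith [mul_le_mul_of_nonneg_left hx.1 hq'.le]
      · nlinarith [mul_le_mul_of_nonneg_left hx.2 hq'.le]
    have h2 := two_mul_abs_le_abs_sin hx'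
    have h3 : (4 * (q * x)) ^ 2 ≤ sinChar q x ^ 2 := by
      rw [sinChar_coe, ← sq_abs, ← sq_abs (Real.sin _)]
      have : Real.sin (2 * Real.pi * q * x) = Real.sin (Real.pi * (2 * (q * x))) := by
        congr 1; ring
      rw [this]
      refine pow_le_pow_left₀ (abs_nonneg _) ?_ 2
      refine le_trans (le_of_eq ?_) h2
      rw [abs_mul, abs_mul, abs_mul]
      norm_num
      ring
    unfold weight
    rw [← one_div, div_le_div_iff₀ (by positivity) (by positivity)]
    have : δ ^ 2 * (1 + (4 * q / δ * x) ^ 2) = δ ^ 2 + (4 * (q * x)) ^ 2 := by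
      field_simp
    rw [this]
    linarith
  have hc1 : Continuous fun x : ℝ => weight δ q x :=
    (continuous_weight hδ q).comp (AddCircle.continuous_mk' 1)
  have hc2 : Continuous fun x : ℝ => (1 + (4 * q / δ * x) ^ 2)⁻¹ :=
    Continuous.inv₀ (by fun_prop) fun x => by positivity
  refine (intervalIntegral.integral_mono_on hle (hc1.intervalIntegrable _ _)
    (hc2.intervalIntegrable _ _) hpt).trans ?_
  have hne : (4 * q / δ : ℝ) ≠ 0 := by positivity
  rw [intervalIntegral.integral_comp_mul_left (fun y : ℝ => (1 + y ^ 2)⁻¹) hne,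
    integral_inv_one_add_sq, smul_eq_mul]
  have h1 : ∀ y, Real.arctan y ≤ 2 := fun y =>
    (Real.arctan_lt_pi_div_two y).le.trans (by linarith [Real.pi_le_four])
  have h2 : ∀ y, -2 ≤ Real.arctan y := fun y =>
    le_trans (by linarith [Real.pi_le_four]) (Real.neg_pi_div_two_lt_arctan y).le
  calc _ ≤ (4 * q / δ : ℝ)⁻¹ * 4 := by
        gcongr
        linarith [h1 (4 * q / δ * (1 / (4 * q))), h2 (4 * q / δ * -(1 / (4 * q)))]
    _ = _ := by field_simp

theorem weight_coe_periodic (δ : ℝ) {q : ℕ} (hq : 0 < q) :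
    Function.Periodic (fun x : ℝ => weight δ q x) (1 / (2 * q)) := fun x => by
  have hq' : (0 : ℝ) < q := by exact_mod_cast hq
  simp only [weight, sinChar_coe]
  have : 2 * Real.pi * q * (x + 1 / (2 * q)) = 2 * Real.pi * q * x + Real.pi := by field_simp
  rw [this, Real.sin_add_pi, neg_sq]

theorem setIntegral_arc_weight_le {δ : ℝ} (hδ : 0 < δ) {q : ℕ} (hq : 0 < q) {a b : ℝ} (ha : 0 < a)
    (hb : b < 1) (hab : 1 ≤ 8 * (q * (b - a))) :
    ∫ y in arc a b, weight δ q y ≤ 10 * δ * volume.real (arc a b) := by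
  have hq' : (0 : ℝ) < q := by exact_mod_cast hq
  have hab' : a ≤ b := by
    by_contra h
    nlinarith [mul_neg_of_pos_of_neg hq' (by linarith : b - a < 0)]
  have hc : Continuous fun x : ℝ => weight δ q x :=
    (continuous_weight hδ q).comp (AddCircle.continuous_mk' 1)
  rw [setIntegral_arc ha hab' hb, volume_real_arc ha hab' hb]
  set k := ⌈2 * q * (b - a)⌉₊
  have hk1 : 2 * q * (b - a) ≤ k := Nat.le_ceil _
  have hk2 : (k : ℝ) < 2 * q * (b - a) + 1 :=
    Nat.ceil_lt_add_one (mul_nonneg (by positivity) (by linarith))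
  have hbk : b ≤ a + k • (1 / (2 * q) : ℝ) := by
    have h : (k • (1 / (2 * q) : ℝ)) * (2 * q) = k := by simp; field_simp
    have h2 : (b - a) * (2 * q) ≤ (k • (1 / (2 * q) : ℝ)) * (2 * q) := by rw [h]; linarith
    linarith [le_of_mul_le_mul_right h2 (by positivity)]
  have hper := (weight_coe_periodic δ hq)
  calc ∫ x in a..b, weight δ q x ≤ ∫ x in a..(a + k • (1 / (2 * q) : ℝ)), weight δ q x := by
        refine intervalIntegral.integral_mono_interval le_rfl hab' hbk
          (Eventually.of_forall fun x => weight_nonneg _ _ _) (hc.intervalIntegrable _ _)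
    _ = k • ∫ x in a..(a + 1 / (2 * q)), weight δ q x := by
        have h := hper.intervalIntegral_add_zsmul_eq k a fun _ _ => hc.intervalIntegrable _ _
        simpa using h
    _ = k • ∫ x in (-(1 / (4 * q)) : ℝ)..(-(1 / (4 * q)) + 1 / (2 * q)), weight δ q x := by
        rw [hper.intervalIntegral_add_eq a (-(1 / (4 * q)))]
    _ ≤ k * (δ / q) := by
        rw [nsmul_eq_mul]
        gcongr
        have h := integral_weight_half_period_le hδ hq
        rwa [show (-(1 / (4 * q)) + 1 / (2 * q) : ℝ) = 1 / (4 * q) by field_simp; norm_num]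
    _ ≤ (10 * (q * (b - a))) * (δ / q) := by
        gcongr
        linarith
    _ = _ := by field_simp

theorem setIntegral_weight_le {δ : ℝ} (hδ : 0 < δ) {q : ℕ} (hq : 0 < q) {a b : Fin 4 → ℝ}
    {j : Fin 4} (ha : 0 < a j) (hb : b j < 1) (hab : 1 ≤ 8 * (q * (b j - a j))) :
    ∫ x in multiInterval a b, weight δ q (x j) ≤
      10 * δ * volume.real (multiInterval a b) := by
  have h := setIntegral_multiInterval a b (Function.update (fun _ _ => 1) j (weight δ q))
  have h1 : ∀ x : Torus, ∏ i, Function.update (fun _ _ => (1 : ℝ)) j (weight δ q) i (x i) =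
      weight δ q (x j) := fun x => by
    rw [← Finset.mul_prod_erase _ _ (Finset.mem_univ j), Function.update_self,
      Finset.prod_eq_one, mul_one]
    intro i hi
    rw [Function.update_of_ne (Finset.ne_of_mem_erase hi)]
  simp_rw [h1] at h
  rw [h, volume_real_multiInterval, ← Finset.mul_prod_erase _ _ (Finset.mem_univ j),
    ← Finset.mul_prod_erase _ (fun j => volume.real (arc (a j) (b j))) (Finset.mem_univ j),
    Function.update_self, ← mul_assoc]
  have h2 : ∏ i ∈ Finset.univ.erase j, ∫ y in arc (a i) (b i),
      Function.update (fun _ _ => (1 : ℝ)) j (weight δ q) i y =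
      ∏ i ∈ Finset.univ.erase j, volume.real (arc (a i) (b i)) :=
    Finset.prod_congr rfl fun i hi => by
      rw [Function.update_of_ne (Finset.ne_of_mem_erase hi)]
      simp
  rw [h2]
  gcongr
  exact setIntegral_arc_weight_le hδ hq ha hb hab

theorem setIntegral_weight_mul_weight_le {δ : ℝ} (hδ : 0 < δ) {q q' : ℕ} (hq : 0 < q)
    (hq' : 0 < q') {a b : Fin 4 → ℝ} {j j' : Fin 4} (hjj : j ≠ j') (ha : 0 < a j) (hb : b j < 1)
    (hab : 1 ≤ 8 * (q * (b j - a j))) (ha' : 0 < a j') (hb' : b j' < 1)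
    (hab' : 1 ≤ 8 * (q' * (b j' - a j'))) :
    ∫ x in multiInterval a b, weight δ q (x j) * weight δ q' (x j') ≤
      100 * δ ^ 2 * volume.real (multiInterval a b) := by
  set G : Fin 4 → UnitAddCircle → ℝ :=
    Function.update (Function.update (fun _ _ => 1) j' (weight δ q')) j (weight δ q) with hG
  have hGj : G j = weight δ q := by simp [hG]
  have hGj' : G j' = weight δ q' := by simp [hG, Function.update_of_ne hjj.symm]
  have hGi : ∀ i ∈ (Finset.univ.erase j).erase j', G i = fun _ => 1 := fun i hi => by
    rw [Finset.mem_erase, Finset.mem_erase] at hi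
    rw [hG, Function.update_of_ne hi.2.1, Function.update_of_ne hi.1]
  have hmem : j' ∈ Finset.univ.erase j := Finset.mem_erase.2 ⟨hjj.symm, Finset.mem_univ _⟩
  have hsplit : ∀ F : Fin 4 → ℝ, ∏ i, F i = F j * (F j' * ∏ i ∈ (Finset.univ.erase j).erase j',
      F i) := fun F => by
    rw [Finset.mul_prod_erase _ _ hmem, Finset.mul_prod_erase _ _ (Finset.mem_univ j)]
  have h := setIntegral_multiInterval a b G
  have h1 : ∀ x : Torus, ∏ i, G i (x i) = weight δ q (x j) * weight δ q' (x j') := fun x => by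
    rw [hsplit, hGj, hGj', Finset.prod_eq_one, mul_one]
    intro i hi
    rw [hGi i hi]
  simp_rw [h1] at h
  have h2 : ∏ i ∈ (Finset.univ.erase j).erase j', ∫ y in arc (a i) (b i), G i y =
      ∏ i ∈ (Finset.univ.erase j).erase j', volume.real (arc (a i) (b i)) :=
    Finset.prod_congr rfl fun i hi => by
      rw [hGi i hi]
      simp
  rw [h, volume_real_multiInterval, hsplit, hsplit, h2, hGj, hGj']
  have h3 := setIntegral_arc_weight_le hδ hq ha hb hab
  have h4 := setIntegral_arc_weight_le hδ hq' ha' hb' hab'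
  have h5 : 0 ≤ ∏ i ∈ (Finset.univ.erase j).erase j', volume.real (arc (a i) (b i)) :=
    Finset.prod_nonneg fun i _ => measureReal_nonneg
  have h6 : 0 ≤ ∫ y in arc (a j') (b j'), weight δ q' y :=
    setIntegral_nonneg (measurableSet_arc _ _) fun y _ => weight_nonneg _ _ _
  calc _ ≤ (10 * δ * volume.real (arc (a j) (b j))) * ((10 * δ * volume.real (arc (a j') (b j'))) *
        ∏ i ∈ (Finset.univ.erase j).erase j', volume.real (arc (a i) (b i))) := by gcongr
    _ = _ := by ring

/-! ### Birkhoff sums -/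

section Birkhoff

variable (ρ : Torus) (φ : Torus → ℝ)

theorem birkhoff_natCast (n : ℕ) (x : Torus) :
    birkhoff ρ φ n x = ∑ i ∈ Finset.range n, φ (x + i • ρ) := by
  simp [birkhoff]

theorem birkhoff_zero (x : Torus) : birkhoff ρ φ 0 x = 0 := by
  simp [birkhoff]

theorem birkhoff_add_one (N : ℤ) (x : Torus) :
    birkhoff ρ φ (N + 1) x = birkhoff ρ φ N x + φ (x + N • ρ) := by
  obtain ⟨n, rfl | rfl⟩ := Int.eq_nat_or_neg N
  · have : ((n : ℤ) + 1) = ((n + 1 : ℕ) : ℤ) := by push_cast; rfl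
    rw [this, birkhoff_natCast, birkhoff_natCast, Finset.sum_range_succ]
    simp
  · cases n with
    | zero => simp [birkhoff]
    | succ n =>
      have h1 : (-((n + 1 : ℕ) : ℤ) + 1) = -(n : ℤ) := by push_cast; ring
      rw [h1]
      have h2 : (-((n + 1 : ℕ) : ℤ)).toNat = 0 := by omega
      have h3 : (-(n : ℤ)).toNat = 0 := by omega
      have h4 : (- -((n + 1 : ℕ) : ℤ)).toNat = n + 1 := by omega
      have h5 : (- -(n : ℤ)).toNat = n := by omega
      simp only [birkhoff, h2, h3, h4, h5, Finset.sum_range_succ, neg_smul, natCast_zsmul,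
        ← sub_eq_add_neg]
      ring

theorem birkhoff_add (M N : ℤ) (x : Torus) :
    birkhoff ρ φ (M + N) x = birkhoff ρ φ M x + birkhoff ρ φ N (x + M • ρ) := by
  induction N using Int.induction_on with
  | zero => simp [birkhoff_zero]
  | succ n ih =>
    rw [← add_assoc, birkhoff_add_one, ih, birkhoff_add_one, add_smul, add_assoc, add_assoc]
  | pred n ih =>
    have h1 := birkhoff_add_one ρ φ (M + (-n - 1)) x
    have h2 := birkhoff_add_one ρ φ (-n - 1) (x + M • ρ)
    rw [show M + (-(n : ℤ) - 1) + 1 = M + -n by ring, ih] at h1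
    rw [sub_add_cancel] at h2
    rw [add_smul, ← add_assoc] at h1
    linarith

theorem birkhoff_neg (N : ℤ) (x : Torus) :
    birkhoff ρ φ (-N) x = -birkhoff ρ φ N (x + (-N) • ρ) := by
  have h := birkhoff_add ρ φ (-N) N x
  rw [neg_add_cancel, birkhoff_zero] at h
  linarith

variable {ρ φ}

theorem continuous_birkhoff (hφ : Continuous φ) (N : ℤ) : Continuous (birkhoff ρ φ N) := by
  unfold birkhoff
  fun_prop

theorem HasPartial.birkhoff {j : Fin 4} {φ' : Torus → ℝ} (h : HasPartial j φ φ') (N : ℤ) :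
    HasPartial j (birkhoff ρ φ N) (birkhoff ρ φ' N) := by
  have h1 := (HasPartial.sum (Finset.range N.toNat) fun i _ => h.comp_add (i • ρ)).add
    (HasPartial.sum (Finset.range (-N).toNat) fun i _ => h.comp_add (-((i + 1) • ρ))).neg
  intro x
  simpa only [TorusFlow.birkhoff, sub_eq_add_neg] using h1 x

theorem le_birkhoff_sub {c : ℝ} (hc : ∀ x, c ≤ φ x) {M N : ℤ} (h : M ≤ N) (x : Torus) :
    c * (N - M : ℤ) ≤ birkhoff ρ φ N x - birkhoff ρ φ M x := by
  obtain ⟨n, hn⟩ := Int.eq_ofNat_of_zero_le (sub_nonneg.2 h)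
  have h1 := birkhoff_add ρ φ M n x
  rw [show M + (n : ℤ) = N by omega, birkhoff_natCast] at h1
  rw [h1, add_sub_cancel_left, hn, mul_comm]
  have := Finset.card_nsmul_le_sum (Finset.range n) (fun i => φ (x + M • ρ + i • ρ)) c
    fun i _ => hc _
  simpa using this

theorem birkhoff_sub_le {c : ℝ} (hc : ∀ x, φ x ≤ c) {M N : ℤ} (h : M ≤ N) (x : Torus) :
    birkhoff ρ φ N x - birkhoff ρ φ M x ≤ c * (N - M : ℤ) := by
  obtain ⟨n, hn⟩ := Int.eq_ofNat_of_zero_le (sub_nonneg.2 h)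
  have h1 := birkhoff_add ρ φ M n x
  rw [show M + (n : ℤ) = N by omega, birkhoff_natCast] at h1
  rw [h1, add_sub_cancel_left, hn, mul_comm]
  have := Finset.sum_le_card_nsmul (Finset.range n) (fun i => φ (x + M • ρ + i • ρ)) c
    fun i _ => hc _
  simpa using this

theorem mul_abs_sub_le_abs_birkhoff_sub {c : ℝ} (hc : ∀ x, c ≤ φ x) (M N : ℤ) (x : Torus) :
    c * (|M - N| : ℤ) ≤ |birkhoff ρ φ M x - birkhoff ρ φ N x| := by
  rcases le_total M N with h | h
  · rw [abs_sub_comm, abs_sub_comm (birkhoff ρ φ M x), abs_of_nonneg (sub_nonneg.2 h)]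
    exact (le_birkhoff_sub hc h x).trans (le_abs_self _)
  · rw [abs_of_nonneg (sub_nonneg.2 h)]
    exact (le_birkhoff_sub hc h x).trans (le_abs_self _)

theorem mul_abs_le_abs_birkhoff {c : ℝ} (hc : ∀ x, c ≤ φ x) (N : ℤ) (x : Torus) :
    c * (|N| : ℤ) ≤ |birkhoff ρ φ N x| := by
  simpa [birkhoff_zero] using mul_abs_sub_le_abs_birkhoff_sub hc N 0 x

theorem abs_birkhoff_le {c c' : ℝ} (hc0 : 0 ≤ c) (hc : ∀ x, c ≤ φ x) (hc' : ∀ x, φ x ≤ c') (N : ℤ)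
    (x : Torus) : |birkhoff ρ φ N x| ≤ c' * (|N| : ℤ) := by
  rcases le_total 0 N with h | h
  · have h1 := le_birkhoff_sub (ρ := ρ) hc h x
    have h2 := birkhoff_sub_le (ρ := ρ) hc' h x
    have h3 : (0 : ℝ) ≤ c * (N - 0 : ℤ) :=
      mul_nonneg hc0 (by exact_mod_cast (sub_nonneg.2 h))
    simp only [birkhoff_zero, sub_zero] at h1 h2 h3
    rw [abs_of_nonneg h, abs_of_nonneg (h3.trans h1)]
    simpa using h2
  · have h1 := le_birkhoff_sub (ρ := ρ) hc h x
    have h2 := birkhoff_sub_le (ρ := ρ) hc' h x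
    have h3 : (0 : ℝ) ≤ c * (0 - N : ℤ) :=
      mul_nonneg hc0 (by exact_mod_cast (sub_nonneg.2 h))
    simp only [birkhoff_zero, zero_sub] at h1 h2 h3
    rw [abs_of_nonpos h, ← abs_neg, abs_of_nonneg (h3.trans h1)]
    simpa using h2

end Birkhoff

/-! ### The ceiling function and the derivatives of its Birkhoff sums -/

theorem IsConvergents.summable_sq_div_exp {x : ℝ} {q : ℕ → ℕ} {p : ℕ → ℤ}
    (h : IsConvergents x q p) (n₀ : ℕ) :
    Summable fun n => (q (n₀ + n) : ℝ) ^ 2 / Real.exp (q (n₀ + n)) := by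
  have hs : Summable fun n : ℕ => 96 * (1 / (n + 1 : ℝ) ^ 2) :=
    (((summable_nat_add_iff 1).2 (Real.summable_one_div_nat_pow.2 one_lt_two)).congr
      fun n => by push_cast; rfl).mul_left 96
  refine Summable.of_nonneg_of_le (fun n => by positivity) (fun n => ?_) hs
  set k := q (n₀ + n)
  have hk : (n + 1 : ℝ) ≤ 2 * k := by
    have h1 := h.le_self (n₀ + n)
    have h2 := h.pos (n₀ + n)
    have h3 : n + 1 ≤ 2 * k := by omega
    exact_mod_cast h3
  have hk0 : (0 : ℝ) < k := by exact_mod_cast h.pos _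
  -- with `n + 1 ≤ 2 k` this gives the constant `96 = 4 * 24`
  have he : (k : ℝ) ^ 4 ≤ 24 * Real.exp k := by
    have := Real.pow_div_factorial_le_exp (k : ℝ) hk0.le 4
    norm_num [Nat.factorial] at this
    linarith
  rw [mul_one_div, div_le_div_iff₀ (Real.exp_pos _) (by positivity)]
  calc (k : ℝ) ^ 2 * (n + 1 : ℝ) ^ 2 ≤ (k : ℝ) ^ 2 * (2 * k) ^ 2 := by gcongr
    _ = 4 * (k : ℝ) ^ 4 := by ring
    _ ≤ _ := by linarith

theorem hasDerivAt_circle {s s' : UnitAddCircle → ℝ}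
    (hs : ∀ y, HasDerivAt (fun h : ℝ => s (y + (h : UnitAddCircle))) (s' y) 0) (y : UnitAddCircle)
    (h : ℝ) : HasDerivAt (fun h : ℝ => s (y + (h : UnitAddCircle)))
      (s' (y + (h : UnitAddCircle))) h := by
  have h2 := HasDerivAt.comp_sub_const h h (f := fun k : ℝ =>
    s (y + (h : UnitAddCircle) + (k : UnitAddCircle)))
    (f' := s' (y + (h : UnitAddCircle))) (by rw [sub_self]; exact hs _)
  refine h2.congr_of_eventuallyEq (Eventually.of_forall fun k => ?_)
  dsimp only
  rw [add_assoc, ← AddCircle.coe_add, add_sub_cancel]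

/-- The amplitude `-2 π q e^{-q}` of the derivative of the term of frequency `q` of the ceiling
function. -/
def amp (q : ℕ) : ℝ := -(2 * Real.pi * q / Real.exp q)

theorem abs_amp (q : ℕ) : |amp q| = 2 * Real.pi * q / Real.exp q := by
  rw [amp, abs_neg, abs_of_nonneg (by positivity)]

/-- The derivative of the part of the ceiling function that depends on one coordinate. -/
def ceilingDeriv (q : ℕ → ℕ) (n₀ : ℕ) (y : UnitAddCircle) : ℝ :=
  ∑' n, amp (q (n₀ + n)) * sinChar (q (n₀ + n)) y

theorem abs_sinChar_le (q : ℕ) (y : UnitAddCircle) : |sinChar q y| ≤ 1 :=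
  (Complex.abs_im_le_norm _).trans (norm_fourier_apply q y).le

namespace IsConvergents

variable {x : ℝ} {q : ℕ → ℕ} {p : ℕ → ℤ}

theorem abs_amp_mul_sinChar_le (h : IsConvergents x q p) (n : ℕ) (y : UnitAddCircle) :
    |amp (q n) * sinChar (q n) y| ≤ 2 * Real.pi * ((q n : ℝ) ^ 2 / Real.exp (q n)) := by
  have hq : (1 : ℝ) ≤ q n := by exact_mod_cast h.pos n
  rw [abs_mul, abs_amp]
  calc _ ≤ 2 * Real.pi * q n / Real.exp (q n) * 1 := by gcongr; exact abs_sinChar_le _ _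
    _ = 2 * Real.pi * (q n / Real.exp (q n)) := by ring
    _ ≤ _ := by
      have := Real.pi_pos
      gcongr
      nlinarith

theorem abs_re_fourier_div_le (h : IsConvergents x q p) (n : ℕ) (y : UnitAddCircle) :
    |(fourier (q n : ℤ) y).re / Real.exp (q n)| ≤ (q n : ℝ) ^ 2 / Real.exp (q n) := by
  have hq : (1 : ℝ) ≤ q n := by exact_mod_cast h.pos n
  rw [abs_div, abs_of_pos (Real.exp_pos _)]
  gcongr
  exact (abs_re_fourier_le _ _).trans (by nlinarith)

theorem summable_amp_mul_sinChar (h : IsConvergents x q p) (n₀ : ℕ) (y : UnitAddCircle) :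
    Summable fun n => amp (q (n₀ + n)) * sinChar (q (n₀ + n)) y :=
  Summable.of_norm_bounded ((h.summable_sq_div_exp n₀).mul_left (2 * Real.pi))
    fun _ => h.abs_amp_mul_sinChar_le _ _

theorem hasDerivAt_tsum_re_fourier (h : IsConvergents x q p) (n₀ : ℕ) (y : UnitAddCircle) :
    HasDerivAt (fun t : ℝ => ∑' n, (fourier (q (n₀ + n) : ℤ) (y + (t : UnitAddCircle))).re /
      Real.exp (q (n₀ + n))) (ceilingDeriv q n₀ y) 0 := by
  have h1 := hasDerivAt_tsum (y₀ := (0 : ℝ))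
    (g := fun (n : ℕ) (t : ℝ) => (fourier (q (n₀ + n) : ℤ) (y + (t : UnitAddCircle))).re /
      Real.exp (q (n₀ + n)))
    (g' := fun (n : ℕ) (t : ℝ) =>
      amp (q (n₀ + n)) * sinChar (q (n₀ + n)) (y + (t : UnitAddCircle)))
    ((h.summable_sq_div_exp n₀).mul_left (2 * Real.pi)) (fun n t => ?_)
    (fun n t => h.abs_amp_mul_sinChar_le _ _)
    (Summable.of_norm_bounded (h.summable_sq_div_exp n₀) fun n => h.abs_re_fourier_div_le _ _) 0
  · simpa [ceilingDeriv] using h1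
  · refine ((hasDerivAt_circle (s := fun y => (fourier (q (n₀ + n) : ℤ) y).re)
      (hasDerivAt_re_fourier (q (n₀ + n))) y t).div_const _).congr_deriv ?_
    rw [amp]
    ring

/-- The derivative of the Birkhoff sum is that of its term of index `m`: the earlier terms have
bounded sums by the bound on exponential sums, the later ones have tiny coefficients. -/
theorem exists_abs_sum_ceilingDeriv_sub_le (h : IsConvergents x q p) (n₀ : ℕ) :
    ∃ A : ℝ, 0 < A ∧ ∀ m, n₀ ≤ m → ∀ (N : ℕ) (y : UnitAddCircle),
      |∑ i ∈ Finset.range N, ceilingDeriv q n₀ (y + i • (x : UnitAddCircle)) -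
        N * amp (q m) * sinChar (q m) y| ≤ A * (q m + (N : ℝ) ^ 2 / q (m + 1)) := by
  obtain ⟨A₁, hA₁, hsum⟩ := h.exists_norm_sum_fourier_le
  set A₂ := ∑' n, 2 * Real.pi * ((q (n₀ + n) : ℝ) ^ 2 / Real.exp (q (n₀ + n)))
  have hA₂ : 0 ≤ A₂ := tsum_nonneg fun n => by have := Real.pi_pos; positivity
  have hA₂s : HasSum (fun n => 2 * Real.pi * ((q (n₀ + n) : ℝ) ^ 2 / Real.exp (q (n₀ + n)))) A₂ :=
    ((h.summable_sq_div_exp n₀).mul_left (2 * Real.pi)).hasSum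
  set B := A₁ + 2 * Real.pi
  have hpi := Real.pi_pos
  refine ⟨B * A₂ + 1, by positivity, fun m hm N y => ?_⟩
  set X : ℝ := B * (q m + (N : ℝ) ^ 2 / q (m + 1))
  have hqm1 : (1 : ℝ) ≤ q (m + 1) := by exact_mod_cast h.pos (m + 1)
  have hN2 : (N : ℝ) ≤ (N : ℝ) ^ 2 := by
    exact_mod_cast Nat.le_self_pow two_ne_zero N
  have hX0 : 0 ≤ X := by positivity
  -- the error of each frequency
  have herr : ∀ k, |∑ i ∈ Finset.range N, sinChar (q k) (y + i • (x : UnitAddCircle)) -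
      (if k = m then N * sinChar (q m) y else 0)| ≤ X * q k := by
    intro k
    have hqk : (1 : ℝ) ≤ q k := by exact_mod_cast h.pos k
    rcases lt_trichotomy k m with hk | rfl | hk
    · rw [if_neg hk.ne, sub_zero]
      have h1 : ∑ i ∈ Finset.range N, sinChar (q k) (y + i • (x : UnitAddCircle)) =
          (∑ i ∈ Finset.range N, fourier (q k : ℤ) (y + i • (x : UnitAddCircle))).im := by
        rw [Complex.im_sum]; rfl
      have hq : (q (k + 1) : ℝ) ≤ q m := by exact_mod_cast h.mono hk
      rw [h1]
      calc _ ≤ A₁ * q (k + 1) := (Complex.abs_im_le_norm _).trans (hsum k N y)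
        _ ≤ B * (q m + (N : ℝ) ^ 2 / q (m + 1)) := by
          gcongr
          · simp only [B]; linarith
          · exact hq.trans (le_add_of_nonneg_right (by positivity))
        _ ≤ _ := le_mul_of_one_le_right hX0 hqk
    · rw [if_pos rfl]
      have h1 : ∑ i ∈ Finset.range N, sinChar (q k) (y + i • (x : UnitAddCircle)) -
          N * sinChar (q k) y =
          ∑ i ∈ Finset.range N, (sinChar (q k) (y + i • (x : UnitAddCircle)) - sinChar (q k) y) := by
        rw [Finset.sum_sub_distrib]
        simp
      rw [h1]
      refine le_trans ?_ (le_mul_of_one_le_right hX0 hqk)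
      calc _ ≤ ∑ i ∈ Finset.range N, 2 * Real.pi * N / q (k + 1) := by
            refine (Finset.abs_sum_le_sum_abs _ _).trans (Finset.sum_le_sum fun i hi => ?_)
            have h2 := h.norm_fourier_add_nsmul_sub_le k i y
            have h3 : (i : ℝ) ≤ N := by exact_mod_cast (Finset.mem_range.1 hi).le
            calc _ ≤ 2 * Real.pi * i / q (k + 1) := by
                  rw [sinChar, sinChar, ← Complex.sub_im]
                  exact (Complex.abs_im_le_norm _).trans h2
              _ ≤ _ := by gcongr
        _ = 2 * Real.pi * ((N : ℝ) ^ 2 / q (k + 1)) := by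
            rw [Finset.sum_const, Finset.card_range, nsmul_eq_mul]
            ring
        _ ≤ _ := by
            simp only [X, B]
            gcongr
            · linarith
            · exact le_add_of_nonneg_left (by positivity)
    · rw [if_neg hk.ne', sub_zero]
      have hq : (q (m + 1) : ℝ) ≤ q k := by exact_mod_cast h.mono hk
      calc _ ≤ (N : ℝ) := by
            refine (Finset.abs_sum_le_sum_abs _ _).trans ((Finset.sum_le_sum fun i _ =>
              abs_sinChar_le _ _).trans ?_)
            simp
        _ ≤ (N : ℝ) ^ 2 := hN2
        _ = (N : ℝ) ^ 2 / q (m + 1) * q (m + 1) := by field_simp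
        _ ≤ X * q k := by
          gcongr
          simp only [X]
          calc (N : ℝ) ^ 2 / q (m + 1) ≤ 1 * (q m + (N : ℝ) ^ 2 / q (m + 1)) := by
                rw [one_mul]; exact le_add_of_nonneg_left (by positivity)
            _ ≤ _ := by
              gcongr
              simp only [B]
              linarith [Real.pi_gt_three]
  obtain ⟨m', rfl⟩ := Nat.exists_eq_add_of_le hm
  have hsummable := fun i : ℕ => h.summable_amp_mul_sinChar n₀ (y + i • (x : UnitAddCircle))
  have h1 : ∑ i ∈ Finset.range N, ceilingDeriv q n₀ (y + i • (x : UnitAddCircle)) =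
      ∑' n, amp (q (n₀ + n)) *
        ∑ i ∈ Finset.range N, sinChar (q (n₀ + n)) (y + i • (x : UnitAddCircle)) := by
    simp only [ceilingDeriv, Finset.mul_sum]
    rw [Summable.tsum_finsetSum fun i _ => hsummable i]
  have h2 : N * amp (q (n₀ + m')) * sinChar (q (n₀ + m')) y =
      ∑' n, amp (q (n₀ + n)) * (if n₀ + n = n₀ + m' then N * sinChar (q (n₀ + m')) y else 0) := by
    rw [tsum_eq_single m']
    · simp; ring
    · intro n hn
      rw [if_neg (by omega), mul_zero]
  have hs1 : Summable fun n => amp (q (n₀ + n)) *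
      ∑ i ∈ Finset.range N, sinChar (q (n₀ + n)) (y + i • (x : UnitAddCircle)) := by
    simp only [Finset.mul_sum]
    exact summable_sum fun i _ => hsummable i
  have hs2 : Summable fun n => amp (q (n₀ + n)) *
      (if n₀ + n = n₀ + m' then N * sinChar (q (n₀ + m')) y else 0) :=
    summable_of_ne_finset_zero (s := {m'}) fun n hn => by
      rw [if_neg (by simpa using hn), mul_zero]
  rw [h1, h2, ← hs1.tsum_sub hs2]
  have h3 := tsum_of_norm_bounded (hA₂s.mul_left X) (f := fun n => amp (q (n₀ + n)) *
      ∑ i ∈ Finset.range N, sinChar (q (n₀ + n)) (y + i • (x : UnitAddCircle)) -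
      amp (q (n₀ + n)) *
      (if n₀ + n = n₀ + m' then N * sinChar (q (n₀ + m')) y else 0)) fun n => by
    rw [← mul_sub, Real.norm_eq_abs, abs_mul, abs_amp]
    calc _ ≤ 2 * Real.pi * q (n₀ + n) / Real.exp (q (n₀ + n)) * (X * q (n₀ + n)) := by
          gcongr
          exact herr _
      _ = _ := by ring
  refine h3.trans ?_
  simp only [X]
  have : (0 : ℝ) ≤ q (n₀ + m') + (N : ℝ) ^ 2 / q (n₀ + m' + 1) := by positivity
  nlinarith

end IsConvergents

/-- The partial derivatives of the ceiling function. -/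
def ceilingPartial (α : Fin 4 → ℝ) (n₀ : ℕ) (j : Fin 4) (x : Torus) : ℝ :=
  ceilingDeriv (convDen (α j)) n₀ (x j)

theorem hasPartial_ceiling {α : Fin 4 → ℝ} (hα : α ∈ Y) (n₀ : ℕ) (j : Fin 4) :
    HasPartial j (ceiling α n₀) (ceilingPartial α n₀ j) := by
  intro x
  obtain ⟨p, hp⟩ := exists_isConvergents (tendsto_convDen hα j)
  have h : ∀ i ∈ Finset.univ, HasPartial j (fun x : Torus => ∑' n : ℕ,
      (fourier (convDen (α i) (n₀ + n) : ℤ) (x i)).re / Real.exp (convDen (α i) (n₀ + n)))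
      (fun x => if i = j then ceilingPartial α n₀ j x else 0) := fun i _ => by
    rcases eq_or_ne i j with rfl | hij
    · simp only [if_pos]
      exact HasPartial.comp_apply (s := fun y => ∑' n : ℕ,
        (fourier (convDen (α i) (n₀ + n) : ℤ) y).re / Real.exp (convDen (α i) (n₀ + n)))
        (hp.hasDerivAt_tsum_re_fourier n₀) i
    · simp only [if_neg hij]
      exact HasPartial.comp_apply_ne (fun y => ∑' n : ℕ,
        (fourier (convDen (α i) (n₀ + n) : ℤ) y).re / Real.exp (convDen (α i) (n₀ + n))) hij
  have h1 := (HasPartial.sum Finset.univ h) x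
  simp only [Finset.sum_ite_eq', Finset.mem_univ, if_true] at h1
  exact h1.const_add 1

theorem continuous_ceiling {α : Fin 4 → ℝ} (hα : α ∈ Y) (n₀ : ℕ) : Continuous (ceiling α n₀) := by
  refine continuous_const.add (continuous_finsetSum _ fun j _ => ?_)
  obtain ⟨p, hp⟩ := exists_isConvergents (tendsto_convDen hα j)
  refine continuous_tsum (fun n => ?_) (hp.summable_sq_div_exp n₀)
    fun n x => hp.abs_re_fourier_div_le _ _
  have : Continuous fun x : Torus => (fourier (convDen (α j) (n₀ + n) : ℤ) (x j)).re :=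
    Complex.continuous_re.comp ((fourier _).continuous.comp (continuous_apply j))
  exact this.div_const _

/-- In the direction `j` the Birkhoff sums are stretched at the rate `N q_m e^{-q_m}`, away from
the critical points of `cos (2 π q_m x_j)`. -/
theorem exists_abs_birkhoff_ceilingPartial_sub_le {α : Fin 4 → ℝ} (hα : α ∈ Y) (n₀ : ℕ)
    (j : Fin 4) : ∃ A : ℝ, 0 < A ∧ ∀ m, n₀ ≤ m → ∀ (N : ℤ) (x : Torus),
      |birkhoff (proj α) (ceilingPartial α n₀ j) N x -
        N * amp (convDen (α j) m) * sinChar (convDen (α j) m) (x j)| ≤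
        A * (convDen (α j) m + (N : ℝ) ^ 2 / convDen (α j) (m + 1)) := by
  obtain ⟨p, hp⟩ := exists_isConvergents (tendsto_convDen hα j)
  obtain ⟨A, hA, hA'⟩ := hp.exists_abs_sum_ceilingDeriv_sub_le n₀
  set q := convDen (α j)
  have hpi := Real.pi_pos
  have hnat : ∀ (m : ℕ), n₀ ≤ m → ∀ (n : ℕ) (x : Torus),
      |birkhoff (proj α) (ceilingPartial α n₀ j) n x - n * amp (q m) * sinChar (q m) (x j)| ≤
        A * (q m + (n : ℝ) ^ 2 / q (m + 1)) := fun m hm n x => by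
    rw [birkhoff_natCast]
    exact hA' m hm n (x j)
  refine ⟨A + 2 * Real.pi * (2 * Real.pi), by positivity, fun m hm N x => ?_⟩
  have hq1 : (0 : ℝ) < q (m + 1) := by exact_mod_cast hp.pos _
  have hnn : (0 : ℝ) ≤ q m + (N : ℝ) ^ 2 / q (m + 1) := by positivity
  obtain ⟨n, rfl | rfl⟩ := Int.eq_nat_or_neg N
  · refine (hnat m hm n x).trans ?_
    push_cast
    gcongr
    exact le_add_of_nonneg_right (by positivity)
  · have h1 := hnat m hm n (x + (-(n : ℤ)) • proj α)
    have h2 : |sinChar (q m) (x j) - sinChar (q m) ((x + (-(n : ℤ)) • proj α) j)| ≤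
        2 * Real.pi * n / q (m + 1) := by
      have h3 := hp.norm_fourier_add_nsmul_sub_le m n ((x + (-(n : ℤ)) • proj α) j)
      have h4 : (x + (-(n : ℤ)) • proj α) j + n • (α j : UnitAddCircle) = x j := by
        simp [proj]
      rw [h4] at h3
      rw [sinChar, sinChar, ← Complex.sub_im]
      exact (Complex.abs_im_le_norm _).trans h3
    have h5 : |amp (q m)| ≤ 2 * Real.pi := by
      rw [abs_amp, div_le_iff₀ (Real.exp_pos _)]
      have := Real.add_one_le_exp (q m : ℝ)
      gcongr
      linarith
    rw [birkhoff_neg]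
    have h6 : -birkhoff (proj α) (ceilingPartial α n₀ j) n (x + (-(n : ℤ)) • proj α) -
        ((-(n : ℤ) : ℤ) : ℝ) * amp (q m) * sinChar (q m) (x j) =
        n * amp (q m) * (sinChar (q m) (x j) - sinChar (q m) ((x + (-(n : ℤ)) • proj α) j)) -
        (birkhoff (proj α) (ceilingPartial α n₀ j) n (x + (-(n : ℤ)) • proj α) -
          n * amp (q m) * sinChar (q m) ((x + (-(n : ℤ)) • proj α) j)) := by
      push_cast
      ring
    rw [h6]
    refine (abs_sub _ _).trans ?_
    have h7 : |n * amp (q m) * (sinChar (q m) (x j) -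
        sinChar (q m) ((x + (-(n : ℤ)) • proj α) j))| ≤
        n * (2 * Real.pi) * (2 * Real.pi * n / q (m + 1)) := by
      rw [abs_mul, abs_mul, Nat.abs_cast]
      gcongr
    have h8 : n * (2 * Real.pi) * (2 * Real.pi * n / q (m + 1)) =
        2 * Real.pi * (2 * Real.pi) * ((n : ℝ) ^ 2 / q (m + 1)) := by ring
    have h9 : 2 * Real.pi * (2 * Real.pi) * ((n : ℝ) ^ 2 / q (m + 1)) ≤
        2 * Real.pi * (2 * Real.pi) * (q m + (n : ℝ) ^ 2 / q (m + 1)) := by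
      gcongr
      exact le_add_of_nonneg_left (by positivity)
    have h10 : ((-(n : ℤ) : ℤ) : ℝ) ^ 2 = (n : ℝ) ^ 2 := by push_cast; ring
    rw [h10]
    linarith

/-! ### Profiles on the base -/

theorem isOpenQuotientMap_proj : IsOpenQuotientMap proj :=
  IsOpenQuotientMap.piMap (f := fun (_ : Fin 4) (y : ℝ) => (y : UnitAddCircle))
    fun _ => QuotientAddGroup.isOpenQuotientMap_mk

/-- The partial derivative of a function on the torus, `0` where it does not exist. -/
def partialDeriv (j : Fin 4) (χ : Torus → ℝ) (x : Torus) : ℝ :=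
  deriv (fun h : ℝ => χ (x + Pi.single j (h : UnitAddCircle))) 0

theorem partialDeriv_eq_zero {j : Fin 4} {χ : Torus → ℝ} {J : Set Torus} (hJ : IsClosed J)
    (h : ∀ x, x ∉ J → χ x = 0) {x : Torus} (hx : x ∉ J) : partialDeriv j χ x = 0 := by
  have hc : Continuous fun h : ℝ => x + Pi.single j (h : UnitAddCircle) := by
    refine continuous_const.add ((continuous_single j).comp (AddCircle.continuous_mk' 1))
  have h0 : ∀ᶠ h : ℝ in 𝓝 0, x + Pi.single j (h : UnitAddCircle) ∈ Jᶜ :=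
    hc.continuousAt.eventually_mem (hJ.isOpen_compl.mem_nhds (by simpa using hx))
  have h1 : (fun h : ℝ => χ (x + Pi.single j (h : UnitAddCircle))) =ᶠ[𝓝 0] fun _ => 0 :=
    h0.mono fun t ht => h _ ht
  rw [partialDeriv, h1.deriv_eq, deriv_const]

namespace IsBaseProfile

variable {a b : Fin 4 → ℝ} {C : ℝ} {χ : Torus → ℝ}

theorem continuous (h : IsBaseProfile a b C χ) : Continuous χ :=
  (isOpenQuotientMap_proj.continuous_comp_iff).1 h.smooth.continuous

theorem hasDerivAt_lift (h : IsBaseProfile a b C χ) (j : Fin 4) (y : Fin 4 → ℝ) :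
    HasDerivAt (fun t : ℝ => χ (proj y + Pi.single j (t : UnitAddCircle)))
      (fderiv ℝ (fun x : Fin 4 → ℝ => χ (proj x)) y (Pi.single j 1)) 0 := by
  have h1 : HasFDerivAt (fun x : Fin 4 → ℝ => χ (proj x))
      (fderiv ℝ (fun x : Fin 4 → ℝ => χ (proj x)) y) (y + (0 : ℝ) • Pi.single j 1) := by
    rw [zero_smul, add_zero]
    exact (h.smooth.differentiable (by simp) y).hasFDerivAt
  have h2 : HasDerivAt (fun t : ℝ => y + t • (Pi.single j 1 : Fin 4 → ℝ)) (Pi.single j 1) 0 := by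
    simpa using ((hasDerivAt_id (0 : ℝ)).smul_const (Pi.single j 1 : Fin 4 → ℝ)).const_add y
  refine (h1.comp_hasDerivAt (0 : ℝ) h2).congr_of_eventuallyEq (Eventually.of_forall fun t => ?_)
  simp only [Function.comp_apply]
  congr 1
  funext i
  rcases eq_or_ne i j with rfl | hij
  · simp [proj]
  · simp [proj, Pi.single_eq_of_ne hij]

theorem hasPartial (h : IsBaseProfile a b C χ) (j : Fin 4) :
    HasPartial j χ (partialDeriv j χ) := fun x => by
  obtain ⟨y, rfl⟩ := isOpenQuotientMap_proj.surjective x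
  exact (h.hasDerivAt_lift j y).differentiableAt.hasDerivAt

theorem abs_partialDeriv_le (h : IsBaseProfile a b C χ) (j : Fin 4) (x : Torus) :
    |partialDeriv j χ x| ≤
      C * (volume.real (multiInterval a b)) ^ (-(1 / 2) : ℝ) * (b j - a j)⁻¹ := by
  obtain ⟨y, rfl⟩ := isOpenQuotientMap_proj.surjective x
  rw [partialDeriv, (h.hasDerivAt_lift j y).deriv]
  exact (le_add_of_nonneg_left (abs_nonneg _)).trans (h.bound_one j (proj y) y)

end IsBaseProfile

theorem rpow_neg_half_mul_self {V : ℝ} (hV : 0 < V) :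
    V ^ (-(1 / 2) : ℝ) * V ^ (-(1 / 2) : ℝ) = V⁻¹ := by
  rw [← Real.rpow_add hV, ← Real.rpow_neg_one]
  norm_num

/-! ### The intervals `J_n` -/

section Interval

variable (α : Fin 4 → ℝ) (n : ℕ) (j : Fin 4)

theorem leftEnd_pos : 0 < leftEnd α n j := by
  have : (1 : ℝ) ≤ convDen (α j) n := by exact_mod_cast one_le_convDen _ _
  unfold leftEnd
  positivity

theorem rightEnd_lt_one : rightEnd α n j < 1 := by
  have : (1 : ℝ) ≤ convDen (α j) n := by exact_mod_cast one_le_convDen _ _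
  unfold rightEnd
  rw [div_lt_one (by positivity)]
  linarith

theorem rightEnd_sub_leftEnd : rightEnd α n j - leftEnd α n j = 1 / (8 * convDen (α j) n) := by
  have : (1 : ℝ) ≤ convDen (α j) n := by exact_mod_cast one_le_convDen _ _
  unfold rightEnd leftEnd
  field_simp
  norm_num

theorem leftEnd_le_rightEnd : leftEnd α n j ≤ rightEnd α n j := by
  have h : (0 : ℝ) ≤ 1 / (8 * convDen (α j) n) := by positivity
  rw [← rightEnd_sub_leftEnd] at h
  linarith

/-- The multi-interval `J_n`. -/
def interval : Set Torus := multiInterval (leftEnd α n) (rightEnd α n)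

theorem isClosed_interval : IsClosed (interval α n) := isClosed_multiInterval _ _

theorem volume_real_interval_pos : 0 < volume.real (interval α n) := by
  rw [interval, volume_real_multiInterval]
  refine Finset.prod_pos fun j _ => ?_
  rw [volume_real_arc (leftEnd_pos α n j) (leftEnd_le_rightEnd α n j) (rightEnd_lt_one α n j),
    rightEnd_sub_leftEnd]
  have : (1 : ℝ) ≤ convDen (α j) n := by exact_mod_cast one_le_convDen _ _
  positivity

end Interval

/-- An orbit of the translation returns to `J_n` only after `q_n^{(4)}` steps. -/
theorem le_abs_of_mem_interval {α : Fin 4 → ℝ} (hα : α ∈ Y) {n : ℕ} (hn : 2 ≤ n) {x : Torus}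
    {N : ℤ} (hx : x ∈ interval α n) (hxN : x + N • proj α ∈ interval α n) (hN : N ≠ 0) :
    (convDen (α 3) n : ℤ) ≤ |N| := by
  by_contra hlt
  obtain ⟨p, hp⟩ := exists_isConvergents (tendsto_convDen hα 3)
  obtain ⟨u, hu, hux⟩ := hx 3
  obtain ⟨v, hv, hvx⟩ := hxN 3
  have h1 : ((u + N * α 3 : ℝ) : UnitAddCircle) = (v : UnitAddCircle) := by
    dsimp only at hux hvx
    rw [hvx, AddCircle.coe_add, hux, ← zsmul_eq_mul, AddCircle.coe_zsmul]
    rfl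
  rw [← sub_eq_zero, ← AddCircle.coe_sub, AddCircle.coe_eq_zero_iff] at h1
  obtain ⟨k, hk⟩ := h1
  rw [zsmul_eq_mul, mul_one] at hk
  have h2 := hp.le_abs_mul_sub (two_mul_convDen_le hα hn 3) hN (not_le.1 hlt) k
  have h3 : |N * α 3 - k| ≤ 1 / (8 * convDen (α 3) n) := by
    rw [← rightEnd_sub_leftEnd, hk, abs_le]
    constructor <;> linarith [hu.1, hu.2, hv.1, hv.2]
  have hq : (1 : ℝ) ≤ convDen (α 3) n := by exact_mod_cast one_le_convDen _ _
  have h4 := h2.trans h3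
  rw [div_le_div_iff₀ (by positivity) (by positivity)] at h4
  linarith

/-! ### Decay of the oscillating integrals -/

/-- The points of `J` that return to `J` after `N` steps, at a time that is `T`-close to `r`. -/
def hitSet (ρ : Torus) (φ : Torus → ℝ) (J : Set Torus) (T r : ℝ) (N : ℤ) : Set Torus :=
  {x | x ∈ J ∧ x + N • ρ ∈ J ∧ |r - birkhoff ρ φ N x| ≤ T}

theorem isClosed_hitSet {ρ : Torus} {φ : Torus → ℝ} (hφ : Continuous φ) {J : Set Torus}
    (hJ : IsClosed J) (T r : ℝ) (N : ℤ) : IsClosed (hitSet ρ φ J T r N) := by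
  refine hJ.inter ((hJ.preimage (continuous_add_const _)).inter ?_)
  exact isClosed_le ((continuous_const.sub (continuous_birkhoff hφ N)).abs) continuous_const

/-- `ψ` is the derivative of `Ψ`, both are supported in `[-T, T]` and bounded by `P`. -/
structure IsTimeCoboundary (T P : ℝ) (ψ Ψ : ℝ → ℝ) : Prop where
  continuous : Continuous ψ
  hasDerivAt : ∀ t, HasDerivAt Ψ (ψ t) t
  abs_le : ∀ t, |ψ t| ≤ P
  abs_le' : ∀ t, |Ψ t| ≤ P
  eq_zero : ∀ t, T < |t| → ψ t = 0
  eq_zero' : ∀ t, T < |t| → Ψ t = 0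

/-- The orbit pieces of length `2 T` through `J` are pairwise disjoint: an orbit meets `J` at most
once during a time interval of that length. -/
def IsSeparated (ρ : Torus) (φ : Torus → ℝ) (J : Set Torus) (T : ℝ) : Prop :=
  ∀ (x : Torus) (r : ℝ) (M N : ℤ), x + M • ρ ∈ J → x + N • ρ ∈ J →
    |r - birkhoff ρ φ M x| ≤ T → |r - birkhoff ρ φ N x| ≤ T → M = N

section Decay

variable {α : Fin 4 → ℝ} {n₀ : ℕ} {c c' : ℝ}

/-- If the coordinate `j` is stretched at time `r = ± y¹²`, integration by parts with the scale
`δ = y⁻⁴` gains the factor `y⁻⁷`. -/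
theorem exists_abs_integral_one_sub_weight_le (hα : α ∈ Y) (hc : 0 < c)
    (hcφ : ∀ x, c ≤ ceiling α n₀ x) (hφc' : ∀ x, ceiling α n₀ x ≤ c') {T C P : ℝ} (hT : 0 < T)
    (hP : 0 < P) (j : Fin 4) :
    ∃ K : ℝ, 0 < K ∧ ∀ n, n₀ ≤ n → ∀ χ₁ χ₂ : Torus → ℝ,
      IsBaseProfile (leftEnd α n) (rightEnd α n) C χ₁ →
      IsBaseProfile (leftEnd α n) (rightEnd α n) C χ₂ →
      ∀ ψ Ψ : ℝ → ℝ, IsTimeCoboundary T P ψ Ψ → ∀ r y : ℝ, 1 ≤ y → |r| = y ^ 12 → 2 * T ≤ |r| →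
      ∀ m, n ≤ m → IsStretched α |r| j m → ∀ v : Torus → ℝ, Continuous v →
      HasPartial j v (fun _ => 0) → (∀ x, |v x| ≤ 1) → ∀ N : ℤ,
      |∫ x, v x * (χ₁ x * χ₂ (x + N • proj α)) *
          ψ (r - birkhoff (proj α) (ceiling α n₀) N x) *
          (1 - weight (y⁻¹ ^ 4) (convDen (α j) m) (x j))| ≤
        ∫ x in hitSet (proj α) (ceiling α n₀) (interval α n) T r N,
          (volume.real (interval α n))⁻¹ *
            (K * (y⁻¹ ^ 7 + y⁻¹ ^ 3 * weight (y⁻¹ ^ 4) (convDen (α j) m) (x j))) := by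
  obtain ⟨A, hA, hder⟩ := exists_abs_birkhoff_ceilingPartial_sub_le hα n₀ j
  obtain ⟨p, hp⟩ := exists_isConvergents (tendsto_convDen hα j)
  have hpi := Real.pi_pos
  have hc' : 0 < c' := hc.trans_le ((hcφ 0).trans (hφc' 0))
  set A' := A * (1 + 4 / c ^ 2)
  set K₁ := P * c' * (C ^ 2 + 1) * ((A' + 16) / 2)
  set K₂ := P * c' * (C ^ 2 + 1) * (2 * Real.pi)
  have hA' : 0 < A' := by positivity
  have hK₁ : 0 < K₁ := by positivity
  have hK₂ : 0 < K₂ := by positivity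
  refine ⟨K₁ + K₂, by positivity,
    fun n hn χ₁ χ₂ h₁ h₂ ψ Ψ hψ r y hy hry hTr m hm hst v hv hv' hv1 N => ?_⟩
  set q := convDen (α j)
  set J := interval α n
  set V := volume.real J
  set φ := ceiling α n₀
  set S := birkhoff (proj α) φ N
  set E := hitSet (proj α) φ J T r N
  have hφ : Continuous φ := continuous_ceiling hα n₀
  have hV : 0 < V := volume_real_interval_pos α n
  have hJ : IsClosed J := isClosed_interval α n
  have hE : MeasurableSet E := (isClosed_hitSet hφ hJ T r N).measurableSet
  have hy0 : 0 < y := by linarith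
  have hqm : (1 : ℝ) ≤ q m := by exact_mod_cast hp.pos m
  have hqm1 : (0 : ℝ) < q (m + 1) := by exact_mod_cast hp.pos (m + 1)
  have hqn : (q n : ℝ) ≤ q m := by exact_mod_cast hp.mono hm
  set a : Torus → ℝ := fun x => χ₁ x * χ₂ (x + N • proj α)
  set a' : Torus → ℝ := fun x => partialDeriv j χ₁ x * χ₂ (x + N • proj α) +
    χ₁ x * partialDeriv j χ₂ (x + N • proj α)
  have hac : Continuous a := h₁.continuous.mul (h₂.continuous.comp (continuous_add_const _))
  have ha' : HasPartial j a a' := (h₁.hasPartial j).mul ((h₂.hasPartial j).comp_add _)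
  -- outside of the hitting set the integrand and its primitive vanish
  have hout : ∀ x, x ∉ E → (a x = 0 ∧ a' x = 0) ∨ (ψ (r - S x) = 0 ∧ Ψ (r - S x) = 0) := by
    intro x hx
    by_cases hxJ : x ∈ J
    · by_cases hxN : x + N • proj α ∈ J
      · right
        have : T < |r - S x| := by
          by_contra hle
          exact hx ⟨hxJ, hxN, not_lt.1 hle⟩
        exact ⟨hψ.eq_zero _ this, hψ.eq_zero' _ this⟩
      · left
        have h3 := h₂.support _ hxN
        have h4 := partialDeriv_eq_zero (j := j) hJ h₂.support hxN
        simp [a, a', h3, h4]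
    · left
      have h3 := h₁.support _ hxJ
      have h4 := partialDeriv_eq_zero (j := j) hJ h₁.support hxJ
      simp [a, a', h3, h4]
  rcases E.eq_empty_or_nonempty with hempty | ⟨x₀, hx₀⟩
  · have h0 : ∀ x, v x * a x * ψ (r - S x) * (1 - weight (y⁻¹ ^ 4) (q m) (x j)) = 0 := fun x => by
      rcases hout x (by rw [hempty]; exact notMem_empty x) with h | h <;> simp [h.1]
    change |∫ x, v x * a x * ψ (r - S x) * (1 - weight (y⁻¹ ^ 4) (q m) (x j))| ≤ _
    simp_rw [h0]
    simp [hempty]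
  -- `N` is comparable with `r`
  have hS1 : |r| ≤ 2 * |S x₀| := by
    have h1 := abs_sub_abs_le_abs_sub r (S x₀)
    have h2 : |r - S x₀| ≤ T := hx₀.2.2
    linarith
  have hS2 : |S x₀| ≤ 2 * |r| := by
    have h1 := abs_sub_abs_le_abs_sub (S x₀) r
    rw [abs_sub_comm] at h1
    have h2 : |r - S x₀| ≤ T := hx₀.2.2
    linarith
  have hN1 : |r| ≤ 2 * c' * |(N : ℝ)| := by
    have h1 : |S x₀| ≤ c' * (|N| : ℤ) := abs_birkhoff_le hc.le hcφ hφc' N x₀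
    push_cast at h1
    linarith
  have hN2 : c * |(N : ℝ)| ≤ 2 * |r| := by
    have h1 : c * (|N| : ℤ) ≤ |S x₀| := mul_abs_le_abs_birkhoff hcφ N x₀
    push_cast at h1
    linarith
  have hr : 0 < |r| := by rw [hry]; positivity
  have hNpos : 0 < |(N : ℝ)| := by
    by_contra h
    nlinarith [mul_nonneg hc'.le (abs_nonneg (N : ℝ))]
  set κ : ℝ := N * amp (q m)
  set η : ℝ := A' * q m
  have hη : ∀ x, |κ * sinChar (q m) (x j) -
      birkhoff (proj α) (ceilingPartial α n₀ j) N x| ≤ η := fun x => by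
    rw [abs_sub_comm]
    refine (hder m (hn.trans hm) N x).trans ?_
    have h1 : (N : ℝ) ^ 2 / q (m + 1) ≤ 4 / c ^ 2 := by
      rw [div_le_div_iff₀ hqm1 (by positivity)]
      have h2 : (c * |(N : ℝ)|) ^ 2 ≤ (2 * |r|) ^ 2 := by gcongr
      rw [mul_pow, sq_abs] at h2
      have h3 := hst.2
      nlinarith
    have h2 : (4 : ℝ) / c ^ 2 ≤ 4 / c ^ 2 * q m := le_mul_of_one_le_right (by positivity) hqm
    calc A * (q m + (N : ℝ) ^ 2 / q (m + 1)) ≤ A * (q m + 4 / c ^ 2 * q m) := by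
          gcongr
          exact h1.trans h2
      _ = η := by simp only [η, A']; ring
  have hexp : Real.exp (q m) ≤ y := by
    have h1 : Real.exp (q m) ^ 12 ≤ y ^ 12 := by
      rw [← Real.exp_nat_mul, ← hry]
      exact_mod_cast hst.1
    exact le_of_pow_le_pow_left₀ (by norm_num) hy0.le h1
  have hκ : q m * y ^ 11 ≤ c' * |κ| := by
    have h1 : |κ| = |(N : ℝ)| * (2 * Real.pi * q m / Real.exp (q m)) := by
      rw [abs_mul, abs_amp]
    have h2 : y ^ 12 ≤ 2 * c' * |(N : ℝ)| := by rw [← hry]; exact hN1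
    have h3 : 1 / y ≤ 1 / Real.exp (q m) := one_div_le_one_div_of_le (Real.exp_pos _) hexp
    calc q m * y ^ 11 = 1 * q m * (y ^ 12 * (1 / y)) := by field_simp
      _ ≤ Real.pi * q m * (2 * c' * |(N : ℝ)| * (1 / Real.exp (q m))) := by
        gcongr
        linarith [Real.pi_gt_three]
      _ = c' * |κ| := by rw [h1]; ring
  have hκ0 : 0 < |κ| := by
    by_contra h
    have : 0 < q m * y ^ 11 := by positivity
    nlinarith [mul_nonneg hc'.le (abs_nonneg κ)]
  have hκinv : P / |κ| ≤ P * c' * y⁻¹ ^ 11 / q m := by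
    rw [div_le_div_iff₀ hκ0 (by linarith)]
    have h1 : (q m : ℝ) ≤ y⁻¹ ^ 11 * (c' * |κ|) := by
      calc (q m : ℝ) = y⁻¹ ^ 11 * (q m * y ^ 11) := by field_simp
        _ ≤ _ := by gcongr
    nlinarith
  -- the amplitude and its derivative
  set W := V ^ (-(1 / 2) : ℝ)
  have hW : W * W = V⁻¹ := rpow_neg_half_mul_self hV
  have hCW : 0 ≤ C * W := (abs_nonneg _).trans (h₁.bound_zero 0)
  have hinv : (rightEnd α n j - leftEnd α n j)⁻¹ ≤ 8 * q m := by
    rw [rightEnd_sub_leftEnd, one_div, inv_inv]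
    gcongr
  have hA₀ : ∀ x, |a x| ≤ (C ^ 2 + 1) * V⁻¹ := fun x => by
    rw [abs_mul]
    calc _ ≤ (C * W) * (C * W) := by
          gcongr
          exacts [h₁.bound_zero x, h₂.bound_zero _]
      _ = C ^ 2 * V⁻¹ := by rw [← hW]; ring
      _ ≤ _ := by gcongr; linarith
  have hpd : ∀ χ, IsBaseProfile (leftEnd α n) (rightEnd α n) C χ → ∀ x,
      |partialDeriv j χ x| ≤ C * W * (8 * q m) := fun χ h x =>
    (h.abs_partialDeriv_le j x).trans (mul_le_mul_of_nonneg_left hinv hCW)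
  have hA₁ : ∀ x, |a' x| ≤ 16 * (C ^ 2 + 1) * V⁻¹ * q m := fun x => by
    refine (abs_add_le _ _).trans ?_
    rw [abs_mul, abs_mul]
    calc _ ≤ (C * W * (8 * q m)) * (C * W) + (C * W) * (C * W * (8 * q m)) := by
          gcongr
          exacts [hpd _ h₁ x, h₂.bound_zero _, h₁.bound_zero x, hpd _ h₂ _]
      _ = 16 * C ^ 2 * V⁻¹ * q m := by rw [← hW]; ring
      _ ≤ _ := by gcongr; linarith
  have hδ : 0 < y⁻¹ ^ 4 := by positivity
  have hmain := abs_integral_mul_one_sub_weight_le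
    (S' := birkhoff (proj α) (ceilingPartial α n₀ j) N)
    hac ha' (continuous_birkhoff hφ N) ((hasPartial_ceiling hα n₀ j).birkhoff N) hv hv'
    hψ.continuous hψ.hasDerivAt hδ (abs_pos.1 hκ0) hA₀ hA₁ hψ.abs_le hψ.abs_le' hv1 hη hE r hout
  refine hmain.trans ?_
  have hwc : Continuous fun x : Torus => weight (y⁻¹ ^ 4) (q m) (x j) :=
    (continuous_weight hδ _).comp (continuous_apply j)
  refine setIntegral_mono ?_ ?_ fun x => ?_
  · exact (Continuous.integrable_of_hasCompactSupport (by fun_prop)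
      (HasCompactSupport.of_compactSpace _)).integrableOn
  · exact (Continuous.integrable_of_hasCompactSupport (by fun_prop)
      (HasCompactSupport.of_compactSpace _)).integrableOn
  · have hw := weight_nonneg (y⁻¹ ^ 4) (q m) (x j)
    set w := weight (y⁻¹ ^ 4) (q m) (x j)
    have hV' : 0 < V⁻¹ := inv_pos.2 hV
    have hz : 0 < y⁻¹ := inv_pos.2 hy0
    set z := y⁻¹
    calc _ ≤ P * c' * z ^ 11 / q m * (((C ^ 2 + 1) * V⁻¹ * η + 16 * (C ^ 2 + 1) * V⁻¹ * q m) /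
            (2 * z ^ 4) + 2 * Real.pi * q m * ((C ^ 2 + 1) * V⁻¹) / (z ^ 4) ^ 2 * w) := by
          gcongr
      _ = V⁻¹ * (K₁ * z ^ 7 + K₂ * (z ^ 3 * w)) := by
          simp only [K₁, K₂, η]
          have hq0 : (q m : ℝ) ≠ 0 := by linarith
          field_simp
      _ ≤ V⁻¹ * ((K₁ + K₂) * z ^ 7 + (K₁ + K₂) * (z ^ 3 * w)) := by
          gcongr <;> linarith
      _ = _ := by ring

/-- Two visits to `J_n` are separated by a long time. -/
theorem isSeparated_interval (hα : α ∈ Y) (hcφ : ∀ x, c ≤ ceiling α n₀ x) (hc : 0 < c) {T : ℝ}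
    {n : ℕ} (hn : 2 ≤ n) (hT : 2 * T < c * convDen (α 3) n) :
    IsSeparated (proj α) (ceiling α n₀) (interval α n) T := by
  intro x r M N hM hN hM' hN'
  by_contra hMN
  have h1 : x + M • proj α + (N - M) • proj α ∈ interval α n := by
    rwa [add_assoc, ← add_smul, add_sub_cancel]
  have h2 := le_abs_of_mem_interval hα hn hM h1 (sub_ne_zero.2 (Ne.symm hMN))
  have h3 := mul_abs_sub_le_abs_birkhoff_sub (ρ := proj α) hcφ M N x
  have h4 : (convDen (α 3) n : ℝ) ≤ (|M - N| : ℤ) := by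
    rw [abs_sub_comm]; exact_mod_cast h2
  have h5 := abs_sub (r - birkhoff (proj α) (ceiling α n₀) N x)
    (r - birkhoff (proj α) (ceiling α n₀) M x)
  rw [sub_sub_sub_cancel_left] at h5
  nlinarith

theorem IsSeparated.disjoint_hitSet {ρ : Torus} {φ : Torus → ℝ} {J : Set Torus} {T : ℝ}
    (h : IsSeparated ρ φ J T) (r : ℝ) {M N : ℤ} (hMN : M ≠ N) :
    Disjoint (hitSet ρ φ J T r M) (hitSet ρ φ J T r N) :=
  Set.disjoint_left.2 fun x hM hN => hMN (h x r M N hM.2.1 hN.2.1 hM.2.2 hN.2.2)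

/-- The oscillating integrals of the correlations decay like `|r| ^ (-7/12)`, uniformly in `n`. -/
theorem exists_abs_sum_integral_le (hα : α ∈ Y) (hc : 0 < c)
    (hcφ : ∀ x, c ≤ ceiling α n₀ x) (hφc' : ∀ x, ceiling α n₀ x ≤ c') {T C P : ℝ} (hT : 0 < T)
    (hP : 0 < P) :
    ∃ K : ℝ, 0 < K ∧ ∀ n, n₀ ≤ n → 24 ≤ n → 2 * T < c * convDen (α 3) n →
      ∀ χ₁ χ₂ : Torus → ℝ,
      IsBaseProfile (leftEnd α n) (rightEnd α n) C χ₁ →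
      IsBaseProfile (leftEnd α n) (rightEnd α n) C χ₂ →
      ∀ ψ Ψ : ℝ → ℝ, IsTimeCoboundary T P ψ Ψ → ∀ r : ℝ,
      Real.exp (12 * convDen (α 2) n) ≤ |r| → 2 * T ≤ |r| → ∀ s : Finset ℤ,
      |∑ N ∈ s, ∫ x, χ₁ x * χ₂ (x + N • proj α) *
          ψ (r - birkhoff (proj α) (ceiling α n₀) N x)| ≤ K * |r| ^ (-(7 / 12) : ℝ) := by
  choose K hK hdecay using exists_abs_integral_one_sub_weight_le (C := C) hα hc hcφ hφc' hT hP
  set L := ∑ j, K j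
  have hKL : ∀ j, K j ≤ L := fun j =>
    Finset.single_le_sum (fun i _ => (hK i).le) (Finset.mem_univ j)
  have hL : 0 < L := (hK 0).trans_le (hKL 0)
  set K₀ := P * (C ^ 2 + 1)
  have hK₀ : 0 < K₀ := by positivity
  refine ⟨100 * K₀ + 22 * L, by positivity, fun n hn hn24 hTn χ₁ χ₂ h₁ h₂ ψ Ψ hψ r hr hTr s => ?_⟩
  obtain ⟨j, j', m, m', hjj, hm, hm', hst, hst'⟩ := exists_two_isStretched hα hn24 hr
  set J := interval α n
  set V := volume.real J
  set φ := ceiling α n₀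
  set E := hitSet (proj α) φ J T r
  have hφ : Continuous φ := continuous_ceiling hα n₀
  have hV : 0 < V := volume_real_interval_pos α n
  have hJ : IsClosed J := isClosed_interval α n
  have hE : ∀ N, MeasurableSet (E N) := fun N => (isClosed_hitSet hφ hJ T r N).measurableSet
  have hr1 : 1 ≤ |r| := (Real.one_le_exp (by positivity)).trans hr
  have hr0 : 0 < |r| := by linarith
  set y := |r| ^ (1 / 12 : ℝ)
  have hy1 : 1 ≤ y := Real.one_le_rpow hr1 (by norm_num)
  have hy12 : |r| = y ^ 12 := by
    rw [← Real.rpow_natCast, ← Real.rpow_mul hr0.le]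
    norm_num
  have hy7 : y⁻¹ ^ 7 = |r| ^ (-(7 / 12) : ℝ) := by
    rw [inv_pow, ← Real.rpow_natCast, ← Real.rpow_mul hr0.le, ← Real.rpow_neg hr0.le]
    norm_num
  have hz : 0 < y⁻¹ := inv_pos.2 (by linarith)
  have hz1 : y⁻¹ ≤ 1 := inv_le_one_of_one_le₀ hy1
  set z := y⁻¹
  set q := convDen (α j) m
  set q' := convDen (α j') m'
  have hδ : 0 < z ^ 4 := by positivity
  set w : Torus → ℝ := fun x => weight (z ^ 4) q (x j)
  set w' : Torus → ℝ := fun x => weight (z ^ 4) q' (x j')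
  have hwc : Continuous w := (continuous_weight hδ _).comp (continuous_apply j)
  have hwc' : Continuous w' := (continuous_weight hδ _).comp (continuous_apply j')
  have hw0 : ∀ x, 0 ≤ w x := fun x => weight_nonneg _ _ _
  have hw0' : ∀ x, 0 ≤ w' x := fun x => weight_nonneg _ _ _
  have hw1 : ∀ x, |w x| ≤ 1 := fun x => by
    rw [abs_of_nonneg (hw0 x)]; exact weight_le_one hδ _ _
  set G : Torus → ℝ := fun x => V⁻¹ * (K₀ * (w x * w' x) + L * (z ^ 7 + z ^ 3 * w x) +
    L * (z ^ 7 + z ^ 3 * w' x))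
  have hGc : Continuous G := by fun_prop
  have hint : ∀ F : Torus → ℝ, Continuous F → Integrable F volume := fun F hF =>
    hF.integrable_of_hasCompactSupport (HasCompactSupport.of_compactSpace _)
  have hG0 : ∀ x, 0 ≤ G x := fun x => by
    have := hw0 x
    have := hw0' x
    have := inv_pos.2 hV
    positivity
  set W := V ^ (-(1 / 2) : ℝ)
  have hW : W * W = V⁻¹ := rpow_neg_half_mul_self hV
  have hCW : 0 ≤ C * W := (abs_nonneg _).trans (h₁.bound_zero 0)
  -- the bound for one return: at the points where both weights are large there is no cancellation,
  -- elsewhere one of the two directions allows an integration by parts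
  have hone : ∀ N, |∫ x, χ₁ x * χ₂ (x + N • proj α) * ψ (r - birkhoff (proj α) φ N x)| ≤
      ∫ x in E N, G x := fun N => by
    set a : Torus → ℝ := fun x => χ₁ x * χ₂ (x + N • proj α)
    have hac : Continuous a := h₁.continuous.mul (h₂.continuous.comp (continuous_add_const _))
    have hSc := continuous_birkhoff (ρ := proj α) hφ N
    have hψc := hψ.continuous
    have hA₀ : ∀ x, |a x| ≤ (C ^ 2 + 1) * V⁻¹ := fun x => by
      rw [abs_mul]
      calc _ ≤ (C * W) * (C * W) := by
            gcongr
            exacts [h₁.bound_zero x, h₂.bound_zero _]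
        _ = C ^ 2 * V⁻¹ := by rw [← hW]; ring
        _ ≤ _ := by
          have := inv_pos.2 hV
          gcongr
          linarith
    have hsplit : ∫ x, a x * ψ (r - birkhoff (proj α) φ N x) =
        (∫ x, a x * ψ (r - birkhoff (proj α) φ N x) * (w x * w' x)) +
        (∫ x, 1 * a x * ψ (r - birkhoff (proj α) φ N x) * (1 - w x)) +
        ∫ x, w x * a x * ψ (r - birkhoff (proj α) φ N x) * (1 - w' x) := by
      rw [← integral_add, ← integral_add]
      · refine integral_congr_ae (Eventually.of_forall fun x => ?_)
        dsimp only
        ring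
      · exact hint _ (by fun_prop)
      · exact hint _ (by fun_prop)
      · exact hint _ (by fun_prop)
      · exact hint _ (by fun_prop)
    have hb1 : |∫ x, a x * ψ (r - birkhoff (proj α) φ N x) * (w x * w' x)| ≤
        ∫ x in E N, V⁻¹ * (K₀ * (w x * w' x)) := by
      rw [← integral_indicator (hE N)]
      refine abs_integral_le_integral_abs.trans ?_
      refine integral_mono (hint _ (by fun_prop)).abs
        ((hint _ (by fun_prop)).indicator (hE N)) fun x => ?_
      by_cases hx : x ∈ E N
      · rw [indicator_of_mem hx, abs_mul, abs_mul, abs_of_nonneg (mul_nonneg (hw0 x) (hw0' x))]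
        have := mul_nonneg (hw0 x) (hw0' x)
        have := inv_pos.2 hV
        calc _ ≤ (C ^ 2 + 1) * V⁻¹ * P * (w x * w' x) := by
              gcongr
              exacts [hA₀ x, hψ.abs_le _]
          _ = _ := by simp only [K₀]; ring
      · rw [indicator_of_notMem hx]
        have h0 : a x * ψ (r - birkhoff (proj α) φ N x) = 0 := by
          by_cases hxJ : x ∈ J
          · by_cases hxN : x + N • proj α ∈ J
            · have : T < |r - birkhoff (proj α) φ N x| := by
                by_contra hle
                exact hx ⟨hxJ, hxN, not_lt.1 hle⟩
              rw [hψ.eq_zero _ this, mul_zero]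
            · simp [a, h₂.support _ hxN]
          · simp [a, h₁.support _ hxJ]
        simp [h0]
    have hb2 : |∫ x, 1 * a x * ψ (r - birkhoff (proj α) φ N x) * (1 - w x)| ≤
        ∫ x in E N, V⁻¹ * (K j * (z ^ 7 + z ^ 3 * w x)) :=
      hdecay j n hn χ₁ χ₂ h₁ h₂ ψ Ψ hψ r y hy1 hy12 hTr m hm hst (fun _ => 1)
        continuous_const (fun x => hasDerivAt_const _ _) (by simp) N
    have hb3 : |∫ x, w x * a x * ψ (r - birkhoff (proj α) φ N x) * (1 - w' x)| ≤
        ∫ x in E N, V⁻¹ * (K j' * (z ^ 7 + z ^ 3 * w' x)) :=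
      hdecay j' n hn χ₁ χ₂ h₁ h₂ ψ Ψ hψ r y hy1 hy12 hTr m' hm' hst' w hwc
        (HasPartial.comp_apply_ne _ hjj) hw1 N
    change |∫ x, a x * ψ (r - birkhoff (proj α) φ N x)| ≤ _
    rw [hsplit]
    refine (abs_add_three _ _ _).trans ((add_le_add (add_le_add hb1 hb2) hb3).trans ?_)
    rw [← integral_add, ← integral_add]
    · refine setIntegral_mono (hint _ (by fun_prop)).integrableOn (hint _ hGc).integrableOn
        fun x => ?_
      have h3 := hKL j
      have h4 := hKL j'
      have := hw0 x
      have := hw0' x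
      have := inv_pos.2 hV
      simp only [G]
      rw [← mul_add, ← mul_add]
      have e1 : 0 ≤ z ^ 7 + z ^ 3 * w x := by positivity
      have e2 : 0 ≤ z ^ 7 + z ^ 3 * w' x := by positivity
      gcongr
    · exact (hint _ (by fun_prop)).integrableOn
    · exact (hint _ (by fun_prop)).integrableOn
    · exact (hint _ (by fun_prop)).integrableOn
    · exact (hint _ (by fun_prop)).integrableOn
  -- the sum over all returns
  have hsum : |∑ N ∈ s, ∫ x, χ₁ x * χ₂ (x + N • proj α) * ψ (r - birkhoff (proj α) φ N x)| ≤
      ∫ x in J, G x := by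
    refine (Finset.abs_sum_le_sum_abs _ _).trans ((Finset.sum_le_sum fun N _ => hone N).trans ?_)
    rw [← integral_biUnion_finset s (fun N _ => hE N)
      (fun M _ N _ hMN =>
        (isSeparated_interval hα hcφ hc (by omega) hTn).disjoint_hitSet r hMN)
      fun N _ => (hint _ hGc).integrableOn]
    refine setIntegral_mono_set (hint _ hGc).integrableOn (Eventually.of_forall hG0) ?_
    refine (iUnion₂_subset fun N _ x hx => ?_).eventuallyLE
    exact hx.1
  refine hsum.trans ?_
  have hqn : ∀ i k, n ≤ k → 1 ≤ 8 * ((convDen (α i) k : ℝ) * (rightEnd α n i - leftEnd α n i)) := by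
    intro i k hk
    obtain ⟨p, hp⟩ := exists_isConvergents (tendsto_convDen hα i)
    have h3 : (convDen (α i) n : ℝ) ≤ convDen (α i) k := by exact_mod_cast hp.mono hk
    have h4 : (1 : ℝ) ≤ convDen (α i) n := by exact_mod_cast hp.pos n
    rw [rightEnd_sub_leftEnd, ← mul_assoc, mul_one_div, le_div_iff₀ (by positivity)]
    linarith
  have hqpos : ∀ i k, 0 < convDen (α i) k := fun i k => one_le_convDen _ _
  have e1 : ∫ x in J, w x ≤ 10 * z ^ 4 * V :=
    setIntegral_weight_le hδ (hqpos _ _) (leftEnd_pos α n j) (rightEnd_lt_one α n j) (hqn j m hm)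
  have e2 : ∫ x in J, w' x ≤ 10 * z ^ 4 * V :=
    setIntegral_weight_le hδ (hqpos _ _) (leftEnd_pos α n j') (rightEnd_lt_one α n j')
      (hqn j' m' hm')
  have e3 : ∫ x in J, w x * w' x ≤ 100 * (z ^ 4) ^ 2 * V :=
    setIntegral_weight_mul_weight_le hδ (hqpos _ _) (hqpos _ _) hjj
      (leftEnd_pos α n j) (rightEnd_lt_one α n j) (hqn j m hm) (leftEnd_pos α n j')
      (rightEnd_lt_one α n j') (hqn j' m' hm')
  have hG : ∫ x in J, G x = V⁻¹ * (K₀ * (∫ x in J, w x * w' x) +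
      L * (z ^ 7 * V + z ^ 3 * ∫ x in J, w x) + L * (z ^ 7 * V + z ^ 3 * ∫ x in J, w' x)) := by
    have i1 : IntegrableOn w J := (hint _ hwc).integrableOn
    have i2 : IntegrableOn w' J := (hint _ hwc').integrableOn
    have i3 : IntegrableOn (fun x => w x * w' x) J := (hint _ (hwc.mul hwc')).integrableOn
    have i0 : IntegrableOn (fun _ : Torus => z ^ 7) J := (hint _ continuous_const).integrableOn
    have hconst : ∫ _ in J, z ^ 7 = z ^ 7 * V := by
      rw [setIntegral_const, smul_eq_mul, mul_comm]
    simp only [G]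
    rw [integral_const_mul, integral_add, integral_add, integral_const_mul, integral_const_mul,
      integral_const_mul, integral_add i0 (i1.const_mul _), integral_add i0 (i2.const_mul _),
      integral_const_mul, integral_const_mul, hconst]
    · exact i3.const_mul _
    · exact (i0.add (i1.const_mul _)).const_mul _
    · exact (i3.const_mul _).add ((i0.add (i1.const_mul _)).const_mul _)
    · exact (i0.add (i2.const_mul _)).const_mul _
  rw [hG, ← hy7]
  have hV' : 0 < V⁻¹ := inv_pos.2 hV
  calc _ ≤ V⁻¹ * (K₀ * (100 * (z ^ 4) ^ 2 * V) + L * (z ^ 7 * V + z ^ 3 * (10 * z ^ 4 * V)) +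
        L * (z ^ 7 * V + z ^ 3 * (10 * z ^ 4 * V))) := by gcongr
    _ = 100 * K₀ * (z ^ 7 * z) + 22 * L * z ^ 7 := by
      field_simp
      ring
    _ ≤ 100 * K₀ * (z ^ 7 * 1) + 22 * L * z ^ 7 := by gcongr
    _ = _ := by ring

end Decay

/-! ### The special flow -/

section Flow

variable {ρ : Torus} {φ : Torus → ℝ} {c c' : ℝ}

theorem birkhoff_add_le (hc : 0 < c) (hcφ : ∀ x, c ≤ φ x) {M N : ℤ} (h : M < N) (x : Torus) :
    birkhoff ρ φ M x + φ (x + M • ρ) ≤ birkhoff ρ φ N x := by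
  have h1 := le_birkhoff_sub (ρ := ρ) hcφ (Int.add_one_le_of_lt h) x
  have h2 : (0 : ℝ) ≤ c * (N - (M + 1) : ℤ) :=
    mul_nonneg hc.le (by exact_mod_cast sub_nonneg.2 (Int.add_one_le_of_lt h))
  rw [birkhoff_add_one] at h1
  linarith

theorem exists_hits (hc : 0 < c) (hcφ : ∀ x, c ≤ φ x) (x : Torus) (r : ℝ) :
    ∃ N : ℤ, 0 ≤ r - birkhoff ρ φ N x ∧ r - birkhoff ρ φ N x < φ (x + N • ρ) := by
  have hnn := fun N : ℤ => le_birkhoff_sub (ρ := ρ) hcφ (M := 0) (N := N)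
  have hnp := fun N : ℤ => le_birkhoff_sub (ρ := ρ) hcφ (M := N) (N := 0)
  simp only [birkhoff_zero, sub_zero, zero_sub] at hnn hnp
  obtain ⟨B, hB⟩ := exists_nat_gt (|r| / c)
  rw [div_lt_iff₀ hc] at hB
  have hr := abs_le.1 (le_refl |r|)
  obtain ⟨N, hN, hmax⟩ := Int.exists_greatest_of_bdd (P := fun N : ℤ => birkhoff ρ φ N x ≤ r)
    ⟨B, fun N hN => by
      by_contra hlt
      have h1 := hnn N (by omega) x
      have h2 : (B : ℝ) ≤ N := by exact_mod_cast (not_le.1 hlt).le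
      nlinarith⟩
    ⟨-B, by
      have h1 := hnp (-B) (by omega) x
      push_cast at h1
      linarith⟩
  refine ⟨N, by linarith, ?_⟩
  by_contra h
  have h1 := birkhoff_add_one ρ φ N x
  have := hmax (N + 1) (by linarith)
  omega

theorem hits_unique (hc : 0 < c) (hcφ : ∀ x, c ≤ φ x) {x : Torus} {r : ℝ} {M N : ℤ}
    (hM : 0 ≤ r - birkhoff ρ φ M x) (hM' : r - birkhoff ρ φ M x < φ (x + M • ρ))
    (hN : 0 ≤ r - birkhoff ρ φ N x) (hN' : r - birkhoff ρ φ N x < φ (x + N • ρ)) : M = N := by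
  rcases lt_trichotomy M N with h | h | h
  · have := birkhoff_add_le (ρ := ρ) hc hcφ h x
    linarith
  · exact h
  · have := birkhoff_add_le (ρ := ρ) hc hcφ h x
    linarith

theorem flow_eq_flow_zero (t : ℝ) (x : Torus) (s : ℝ) :
    flow ρ φ t (x, s) = flow ρ φ (t + s) (x, 0) := by
  simp [flow, hits]

theorem flow_eq (hc : 0 < c) (hcφ : ∀ x, c ≤ φ x) {x : Torus} {r : ℝ} {N : ℤ}
    (hN : 0 ≤ r - birkhoff ρ φ N x) (hN' : r - birkhoff ρ φ N x < φ (x + N • ρ)) :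
    flow ρ φ r (x, 0) = (x + N • ρ, r - birkhoff ρ φ N x) := by
  have hh : hits ρ φ r (x, 0) = N := by
    have h := Classical.epsilon_spec (p := fun N : ℤ =>
      0 ≤ r + (x, (0 : ℝ)).2 - birkhoff ρ φ N (x, (0 : ℝ)).1 ∧
      r + (x, (0 : ℝ)).2 - birkhoff ρ φ N (x, (0 : ℝ)).1 < φ ((x, (0 : ℝ)).1 + N • ρ))
      ⟨N, by simpa using hN, by simpa using hN'⟩
    simp only [add_zero] at h
    refine hits_unique hc hcφ ?_ ?_ hN hN' <;> simp only [hits, add_zero]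
    exacts [h.1, h.2]
  simp [flow, hh]

theorem exists_flow_eq (hc : 0 < c) (hcφ : ∀ x, c ≤ φ x) (x : Torus) (r : ℝ) :
    ∃ N : ℤ, flow ρ φ r (x, 0) = (x + N • ρ, r - birkhoff ρ φ N x) ∧
      0 ≤ r - birkhoff ρ φ N x ∧ r - birkhoff ρ φ N x < φ (x + N • ρ) := by
  obtain ⟨N, hN, hN'⟩ := exists_hits (ρ := ρ) hc hcφ x r
  exact ⟨N, flow_eq hc hcφ hN hN', hN, hN'⟩

theorem flow_mem_phase (hc : 0 < c) (hcφ : ∀ x, c ≤ φ x) (x : Torus) (r : ℝ) :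
    flow ρ φ r (x, 0) ∈ phase φ := by
  obtain ⟨N, h, hN, hN'⟩ := exists_flow_eq (ρ := ρ) hc hcφ x r
  rw [h]
  exact ⟨hN, hN'⟩

theorem flow_of_mem_phase (hc : 0 < c) (hcφ : ∀ x, c ≤ φ x) {x : Torus} {s : ℝ}
    (h : (x, s) ∈ phase φ) : flow ρ φ s (x, 0) = (x, s) := by
  have := flow_eq (ρ := ρ) (N := 0) hc hcφ (x := x) (r := s)
    (by simpa [birkhoff_zero] using h.1) (by simpa [birkhoff_zero] using h.2)
  simpa [birkhoff_zero] using this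

/-- The flow is defined on the quotient by `(x, s) ∼ (x + ρ, s - φ x)`. -/
theorem flow_add_zsmul (hc : 0 < c) (hcφ : ∀ x, c ≤ φ x) (x : Torus) (r : ℝ) (M : ℤ) :
    flow ρ φ (r - birkhoff ρ φ M x) (x + M • ρ, 0) = flow ρ φ r (x, 0) := by
  obtain ⟨N, h, hN, hN'⟩ := exists_flow_eq (ρ := ρ) hc hcφ x r
  have h1 := birkhoff_add ρ φ M (N - M) x
  rw [add_sub_cancel] at h1
  have h2 : x + M • ρ + (N - M) • ρ = x + N • ρ := by
    rw [add_assoc, ← add_smul, add_sub_cancel]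
  have h3 : r - birkhoff ρ φ M x - birkhoff ρ φ (N - M) (x + M • ρ) = r - birkhoff ρ φ N x := by
    rw [h1]; ring
  rw [h, flow_eq hc hcφ (N := N - M) (by rw [h3]; exact hN) (by rw [h3, h2]; exact hN'), h2, h3]

theorem exists_of_flow_eq_flow (hc : 0 < c) (hcφ : ∀ x, c ≤ φ x) {x y : Torus} {r r' : ℝ}
    (h : flow ρ φ r (x, 0) = flow ρ φ r' (y, 0)) :
    ∃ M : ℤ, y = x + M • ρ ∧ r' = r - birkhoff ρ φ M x := by
  obtain ⟨N, hN, -⟩ := exists_flow_eq (ρ := ρ) hc hcφ x r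
  obtain ⟨N', hN', -⟩ := exists_flow_eq (ρ := ρ) hc hcφ y r'
  rw [hN, hN', Prod.mk.injEq] at h
  have hy : y = x + (N - N') • ρ := by
    rw [sub_smul, ← add_sub_assoc, h.1, add_sub_cancel_right]
  refine ⟨N - N', hy, ?_⟩
  have h1 := birkhoff_add ρ φ (N - N') N' x
  rw [sub_add_cancel, ← hy] at h1
  linarith [h.2]

/-! ### Functions on a flow-box -/

/-- A function on the flow-box is, along each orbit, the sum of its contributions from the visits
of the orbit to `J`. -/
theorem IsBoxFunction.apply_flow_eq_sum (hc : 0 < c) (hcφ : ∀ x, c ≤ φ x) {a b : Fin 4 → ℝ}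
    {T : ℝ} {h : Torus × ℝ → ℝ} {χ : Torus → ℝ} {ψ : ℝ → ℝ}
    (hsep : IsSeparated ρ φ (multiInterval a b) T)
    (hout : ∀ z ∈ phase φ, z ∉ boxRange ρ φ (multiInterval a b) T → h z = 0)
    (hbox : ∀ x ∈ multiInterval a b, ∀ t ∈ Ioo (-T) T, h (flow ρ φ t (x, 0)) = χ x * ψ t)
    (hχ : ∀ x, x ∉ multiInterval a b → χ x = 0) (hψ : ∀ t, t ∉ Ioo (-T) T → ψ t = 0)
    (x : Torus) (r : ℝ) (s : Finset ℤ) (hs : ∀ N, |r - birkhoff ρ φ N x| < T → N ∈ s) :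
    h (flow ρ φ r (x, 0)) = ∑ N ∈ s, χ (x + N • ρ) * ψ (r - birkhoff ρ φ N x) := by
  by_cases hex : ∃ N : ℤ, x + N • ρ ∈ multiInterval a b ∧ |r - birkhoff ρ φ N x| < T
  · obtain ⟨N, hN, hN'⟩ := hex
    rw [Finset.sum_eq_single_of_mem N (hs N hN'), ← hbox _ hN _ (abs_lt.1 hN'),
      flow_add_zsmul hc hcφ]
    intro M _ hMN
    by_cases hM : x + M • ρ ∈ multiInterval a b
    · rw [hψ, mul_zero]
      intro hM'
      exact hMN (hsep x r M N hM hN (abs_lt.2 hM').le hN'.le)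
    · rw [hχ _ hM, zero_mul]
  · rw [hout _ (flow_mem_phase hc hcφ x r), Finset.sum_eq_zero]
    · intro N _
      by_cases hN : x + N • ρ ∈ multiInterval a b
      · rw [hψ, mul_zero]
        exact fun hN' => hex ⟨N, hN, abs_lt.2 hN'⟩
      · rw [hχ _ hN, zero_mul]
    · intro hmem
      simp only [boxRange, mem_iUnion, exists_prop] at hmem
      obtain ⟨t, ht, ⟨y, y₂⟩, hy, hyz⟩ := hmem
      obtain ⟨hyJ, hy2⟩ := hy
      rw [mem_singleton_iff] at hy2
      dsimp only at hyJ hy2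
      subst hy2
      obtain ⟨M, rfl, hM⟩ := exists_of_flow_eq_flow hc hcφ hyz.symm
      exact hex ⟨M, hyJ, by rw [← hM]; exact abs_lt.2 ht⟩

/-! ### Unfolding the correlations -/

/-- The action of `M ∈ ℤ` on the covering space `𝕋⁴ × ℝ` of the phase space. -/
def deck (ρ : Torus) (φ : Torus → ℝ) (M : ℤ) (z : Torus × ℝ) : Torus × ℝ :=
  (z.1 + M • ρ, z.2 - birkhoff ρ φ M z.1)

theorem continuous_deck (hφ : Continuous φ) (M : ℤ) : Continuous (deck ρ φ M) := by
  have := (continuous_birkhoff (ρ := ρ) hφ M).comp (continuous_fst (X := Torus) (Y := ℝ))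
  exact (continuous_fst.add continuous_const).prodMk (continuous_snd.sub this)

theorem deck_deck (M N : ℤ) (z : Torus × ℝ) :
    deck ρ φ N (deck ρ φ M z) = deck ρ φ (M + N) z := by
  simp only [deck, birkhoff_add ρ φ M N, add_smul, add_assoc, sub_sub]

theorem deck_zero (z : Torus × ℝ) : deck ρ φ 0 z = z := by
  simp [deck, birkhoff_zero]

/-- The deck transformation as a homeomorphism. -/
def deckHomeomorph (ρ : Torus) {φ : Torus → ℝ} (hφ : Continuous φ) (M : ℤ) :
    Torus × ℝ ≃ₜ Torus × ℝ where
  toFun := deck ρ φ M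
  invFun := deck ρ φ (-M)
  left_inv z := by rw [deck_deck, add_neg_cancel, deck_zero]
  right_inv z := by rw [deck_deck, neg_add_cancel, deck_zero]
  continuous_toFun := continuous_deck hφ M
  continuous_invFun := continuous_deck hφ (-M)

theorem measurePreserving_deck (hφ : Continuous φ) (M : ℤ) :
    MeasurePreserving (deck ρ φ M) volume volume := by
  have h1 : MeasurePreserving (fun x : Torus => x + M • ρ) volume volume :=
    measurePreserving_add_right volume (M • ρ)
  have hb := continuous_birkhoff (ρ := ρ) hφ M
  refine h1.skew_product (g := fun x s => s - birkhoff ρ φ M x) (μc := volume) (μd := volume)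
    ?_ (Eventually.of_forall fun x => ?_)
  · exact (continuous_snd.sub (hb.comp continuous_fst)).measurable
  · exact (measurePreserving_sub_right volume (birkhoff ρ φ M x)).map_eq

theorem measurableSet_phase (hφ : Continuous φ) : MeasurableSet (phase φ) :=
  (measurableSet_le measurable_const measurable_snd).inter
    (measurableSet_lt measurable_snd (hφ.measurable.comp measurable_fst))

/-- The phase space is a fundamental domain of the covering space. -/
theorem sum_setIntegral_phase_deck (hφ : Continuous φ) (hc : 0 < c) (hcφ : ∀ x, c ≤ φ x)
    {G : Torus × ℝ → ℝ} (hG : Integrable G volume) (s : Finset ℤ)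
    (hs : ∀ z (M : ℤ), G z ≠ 0 → deck ρ φ (-M) z ∈ phase φ → M ∈ s) :
    ∑ M ∈ s, ∫ z in phase φ, G (deck ρ φ M z) = ∫ z, G z := by
  have h1 : ∀ M : ℤ, ∫ z in phase φ, G (deck ρ φ M z) =
      ∫ z in deck ρ φ (-M) ⁻¹' phase φ, G z := fun M => by
    have h2 := (measurePreserving_deck (ρ := ρ) hφ M).setIntegral_preimage_emb
      (deckHomeomorph ρ hφ M).measurableEmbedding G (deck ρ φ (-M) ⁻¹' phase φ)
    rw [← h2, ← preimage_comp]
    have h3 : deck ρ φ (-M) ∘ deck ρ φ M = id := by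
      funext z
      simp [deck_deck, deck_zero]
    rw [h3, preimage_id]
  have hmeas : ∀ M : ℤ, MeasurableSet (deck ρ φ (-M) ⁻¹' phase φ) := fun M =>
    (continuous_deck hφ (-M)).measurable (measurableSet_phase hφ)
  simp_rw [h1]
  rw [← integral_biUnion_finset s (fun M _ => hmeas M) ?_ fun M _ => hG.integrableOn]
  · refine setIntegral_eq_integral_of_forall_compl_eq_zero fun z hz => ?_
    by_contra hne
    obtain ⟨N, hN, hN'⟩ := exists_hits (ρ := ρ) hc hcφ z.1 z.2
    have hmem : deck ρ φ (-(-N)) z ∈ phase φ := by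
      rw [neg_neg]
      exact ⟨hN, hN'⟩
    exact hz (mem_biUnion (hs z (-N) hne hmem) hmem)
  · intro M _ N _ hMN
    rw [Function.onFun, Set.disjoint_left]
    intro z hM hN
    have := hits_unique hc hcφ hM.1 hM.2 hN.1 hN.2
    omega

/-- The correlation of two functions on the flow-box, as an integral over the covering space. -/
theorem correlation_eq_integral (hφ : Continuous φ) (hc : 0 < c) (hcφ : ∀ x, c ≤ φ x)
    (hφc' : ∀ x, φ x ≤ c') {a b : Fin 4 → ℝ} {T : ℝ} {f g : Torus × ℝ → ℝ}
    {χ₁ χ₂ : Torus → ℝ} {ψ₁ ψ₂ : ℝ → ℝ} (hsep : IsSeparated ρ φ (multiInterval a b) T)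
    (hfout : ∀ z ∈ phase φ, z ∉ boxRange ρ φ (multiInterval a b) T → f z = 0)
    (hfbox : ∀ x ∈ multiInterval a b, ∀ t ∈ Ioo (-T) T, f (flow ρ φ t (x, 0)) = χ₂ x * ψ₂ t)
    (hgout : ∀ z ∈ phase φ, z ∉ boxRange ρ φ (multiInterval a b) T → g z = 0)
    (hgbox : ∀ x ∈ multiInterval a b, ∀ t ∈ Ioo (-T) T, g (flow ρ φ t (x, 0)) = χ₁ x * ψ₁ t)
    (hχ₁ : ∀ x, x ∉ multiInterval a b → χ₁ x = 0) (hψ₁ : ∀ t, t ∉ Ioo (-T) T → ψ₁ t = 0)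
    (hχ₂ : ∀ x, x ∉ multiInterval a b → χ₂ x = 0) (hψ₂ : ∀ t, t ∉ Ioo (-T) T → ψ₂ t = 0)
    (hχ₁c : Continuous χ₁) (hψ₁c : Continuous ψ₁) (hχ₂c : Continuous χ₂) (hψ₂c : Continuous ψ₂)
    (t : ℝ) : ∃ s : Finset ℤ, correlation ρ φ f g t = ∫ u in Ioo (-T) T, ψ₁ u *
      ∑ N ∈ s, ∫ x, χ₁ x * χ₂ (x + N • ρ) * ψ₂ (t + u - birkhoff ρ φ N x) := by
  obtain ⟨B, hB⟩ := exists_nat_gt ((|t| + 2 * |T| + |c'|) / c)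
  rw [div_lt_iff₀ hc] at hB
  set s : Finset ℤ := Finset.Icc (-B) B
  -- all indices that matter are in `s`
  have hmem : ∀ (x : Torus) (N : ℤ), |birkhoff ρ φ N x| ≤ |t| + 2 * |T| + |c'| → N ∈ s := by
    intro x N h
    have h1 := mul_abs_le_abs_birkhoff (ρ := ρ) hcφ N x
    have h2 : (|N| : ℤ) ≤ (B : ℤ) := by
      by_contra hlt
      have h3 : (B : ℝ) ≤ (|N| : ℤ) := by exact_mod_cast (not_le.1 hlt).le
      nlinarith
    rw [Finset.mem_Icc]
    exact abs_le.1 h2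
  have hmem' : ∀ (x : Torus) (N : ℤ) (r : ℝ), |r| ≤ |t| + |T| + |c'| →
      |r - birkhoff ρ φ N x| ≤ T → N ∈ s := fun x N r hr h => by
    refine hmem x N ?_
    have h1 := abs_sub_abs_le_abs_sub (birkhoff ρ φ N x) r
    rw [abs_sub_comm] at h1
    linarith [le_abs_self T]
  refine ⟨s, ?_⟩
  set G : Torus × ℝ → ℝ := fun z => ψ₁ z.2 * ∑ N ∈ s, χ₁ z.1 * χ₂ (z.1 + N • ρ) *
    ψ₂ (t + z.2 - birkhoff ρ φ N z.1)
  have hGF : ∀ x u, G (x, u) = f (flow ρ φ (t + u) (x, 0)) * (χ₁ x * ψ₁ u) := fun x u => by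
    by_cases hu : u ∈ Ioo (-T) T
    · rw [IsBoxFunction.apply_flow_eq_sum hc hcφ hsep hfout hfbox hχ₂ hψ₂ x (t + u) s]
      · simp only [G]
        rw [Finset.sum_mul, Finset.mul_sum]
        exact Finset.sum_congr rfl fun N _ => by ring
      · intro N hN
        refine hmem' x N (t + u) ?_ hN.le
        have h1 := abs_add_le t u
        have h2 := abs_lt.2 hu
        linarith [le_abs_self T, abs_nonneg c']
    · simp [G, hψ₁ u hu]
  have hGc : Continuous G := by
    have hb := fun N : ℤ => (continuous_birkhoff (ρ := ρ) hφ N).comp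
      (continuous_fst (X := Torus) (Y := ℝ))
    simp only [Function.comp_def] at hb
    refine (hψ₁c.comp continuous_snd).mul (continuous_finsetSum _ fun N _ => ?_)
    have hb' := hb N
    fun_prop
  have hGs : HasCompactSupport G := by
    refine HasCompactSupport.of_support_subset_isCompact
      (isCompact_univ.prod (isCompact_Icc (a := -T) (b := T))) fun z hz => ⟨mem_univ _, ?_⟩
    by_contra hz2
    refine hz ?_
    simp only [G]
    rw [hψ₁ z.2 fun h => hz2 (Ioo_subset_Icc_self h), zero_mul]
  have hGi : Integrable G volume := hGc.integrable_of_hasCompactSupport hGs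
  have hGdeck : ∀ x u (M : ℤ), G (deck ρ φ M (x, u)) =
      f (flow ρ φ (t + u) (x, 0)) * (χ₁ (x + M • ρ) * ψ₁ (u - birkhoff ρ φ M x)) := by
    intro x u M
    rw [deck, hGF]
    dsimp only
    rw [← add_sub_assoc, flow_add_zsmul hc hcφ]
  have hcorr : correlation ρ φ f g t = ∑ M ∈ s, ∫ z in phase φ, G (deck ρ φ M z) := by
    rw [correlation, phaseMeasure, ← integral_finsetSum]
    · refine setIntegral_congr_fun (measurableSet_phase hφ) fun z hz => ?_
      obtain ⟨x, u⟩ := z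
      have hg := IsBoxFunction.apply_flow_eq_sum hc hcφ hsep hgout hgbox hχ₁ hψ₁ x u s ?_
      · rw [flow_of_mem_phase hc hcφ hz] at hg
        rw [flow_eq_flow_zero, hg, Finset.mul_sum]
        exact Finset.sum_congr rfl fun M _ => (hGdeck x u M).symm
      · intro N hN
        refine hmem' x N u ?_ hN.le
        have h1 : 0 ≤ u := hz.1
        have h2 : u < φ x := hz.2
        rw [abs_of_nonneg h1]
        linarith [hφc' x, le_abs_self c', abs_nonneg t, abs_nonneg T]
    · intro M _
      have := (measurePreserving_deck (ρ := ρ) hφ M).integrable_comp_of_integrable hGi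
      exact this.integrableOn
  rw [hcorr, sum_setIntegral_phase_deck hφ hc hcφ hGi s, Measure.volume_eq_prod,
    integral_prod_symm _ (by rwa [← Measure.volume_eq_prod]),
    setIntegral_eq_integral_of_forall_compl_eq_zero]
  · refine integral_congr_ae (Eventually.of_forall fun u => ?_)
    simp only [G]
    rw [integral_const_mul, integral_finsetSum]
    intro N _
    have hb := continuous_birkhoff (ρ := ρ) hφ N
    exact Continuous.integrable_of_hasCompactSupport (by fun_prop)
      (HasCompactSupport.of_compactSpace _)
  · intro u hu
    rw [hψ₁ u hu, zero_mul]
  · rintro ⟨x, u⟩ M hne hM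
    have hu : u ∈ Ioo (-T) T := by
      by_contra hu
      apply hne
      simp [G, hψ₁ u hu]
    have h1 : 0 ≤ u - birkhoff ρ φ (-M) x := hM.1
    have h2 : u - birkhoff ρ φ (-M) x < φ (x + (-M) • ρ) := hM.2
    have h3 := hmem x (-M) (by
      rw [abs_le]
      have := hφc' (x + (-M) • ρ)
      have := hu.1
      have := hu.2
      have := le_abs_self T
      have := le_abs_self c'
      have := abs_nonneg t
      have := abs_nonneg T
      have := abs_nonneg c'
      constructor <;> linarith)
    rw [Finset.mem_Icc] at h3 ⊢
    omega

/-! ### Return times and transfer functions -/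

/-- The return time is the supremum of a bounded set, since almost every orbit of the translation
is recurrent. -/
theorem two_mul_le_returnTime (hc : 0 < c) (hcφ : ∀ x, c ≤ φ x) {J : Set Torus}
    (hJ : MeasurableSet J) (hJ0 : volume J ≠ 0) {T : ℝ} (hsep : IsSeparated ρ φ J T) :
    2 * T ≤ returnTime ρ φ J := by
  have hbase : ∀ x : Torus, flow ρ φ 0 (x, 0) = (x, 0) := fun x =>
    flow_of_mem_phase hc hcφ ⟨le_rfl, hc.trans_le (hcφ x)⟩
  refine le_csSup ?_ ?_
  · have hcons : Conservative (fun x : Torus => x + ρ) volume :=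
      (measurePreserving_add_right volume ρ).conservative
    obtain ⟨x, hx, m, hm, hxm⟩ := hcons.exists_mem_iterate_mem hJ.nullMeasurableSet hJ0
    rw [add_right_iterate] at hxm
    have hS : 0 < birkhoff ρ φ m x := by
      have h1 := le_birkhoff_sub (ρ := ρ) hcφ (M := 0) (N := m) (by omega) x
      rw [birkhoff_zero, sub_zero, sub_zero] at h1
      have h2 : (0 : ℝ) < m := by exact_mod_cast Nat.pos_of_ne_zero hm
      push_cast at h1
      have := mul_pos hc h2
      linarith
    refine ⟨birkhoff ρ φ m x, fun τ hτ => ?_⟩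
    by_contra hlt
    have hdis := hτ (birkhoff ρ φ m x) (by rwa [abs_of_pos hS])
      (by rw [abs_of_pos hS]; exact not_le.1 hlt)
    have hflow : flow ρ φ (birkhoff ρ φ m x) (x, 0) = (x + m • ρ, 0) := by
      have h1 := flow_add_zsmul (ρ := ρ) hc hcφ x (birkhoff ρ φ m x) m
      rw [sub_self, hbase] at h1
      rw [← h1, natCast_zsmul]
    refine Set.disjoint_left.1 hdis (mem_image_of_mem _ (show (x, (0 : ℝ)) ∈ base J from
      ⟨hx, rfl⟩)) ?_
    rw [hflow]
    exact ⟨hxm, rfl⟩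
  · intro t ht htT
    rw [Set.disjoint_left]
    rintro _ ⟨⟨x, x₂⟩, ⟨hx, hx2⟩, rfl⟩ ⟨hy, hy2⟩
    rw [mem_singleton_iff] at hx2 hy2
    dsimp only at hx hx2
    subst hx2
    obtain ⟨M, hM, hM'⟩ := exists_of_flow_eq_flow (x := x) (r := t)
      (y := (flow ρ φ t (x, 0)).1) (r' := 0) hc hcφ (by rw [hbase]; exact Prod.ext rfl hy2)
    rw [hM] at hy
    have h0 := hsep x (t / 2) 0 M (by simpa using hx) hy
      (by
        rw [birkhoff_zero, sub_zero, abs_div, abs_two]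
        linarith)
      (by
        rw [show birkhoff ρ φ M x = t by linarith, show t / 2 - t = -(t / 2) by ring, abs_neg,
          abs_div, abs_two]
        linarith)
    rw [← h0, birkhoff_zero, sub_zero] at hM'
    rw [← hM', abs_zero] at ht
    exact lt_irrefl _ ht

/-- A coboundary on the flow-box has a time profile of integral `0`. -/
theorem integral_timeProfile_eq_zero (hc : 0 < c) (hcφ : ∀ x, c ≤ φ x) {a b : Fin 4 → ℝ}
    {T : ℝ} (hT : 0 < T) {f u : Torus × ℝ → ℝ} {χ : Torus → ℝ} {ψ : ℝ → ℝ}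
    (hsep : IsSeparated ρ φ (multiInterval a b) T)
    (hfbox : ∀ x ∈ multiInterval a b, ∀ t ∈ Ioo (-T) T, f (flow ρ φ t (x, 0)) = χ x * ψ t)
    (hχ : ∀ x, x ∉ multiInterval a b → χ x = 0)
    (hχ2 : ∫ x in multiInterval a b, χ x ^ 2 = 1)
    (hu : IsTransferFunction ρ φ f u)
    (hu0 : ∀ z ∈ phase φ, z ∉ boxRange ρ φ (multiInterval a b) T → u z = 0) :
    ∫ t in (-T)..T, ψ t = 0 := by
  obtain ⟨y, hy⟩ : ∃ y, χ y ≠ 0 := by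
    by_contra! h
    simp [h] at hχ2
  have hyJ : y ∈ multiInterval a b := by
    by_contra h
    exact hy (hχ y h)
  -- the ends of the orbit piece through `y` are not in the flow-box
  have hend : ∀ r, |r| = T → u (flow ρ φ r (y, 0)) = 0 := fun r hr => by
    refine hu0 _ (flow_mem_phase hc hcφ y r) fun hmem => ?_
    simp only [boxRange, mem_iUnion, exists_prop] at hmem
    obtain ⟨t, ht, ⟨x, x₂⟩, ⟨hx, hx2⟩, hxz⟩ := hmem
    rw [mem_singleton_iff] at hx2
    dsimp only at hx hx2
    subst hx2
    obtain ⟨M, rfl, hM⟩ := exists_of_flow_eq_flow hc hcφ hxz.symm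
    have ht' := abs_lt.2 ht
    have h0 := hsep y r 0 M (by simpa using hyJ) hx (by simp [birkhoff_zero, hr])
      (by rw [← hM]; exact ht'.le)
    rw [← h0, birkhoff_zero, sub_zero] at hM
    rw [hM, hr] at ht'
    exact lt_irrefl _ ht'
  have h1 := hu.2 (y, 0) ⟨le_rfl, hc.trans_le (hcφ y)⟩ (-T) T (by linarith)
  rw [hend T (abs_of_pos hT), hend (-T) (by rw [abs_neg, abs_of_pos hT]), sub_zero,
    intervalIntegral.integral_of_le (by linarith), integral_Ioc_eq_integral_Ioo,
    setIntegral_congr_fun measurableSet_Ioo (hfbox y hyJ), integral_const_mul] at h1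
  rw [intervalIntegral.integral_of_le (by linarith), integral_Ioc_eq_integral_Ioo]
  exact (mul_eq_zero.1 h1).resolve_left hy

theorem isTimeCoboundary_integral {T C : ℝ} (hT : 0 < T) {ψ : ℝ → ℝ}
    (hψ : IsTimeProfile (Ioo (-T) T) C ψ) (h0 : ∫ t in (-T)..T, ψ t = 0) :
    IsTimeCoboundary T (C * (1 + 2 * T)) ψ fun t => ∫ u in (-T)..t, ψ u := by
  have hc : Continuous ψ := hψ.smooth.continuous
  have hb : ∀ t, |ψ t| ≤ C := fun t =>
    (le_add_of_nonneg_right (abs_nonneg _)).trans (hψ.bound t t)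
  have hC : 0 ≤ C := (abs_nonneg _).trans (hb 0)
  have hzero : ∀ t, T < |t| → ψ t = 0 := fun t ht =>
    hψ.support t fun h => lt_asymm ht (abs_lt.2 h)
  have hi : ∀ a b, IntervalIntegrable ψ volume a b := fun a b => hc.intervalIntegrable a b
  have hzero' : ∀ t, T < |t| → ∫ u in (-T)..t, ψ u = 0 := fun t ht => by
    rcases lt_abs.1 ht with h | h
    · rw [← intervalIntegral.integral_add_adjacent_intervals (hi (-T) T) (hi T t), h0, zero_add]
      refine intervalIntegral.integral_zero_ae (Eventually.of_forall fun u hu => ?_)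
      rw [uIoc_of_le h.le] at hu
      exact hzero u (hu.1.trans_le (le_abs_self u))
    · refine intervalIntegral.integral_zero_ae (Eventually.of_forall fun u hu => ?_)
      rw [uIoc_of_ge (by linarith)] at hu
      refine hψ.support u fun h' => ?_
      linarith [h'.1, hu.2]
  refine ⟨hc, fun t => ?_, fun t => ?_, fun t => ?_, hzero, hzero'⟩
  · exact intervalIntegral.integral_hasDerivAt_right (hi _ _)
      (hc.stronglyMeasurableAtFilter _ _) hc.continuousAt
  · refine (hb t).trans ?_
    nlinarith
  · rcases lt_or_ge T |t| with h | h
    · rw [hzero' t h, abs_zero]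
      positivity
    · have h1 := intervalIntegral.norm_integral_le_of_norm_le_const (a := -T) (b := t)
        (f := ψ) (C := C) fun u _ => hb u
      refine h1.trans ?_
      have h2 : |t - -T| ≤ 1 + 2 * T := by
        have := abs_le.1 h
        rw [abs_le]
        constructor <;> linarith
      gcongr

end Flow

/-! ### Decay of correlations -/

section Correlation

variable {α : Fin 4 → ℝ} {n₀ : ℕ} {c c' : ℝ}

/-- For times beyond the trivial range `[-2 T, 2 T]`, the correlations vanish before the first
return to `J_n`, and decay like `|t| ^ (-7/12)` afterwards. -/
theorem exists_abs_correlation_le (hα : α ∈ Y) (hc : 0 < c)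
    (hcφ : ∀ x, c ≤ ceiling α n₀ x) (hφc' : ∀ x, ceiling α n₀ x ≤ c') {T C : ℝ} (hT : 0 < T)
    (hC : 0 < C) (ζ : ℝ) :
    ∃ K : ℝ, 0 < K ∧ ∀ n, n₀ ≤ n → 24 ≤ n →
      Real.exp (12 * convDen (α 2) n) ≤ c * convDen (α 3) n - T →
      2 * T ≤ c * convDen (α 3) n - T →
      ∀ f ∈ classF (proj α) (ceiling α n₀) (leftEnd α n) (rightEnd α n) T C,
      ∀ g ∈ classG (proj α) (ceiling α n₀) (leftEnd α n) (rightEnd α n) T C ζ,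
      ∀ t : ℝ, 2 * T < |t| →
        |correlation (proj α) (ceiling α n₀) f g t| ≤ K * (1 + |t|) ^ (-(7 / 12) : ℝ) ∧
        (|t| < c * convDen (α 3) n - 2 * T →
          correlation (proj α) (ceiling α n₀) f g t = 0) := by
  obtain ⟨K, hK, hdecay⟩ := exists_abs_sum_integral_le (C := C) (P := C * (1 + 2 * T)) hα hc hcφ
    hφc' hT (by positivity)
  set k : ℝ := (1 / 4 : ℝ) ^ (-(7 / 12) : ℝ)
  have hk : 0 < k := Real.rpow_pos_of_pos (by norm_num) _
  refine ⟨C * (K * k) * (2 * T), by positivity, fun n hn hn24 hQ hQT f hf g hg t ht => ?_⟩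
  set Q := c * convDen (α 3) n - T with hQdef
  set φ := ceiling α n₀
  set S := birkhoff (proj α) φ
  have hφ : Continuous φ := continuous_ceiling hα n₀
  have hTn : 2 * T < c * convDen (α 3) n := by linarith
  have hsep := isSeparated_interval hα hcφ hc (by omega : 2 ≤ n) hTn
  obtain ⟨⟨-, hfout, χ₂, ψ₂, hχ₂, hψ₂, hfbox⟩, u, hu, hu0⟩ := hf
  obtain ⟨-, hgout, χ₁, ψ₁, hχ₁, hψ₁, hgbox⟩ := hg
  have hψ₁0 : ∀ s, s ∉ Ioo (-T) T → ψ₁ s = 0 := fun s hs => hψ₁.support s fun h => hs h.1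
  have hint := integral_timeProfile_eq_zero hc hcφ hT hsep hfbox hχ₂.support hχ₂.normalized hu hu0
  have hcob := isTimeCoboundary_integral hT hψ₂ hint
  obtain ⟨s, hs⟩ := correlation_eq_integral hφ hc hcφ hφc' hsep hfout hfbox hgout hgbox
    hχ₁.support hψ₁0 hχ₂.support hψ₂.support hχ₁.continuous hψ₁.smooth.continuous hχ₂.continuous
    hψ₂.smooth.continuous t
  set I : ℝ → ℝ := fun r => ∑ N ∈ s, ∫ x, χ₁ x * χ₂ (x + N • proj α) * ψ₂ (r - S N x)
  have hr : ∀ v ∈ Ioo (-T) T, |t| - T < |t + v| ∧ |t + v| < |t| + T := fun v hv => by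
    have h1 := abs_add_le t v
    have h2 := abs_sub (t + v) v
    rw [add_sub_cancel_right] at h2
    have h3 := abs_lt.2 hv
    constructor <;> linarith
  -- before the first return to `J_n` there is only the visit at time `0`
  have hI0 : ∀ r, T < |r| → |r| < Q → I r = 0 := fun r hrT hrQ => by
    refine Finset.sum_eq_zero fun N _ => ?_
    rw [← integral_zero Torus ℝ]
    congr 1
    funext x
    by_cases hx : x ∈ interval α n
    · by_cases hxN : x + N • proj α ∈ interval α n
      · rw [hcob.eq_zero, mul_zero]
        rcases eq_or_ne N 0 with rfl | hN
        · simpa [S, birkhoff_zero] using hrT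
        · have h1 := le_abs_of_mem_interval hα (by omega) hx hxN hN
          have h2 : (convDen (α 3) n : ℝ) ≤ (|N| : ℤ) := by exact_mod_cast h1
          have h3 : c * (|N| : ℤ) ≤ |S N x| := mul_abs_le_abs_birkhoff hcφ N x
          have h4 := abs_sub_abs_le_abs_sub (S N x) r
          rw [abs_sub_comm] at h4
          have h5 := mul_le_mul_of_nonneg_left h2 hc.le
          linarith
      · rw [hχ₂.support _ hxN, mul_zero, zero_mul]
    · rw [hχ₁.support _ hx, zero_mul, zero_mul]
  constructor
  · have hI : ∀ v ∈ Ioo (-T) T, |I (t + v)| ≤ K * k * (1 + |t|) ^ (-(7 / 12) : ℝ) := fun v hv => by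
      obtain ⟨h1, h2⟩ := hr v hv
      rcases lt_or_ge |t + v| Q with hlt | hge
      · rw [hI0 _ (by linarith) hlt, abs_zero]
        positivity
      · have hge1 : 1 ≤ |t + v| := (Real.one_le_exp (by positivity)).trans (hQ.trans hge)
        refine (hdecay n hn hn24 hTn χ₁ χ₂ hχ₁ hχ₂ ψ₂ _ hcob (t + v) (hQ.trans hge)
          (hQT.trans hge) s).trans ?_
        rw [mul_assoc, ← Real.mul_rpow (by norm_num) (by positivity)]
        refine mul_le_mul_of_nonneg_left ?_ hK.le
        exact Real.rpow_le_rpow_of_nonpos (by positivity) (by linarith) (by norm_num)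
    rw [hs]
    have h1 := norm_setIntegral_le_of_norm_le_const (μ := volume) (s := Ioo (-T) T)
      (f := fun v => ψ₁ v * I (t + v)) (C := C * (K * k * (1 + |t|) ^ (-(7 / 12) : ℝ))) (by simp)
      fun v hv => by
        rw [norm_mul]
        gcongr
        · exact (le_add_of_nonneg_right (abs_nonneg _)).trans (hψ₁.bound v v)
        · exact hI v hv
    refine h1.trans (le_of_eq ?_)
    rw [Real.volume_real_Ioo_of_le (by linarith)]
    ring
  · intro htQ
    rw [hs]
    refine setIntegral_eq_zero_of_forall_eq_zero fun v hv => ?_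
    obtain ⟨h1, h2⟩ := hr v hv
    change ψ₁ v * I (t + v) = 0
    rw [hI0 _ (by linarith) (by linarith), mul_zero]

/-- The first return time to `J_n`, of order `q_n^{(4)}`, is much larger than
`exp (12 q_n^{(3)})`. -/
theorem eventually_exp_le (hα : α ∈ Y) (hc : 0 < c) (T : ℝ) :
    ∀ᶠ n in atTop, Real.exp (12 * convDen (α 2) n) ≤ c * convDen (α 3) n - T := by
  have h1 : Tendsto (fun n : ℕ => c * Real.exp ((n : ℝ) - 12)) atTop atTop :=
    (Real.tendsto_exp_atTop.comp
      (tendsto_atTop_add_const_right _ (-12) tendsto_natCast_atTop_atTop)).const_mul_atTop hc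
  filter_upwards [h1.eventually_ge_atTop (1 + |T|), eventually_ge_atTop 12] with n hn hn12
  have hq : (1 : ℝ) ≤ convDen (α 2) n := by exact_mod_cast one_le_convDen _ _
  have h2 : Real.exp (n * convDen (α 2) n) ≤ convDen (α 3) n := (hα.2 n (by omega)).2.2.1
  have hn12' : (12 : ℝ) ≤ n := by exact_mod_cast hn12
  have h3 : Real.exp ((n : ℝ) - 12) * Real.exp (12 * convDen (α 2) n) ≤
      Real.exp (n * convDen (α 2) n) := by
    rw [← Real.exp_add]
    gcongr
    nlinarith
  have h4 : 1 ≤ Real.exp (12 * (convDen (α 2) n : ℝ)) := Real.one_le_exp (by positivity)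
  have h5 := le_abs_self T
  have h6 : (1 + |T|) * Real.exp (12 * convDen (α 2) n) ≤ c * convDen (α 3) n := by
    calc _ ≤ c * Real.exp ((n : ℝ) - 12) * Real.exp (12 * convDen (α 2) n) := by gcongr
      _ = c * (Real.exp ((n : ℝ) - 12) * Real.exp (12 * convDen (α 2) n)) := by ring
      _ ≤ _ := by gcongr; exact h3.trans h2
  nlinarith [abs_nonneg T]

end Correlation

/-- The tails of an integrable power of `1 + |t|` tend to `0`. -/
theorem tendsto_lintegral_tail (K : ℝ) {R : ℕ → ℝ} (hR : Tendsto R atTop atTop) :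
    Tendsto (fun n => ∫⁻ t : ℝ, {t : ℝ | R n ≤ |t|}.indicator
      (fun t => ENNReal.ofReal (K * (1 + |t|) ^ (-(7 / 6) : ℝ))) t) atTop (𝓝 0) := by
  have hint : Integrable (fun t : ℝ => K * (1 + |t|) ^ (-(7 / 6) : ℝ)) volume :=
    (integrable_one_add_norm (E := ℝ) (r := 7 / 6) (by simp; norm_num)).const_mul K
  have hm : Measurable fun t : ℝ => ENNReal.ofReal (K * (1 + |t|) ^ (-(7 / 6) : ℝ)) := by
    fun_prop
  have h := tendsto_lintegral_of_dominated_convergence (μ := (volume : Measure ℝ))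
    (F := fun n t => {t : ℝ | R n ≤ |t|}.indicator
      (fun t => ENNReal.ofReal (K * (1 + |t|) ^ (-(7 / 6) : ℝ))) t) (f := fun _ => 0)
    (fun t : ℝ => ENNReal.ofReal (K * (1 + |t|) ^ (-(7 / 6) : ℝ)))
    (fun n => hm.indicator (measurableSet_le measurable_const measurable_id.abs))
    (fun n => Eventually.of_forall fun t => indicator_le_self _ _ t)
    hint.lintegral_lt_top.ne
    (Eventually.of_forall fun t => ?_)
  · simpa using h
  · refine tendsto_const_nhds.congr' ?_
    filter_upwards [hR.eventually_gt_atTop |t|] with n hn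
    rw [indicator_of_notMem]
    simpa using hn

end TorusFlow

end

theorem mainTheorem7 (α : Fin 4 → ℝ) (hα : α ∈ TorusFlow.Y) (n₀ : ℕ)
    (hpos : ∀ x, 0 < TorusFlow.ceiling α n₀ x)
    (T C ζ : ℝ) (hT : 0 < T) (hC : 0 < C) (hζ : 0 < ζ)
    (f g : ℕ → TorusFlow.Torus × ℝ → ℝ)
    (hf : ∀ᶠ n in atTop, f n ∈ TorusFlow.classF (TorusFlow.proj α) (TorusFlow.ceiling α n₀)
      (TorusFlow.leftEnd α n) (TorusFlow.rightEnd α n) T C)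
    (hg : ∀ᶠ n in atTop, g n ∈ TorusFlow.classG (TorusFlow.proj α) (TorusFlow.ceiling α n₀)
      (TorusFlow.leftEnd α n) (TorusFlow.rightEnd α n) T C ζ) :
    Tendsto (fun n : ℕ =>
      ∫⁻ t in (Icc
          (-TorusFlow.returnTime (TorusFlow.proj α) (TorusFlow.ceiling α n₀)
            (TorusFlow.multiInterval (TorusFlow.leftEnd α n) (TorusFlow.rightEnd α n)))
          (TorusFlow.returnTime (TorusFlow.proj α) (TorusFlow.ceiling α n₀)
            (TorusFlow.multiInterval (TorusFlow.leftEnd α n) (TorusFlow.rightEnd α n))))ᶜ,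
        ENNReal.ofReal (|TorusFlow.correlation (TorusFlow.proj α) (TorusFlow.ceiling α n₀)
          (f n) (g n) t| ^ 2))
      atTop (𝓝 0) := by
  have hφ := TorusFlow.continuous_ceiling hα n₀
  obtain ⟨xm, -, hxm⟩ := isCompact_univ.exists_isMinOn univ_nonempty hφ.continuousOn
  obtain ⟨xM, -, hxM⟩ := isCompact_univ.exists_isMaxOn univ_nonempty hφ.continuousOn
  have hcφ : ∀ x, TorusFlow.ceiling α n₀ xm ≤ TorusFlow.ceiling α n₀ x := fun x => hxm (mem_univ x)
  have hφc' : ∀ x, TorusFlow.ceiling α n₀ x ≤ TorusFlow.ceiling α n₀ xM := fun x => hxM (mem_univ x)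
  have hc := hpos xm
  set c := TorusFlow.ceiling α n₀ xm
  obtain ⟨K, hK, hcorr⟩ := TorusFlow.exists_abs_correlation_le hα hc hcφ hφc' hT hC ζ
  have hR : Tendsto (fun n => c * TorusFlow.convDen (α 3) n - 2 * T) atTop atTop :=
    tendsto_atTop_add_const_right _ _
      ((tendsto_natCast_atTop_atTop.comp (TorusFlow.tendsto_convDen hα 3)).const_mul_atTop hc)
  refine tendsto_of_tendsto_of_tendsto_of_le_of_le' tendsto_const_nhds
    (TorusFlow.tendsto_lintegral_tail (K ^ 2) hR) (Eventually.of_forall fun _ => zero_le) ?_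
  filter_upwards [hf, hg, TorusFlow.eventually_exp_le hα hc T, hR.eventually_ge_atTop T,
    eventually_ge_atTop n₀, eventually_ge_atTop 24] with n hfn hgn hQ hQT hn hn24
  have hsep := TorusFlow.isSeparated_interval hα hcφ hc (by omega : 2 ≤ n)
    (by linarith : 2 * T < c * TorusFlow.convDen (α 3) n)
  have hJ0 : volume (TorusFlow.interval α n) ≠ 0 := fun h0 => by
    have h := TorusFlow.volume_real_interval_pos α n
    rw [Measure.real, h0] at h
    simp at h
  have hret := TorusFlow.two_mul_le_returnTime hc hcφ
    (TorusFlow.isClosed_interval α n).measurableSet hJ0 hsep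
  refine le_trans (setLIntegral_mono' measurableSet_Icc.compl fun t ht => ?_)
    (setLIntegral_le_lintegral _ _)
  have ht2 : 2 * T < |t| := by
    by_contra hle
    refine ht (abs_le.1 ((not_lt.1 hle).trans ?_))
    exact hret
  obtain ⟨h1, h2⟩ := hcorr n hn hn24 hQ (by linarith) (f n) hfn (g n) hgn t ht2
  by_cases htR : c * TorusFlow.convDen (α 3) n - 2 * T ≤ |t|
  · rw [indicator_of_mem (show t ∈ {t : ℝ | _ ≤ |t|} from htR)]
    refine ENNReal.ofReal_le_ofReal ?_
    have h3 : 0 ≤ 1 + |t| := by positivity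
    calc _ ≤ (K * (1 + |t|) ^ (-(7 / 12) : ℝ)) ^ 2 := by gcongr
      _ = _ := by
        rw [mul_pow, ← Real.rpow_natCast (_ ^ _), ← Real.rpow_mul h3]
        norm_num
  · rw [h2 (not_le.1 htR)]
    simp
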